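/- For $\tau\in\mathcal H=\{\tau\in\mathbb C:\operatorname{Im}\tau>0\}$ write $q=e^{2\pi i\tau}$, $y=\operatorname{Im}\tau$, and let $\sqrt{\cdot}$ be the principal square root. For $u,v\notin\mathbb Z+\tau\mathbb Z$ put $$\vartheta(z;\tau)=\sum_{n\in\mathbb Z+\frac12}e^{\pi i n^2\tau+2\pi i n(z+\frac12)},\qquad \mu(u,v;\tau)=\frac{e^{\pi i u}}{\vartheta(v;\tau)}\sum_{n\in\mathbb Z}\frac{(-1)^n e^{\pi i n(n+1)\tau+2\pi i n v}}{1-e^{2\pi i n\tau+2\pi i u}},$$ $$R(u;\tau)=\sum_{n\in\mathbb Z+\frac12}\Bigl(\operatorname{sgn}(n)-E\bigl((n+\tfrac{\operatorname{Im}u}{y})\sqrt{2y}\bigr)\Bigr)(-1)^{n-\frac12}e^{-\pi i n^2\tau-2\pi i n u},\qquad E(x)=2\int_0^x e^{-\pi w^2}\,dw,$$ and $\tilde\mu(u,v;\tau)=\mu(u,v;\tau)+\frac i2R(u-v;\tau)$. For an integer $k$ with $7\nmid k$ let $$N_7(k;\tau)=q^{-k^2+7k-\frac{49}{4}}\,\tilde\mu(14k\tau,49\tau;98\tau).$$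 For $A=\begin{pmatrix}\alpha&\beta\\\gamma&\delta\end{pmatrix}\in\mathrm{SL}_2(\mathbb Z)$ let $\nu(A)$ be the multiplier of the Dedekind eta function, $\eta(A\tau)=\nu(A)\sqrt{\gamma\tau+\delta}\,\eta(\tau)$, and for even $\gamma$ let ${}^2A=\begin{pmatrix}\alpha&2\beta\\\gamma/2&\delta\end{pmatrix}$. For odd $n$ let $\left(\frac mn\right)$ be the Jacobi symbol, extended by $\left(\frac mn\right)=-\left(\frac m{|n|}\right)$ if $m<0$ and $n<0$, and $\left(\frac mn\right)=\left(\frac m{|n|}\right)$ otherwise; let $\varepsilon(\delta)=1$ if $\delta\equiv1\pmod 4$ and $\varepsilon(\delta)=i$ otherwise. A harmonic weak Maass form of weight $\frac{\kappa}{2}$ ($\kappa$ an odd integer) on a congruence subgroup $\Gamma\subseteq\Gamma_0(4)$ is a smooth function $f:\mathcal H\to\mathbb C$ such that, with $\tau=x+iy$, * $f(A\tau)=\left(\frac\gamma\delta\right)^{\kappa}\varepsilon(\delta)^{-\kappa}(\gamma\tau+\delta)^{\kappa/2}f(\tau)$ for all $A\in\Gamma$ and $\tau\in\mathcal H$; *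 $\Delta_{\kappa/2}f=0$, where $\Delta_{w}=-y^2\left(\frac{\partial^2}{\partial x^2}+\frac{\partial^2}{\partial y^2}\right)+iwy\left(\frac{\partial}{\partial x}+i\frac{\partial}{\partial y}\right)$; * for each $B=\begin{pmatrix}a&b\\c&d\end{pmatrix}\in\mathrm{SL}_2(\mathbb Z)$ there is a constant $C$ with $(c\tau+d)^{-\kappa/2}f(B\tau)=O(e^{Cy})$ as $y\to\infty$, uniformly in $x$. **Statement.** Let $k$ be an integer with $7\nmid k$. 1. For every $A=\begin{pmatrix}\alpha&\beta\\\gamma&\delta\end{pmatrix}\in\Gamma_1(14)\cap\Gamma_0(98)$ and $\tau\in\mathcal H$, $$N_7(k;A\tau)=\nu({}^2A)^{-3}\,(-1)^{\beta+\frac{\alpha-1}{2}}\,i^{-\alpha\beta}\,\sqrt{\gamma\tau+\delta}\;N_7(k;\tau).$$ 2. For every $A=\begin{pmatrix}\alpha&\beta\\\gamma&\delta\end{pmatrix}\in\Gamma_1(28)\cap\Gamma_0(784)$ and $\tau\in\mathcal H$, $$N_7(k;A\tau)=\left(\frac\gamma\delta\right)\sqrt{\gamma\tau+\delta}\;N_7(k;\tau).$$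 3. $N_7(k;\tau)$ is a harmonic weak Maass form of weight $\frac12$ on $\Gamma_1(28)\cap\Gamma_0(784)$. -/

import Mathlib

open scoped MatrixGroups

namespace ZwegersForms

noncomputable section

/-- The Jacobi theta function
`ϑ(z; τ) = ∑_{n ∈ ℤ + 1/2} exp(π i n² τ + 2 π i n (z + 1/2))`. -/
def theta (z τ : ℂ) : ℂ :=
  ∑' m : ℤ, Complex.exp (Real.pi * Complex.I * ((m : ℂ) + 1 / 2) ^ 2 * τ +
    2 * Real.pi * Complex.I * ((m : ℂ) + 1 / 2) * (z + 1 / 2))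

/-- The Appell-Lerch sum `μ(u, v; τ)`, used for `u, v ∉ ℤ + τℤ`. -/
def mu (u v τ : ℂ) : ℂ :=
  Complex.exp (Real.pi * Complex.I * u) / theta v τ *
    ∑' n : ℤ, (-1 : ℂ) ^ n *
        Complex.exp (Real.pi * Complex.I * n * (n + 1) * τ + 2 * Real.pi * Complex.I * n * v) /
      (1 - Complex.exp (2 * Real.pi * Complex.I * n * τ + 2 * Real.pi * Complex.I * u))

/-- `E(x) = 2 ∫₀ˣ exp(-π w²) dw`; only real arguments are needed. -/
def E (x : ℝ) : ℝ := 2 * ∫ w in (0 : ℝ)..x, Real.exp (-Real.pi * w ^ 2)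

/-- `R(u; τ) = ∑_{n ∈ ℤ + 1/2} (sgn(n) - E((n + a)√(2y))) (-1)^{n - 1/2} exp(-π i n² τ - 2 π i n u)`
with `y = Im τ` and `a = Im u / Im τ`. -/
def R (u τ : ℂ) : ℂ :=
  ∑' m : ℤ,
    ((Real.sign ((m : ℝ) + 1 / 2) -
        E (((m : ℝ) + 1 / 2 + u.im / τ.im) * Real.sqrt (2 * τ.im)) : ℝ) : ℂ) *
      (-1 : ℂ) ^ m *
      Complex.exp (-Real.pi * Complex.I * ((m : ℂ) + 1 / 2) ^ 2 * τ -
        2 * Real.pi * Complex.I * ((m : ℂ) + 1 / 2) * u)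

/-- The completed sum `μ̃(u, v; τ) = μ(u, v; τ) + (i/2) R(u - v; τ)`. -/
def muTilde (u v τ : ℂ) : ℂ := mu u v τ + Complex.I / 2 * R (u - v) τ

/-- `N₇(k; τ) = q^{-k² + 7k - 49/4} μ̃(14kτ, 49τ; 98τ)` with `q = exp(2πiτ)`. -/
def N7 (k : ℤ) (τ : UpperHalfPlane) : ℂ :=
  Complex.exp (2 * Real.pi * Complex.I * τ * (-(k : ℂ) ^ 2 + 7 * k - 49 / 4)) *
    muTilde (14 * k * τ) (49 * τ) (98 * τ)

/-- The automorphy factor `γτ + δ` of a matrix with bottom row `(γ, δ)`. -/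
def autFactor (A : SL(2, ℤ)) (τ : UpperHalfPlane) : ℂ :=
  ((A 1 0 : ℤ) : ℂ) * τ + ((A 1 1 : ℤ) : ℂ)

/-- The multiplier `ν(A)` of Dedekind's eta function, that is, the constant with
`η(Aτ) = ν(A) √(γτ + δ) η(τ)` for all `τ` (principal square root).  The quotient does not depend on
`τ` (this is `eta_smul` below), so that it can be read off at `τ = i`. -/
def etaMultiplier (A : SL(2, ℤ)) : ℂ :=
  ModularForm.eta ((A • UpperHalfPlane.I : UpperHalfPlane) : ℂ) /
    (Complex.sqrt (autFactor A UpperHalfPlane.I) *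
      ModularForm.eta ((UpperHalfPlane.I : UpperHalfPlane) : ℂ))

theorem eta_smul (A : SL(2, ℤ)) (τ : UpperHalfPlane) :
    ModularForm.eta ((A • τ : UpperHalfPlane) : ℂ) =
      etaMultiplier A * Complex.sqrt (autFactor A τ) * ModularForm.eta (τ : ℂ) := by
  have hj (σ : UpperHalfPlane) : autFactor A σ ≠ 0 := by
    have h := UpperHalfPlane.denom_ne_zero (A : GL (Fin 2) ℝ) σ
    rwa [ModularGroup.denom_apply] at h
  have hs (σ : UpperHalfPlane) : Complex.sqrt (autFactor A σ) ≠ 0 := by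
    simp [Complex.sqrt, hj σ]
  have hη (σ : UpperHalfPlane) : ModularForm.eta (σ : ℂ) ≠ 0 := ModularForm.eta_ne_zero σ.2
  have hηc : Continuous fun σ : UpperHalfPlane => ModularForm.eta (σ : ℂ) :=
    continuous_iff_continuousAt.2 fun σ =>
      (ModularForm.differentiableAt_eta_of_mem_upperHalfPlaneSet σ.2).continuousAt.comp
        UpperHalfPlane.continuous_coe.continuousAt
  have hsc : Continuous fun σ : UpperHalfPlane => Complex.sqrt (autFactor A σ) := by
    by_cases hc : A 1 0 = 0
    · simp only [autFactor, hc]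
      simpa using continuous_const
    · refine continuous_iff_continuousAt.2 fun σ => ?_
      have hm : autFactor A σ ∈ Complex.slitPlane := by
        right
        have : (autFactor A σ).im = (A 1 0 : ℝ) * σ.im := by simp [autFactor]
        rw [this]
        exact mul_ne_zero (by exact_mod_cast hc) σ.im_pos.ne'
      refine ContinuousAt.cpow ?_ continuousAt_const hm
      unfold autFactor
      have := UpperHalfPlane.continuous_coe
      fun_prop
  let g : UpperHalfPlane → ℂ := fun σ =>
    ModularForm.eta ((A • σ : UpperHalfPlane) : ℂ) /
      (Complex.sqrt (autFactor A σ) * ModularForm.eta (σ : ℂ))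
  have hA : Continuous fun σ : UpperHalfPlane => A • σ :=
    continuous_const_smul (A : GL (Fin 2) ℝ)
  have hg : Continuous g :=
    (hηc.comp hA).div (hsc.mul hηc) fun σ => mul_ne_zero (hs σ) (hη σ)
  have hg24 (σ : UpperHalfPlane) : g σ ^ 24 = 1 := by
    have h1 : ModularForm.eta ((A • σ : UpperHalfPlane) : ℂ) ^ 24 =
        autFactor A σ ^ 12 * ModularForm.eta (σ : ℂ) ^ 24 := by
      have h := SlashInvariantForm.slash_action_eqn'' CuspForm.discriminant
        (Γ := 𝒮ℒ) (γ := (A : GL (Fin 2) ℝ)) (MonoidHom.mem_range.2 ⟨A, rfl⟩) σ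
      simpa [ModularForm.discriminant, autFactor, ModularGroup.denom_apply] using h
    have h2 : Complex.sqrt (autFactor A σ) ^ 24 = autFactor A σ ^ 12 := by
      have h3 : Complex.sqrt (autFactor A σ) ^ 2 = autFactor A σ := by
        simp [Complex.sqrt]
      calc _ = (Complex.sqrt (autFactor A σ) ^ 2) ^ 12 := by ring
        _ = _ := by rw [h3]
    simp only [g]
    rw [div_pow, mul_pow, h1, h2, div_self]
    exact mul_ne_zero (pow_ne_zero _ (hj σ)) (pow_ne_zero _ (hη σ))
  have hfin : {z : ℂ | z ^ 24 = 1}.Finite := by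
    refine ((Polynomial.nthRoots 24 (1 : ℂ)).toFinset.finite_toSet).subset fun z hz => ?_
    simpa [Polynomial.mem_nthRoots] using hz
  have hconst : g τ = g UpperHalfPlane.I := by
    exact isPreconnected_univ.constant_of_mapsTo (S := Set.univ) (T := {z : ℂ | z ^ 24 = 1})
      hfin.isDiscrete hg.continuousOn (fun σ _ => hg24 σ) (Set.mem_univ _) (Set.mem_univ _)
  have hν : etaMultiplier A = g τ := hconst.symm
  rw [hν]
  simp only [g]
  have := hs τ
  have := hη τ
  field_simp

/-- For `A = (α, β; γ, δ)` with `m ∣ γ`, the matrix `ᵐA = (α, mβ; γ/m, δ)`. -/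
def twist (m : ℤ) (A : SL(2, ℤ)) (h : m ∣ A 1 0) : SL(2, ℤ) :=
  ⟨!![A 0 0, m * A 0 1; A 1 0 / m, A 1 1], by
    have hdet := A.det_coe
    rw [Matrix.det_fin_two] at hdet
    rw [Matrix.det_fin_two_of]
    have h' : m * (A 1 0 / m) = A 1 0 := Int.mul_ediv_cancel' h
    linear_combination hdet - (A 0 1) * h'⟩

theorem two_dvd_of_mem {A : SL(2, ℤ)}
    (hA : A ∈ CongruenceSubgroup.Gamma1 14 ⊓ CongruenceSubgroup.Gamma0 98) : (2 : ℤ) ∣ A 1 0 := by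
  have h := CongruenceSubgroup.Gamma0_mem.1 hA.2
  rw [ZMod.intCast_zmod_eq_zero_iff_dvd] at h
  exact dvd_trans (by norm_num) h

/-- The Jacobi symbol `(m/n)` for odd `n` of either sign: it is `(m/|n|)`, except that it is
`-(m/|n|)` if both `m` and `n` are negative; `(0/±1) = 1`. -/
def jacobiExt (m n : ℤ) : ℤ :=
  if m < 0 ∧ n < 0 then -jacobiSym m n.natAbs else jacobiSym m n.natAbs

/-- `ε(δ)` is `1` if `δ ≡ 1 (mod 4)` and `i` otherwise. -/
def epsilonFactor (d : ℤ) : ℂ := if d % 4 = 1 then 1 else Complex.I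

/-- `∂g/∂x` for a function of `z = x + iy`. -/
def partialX (g : ℂ → ℂ) (z : ℂ) : ℂ := fderiv ℝ g z 1

/-- `∂g/∂y` for a function of `z = x + iy`. -/
def partialY (g : ℂ → ℂ) (z : ℂ) : ℂ := fderiv ℝ g z Complex.I

/-- The hyperbolic Laplacian of weight `k`,
`Δ_k = -y² (∂²/∂x² + ∂²/∂y²) + i k y (∂/∂x + i ∂/∂y)`. -/
def hypLaplacian (k : ℂ) (g : ℂ → ℂ) (z : ℂ) : ℂ :=
  -(z.im : ℂ) ^ 2 * (partialX (partialX g) z + partialY (partialY g) z) +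
    Complex.I * k * z.im * (partialX g z + Complex.I * partialY g z)

/-- Harmonic weak Maass forms of half-integral weight `κ/2`, `κ` odd, on a congruence subgroup
`Γ ⊆ Γ₀(4)`. -/
structure IsHarmonicWeakMaassForm (κ : ℤ) (Γ : Subgroup SL(2, ℤ)) (f : UpperHalfPlane → ℂ) :
    Prop where
  odd : Odd κ
  congruence : CongruenceSubgroup.IsCongruenceSubgroup Γ
  le_Gamma0_four : Γ ≤ CongruenceSubgroup.Gamma0 4
  /-- `f(Aτ) = (γ/δ)^κ ε(δ)^{-κ} (γτ + δ)^{κ/2} f(τ)` for `A ∈ Γ`. -/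
  transform : ∀ A ∈ Γ, ∀ τ : UpperHalfPlane,
    f (A • τ) = (jacobiExt (A 1 0) (A 1 1) : ℂ) ^ κ * epsilonFactor (A 1 1) ^ (-κ) *
      autFactor A τ ^ ((κ : ℂ) / 2) * f τ
  /-- `f` is smooth in the real sense. -/
  smooth : ContDiffOn ℝ ((⊤ : ℕ∞) : WithTop ℕ∞) (f ∘ UpperHalfPlane.ofComplex) {z : ℂ | 0 < z.im}
  harmonic : ∀ τ : UpperHalfPlane,
    hypLaplacian ((κ : ℂ) / 2) (f ∘ UpperHalfPlane.ofComplex) (τ : ℂ) = 0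
  /-- At most linear exponential growth at every cusp. -/
  growth : ∀ B : SL(2, ℤ), ∃ C : ℝ,
    (fun τ : UpperHalfPlane => autFactor B τ ^ (-((κ : ℂ) / 2)) * f (B • τ))
      =O[UpperHalfPlane.atImInfty] fun τ : UpperHalfPlane => Real.exp (C * τ.im)

end

end ZwegersForms

namespace ZwegersForms

noncomputable section

open Complex (I exp)
open scoped Real ComplexConjugate NumberTheorySymbols ContDiff

/-! ### The theta function -/

/-! Put σ = 98τ. Then N₇(k; τ) = exp(-πi(u-v)²/σ) μ̃(u, v; σ) with u = kσ/7 and v = σ/2, two torsion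
points relative to ℤ + σℤ (`N7_eq`). The theorem thus follows from the fact that μ̃ transforms like
a Jacobi form of weight 1/2 with quadratic form -(u-v)² and multiplier ν⁻³ (`muTilde_add`,
`muTilde_smul`).

To avoid poles, one works with the completed numerator ϑ(v)μ̃(u,v) = ϑ(v)μ(u,v) + (i/2)ϑ(v)R(u-v).
Neither summand is quasi-periodic in v, but their defects cancel (`completedNumer_add_tau_right`).
Under τ ↦ -1/τ the two sides of the expected law have the same ∂/∂v̄-derivative, an explicit
multiple of ϑ(v) times the conjugate of ϑ(u-v) (`dbar_S`). Their difference is therefore entire in v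
and quasi-periodic with multipliers belonging to the off-lattice point u, so it vanishes by
Liouville (`eq_zero_of_quasiperiodic`, `completedNumer_S`). The laws for S and T propagate to SL₂(ℤ)
(`jacobi_transform`). The law of ϑ is obtained in the same way relative to η³, which is where ν³
enters; dividing needs ϑ(v) ≠ 0 off the lattice (`theta_ne_zero`).

For A in Γ₀(98), A acts on σ through ⁹⁸A, and α ≡ 1 mod 14 makes u and v move by lattice vectors
only. This gives the law with ν(⁹⁸A)⁻³ (`N7_smul`). An explicit formula for ν³ when the lower right
entry is odd (`etaMultiplier_cube`) shows ν(⁹⁸A)³ = ν(²A)³, because 49 is an odd square, and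
evaluates the whole multiplier as (γ/δ) when 16 ∣ γ and α ≡ δ ≡ 1 mod 4.

For harmonicity, N₇ is split into a holomorphic part and a non-holomorphic series whose
τ̄-derivative is y^{-1/2} times an antiholomorphic theta series. Since Δ_w = -4y^{2-w} ∂_τ y^w ∂_τ̄,
weight 1/2 is exactly what kills it (`hypLaplacian_N7`). For growth at a cusp, diag(98,1)B is
factored as a unimodular matrix times an upper triangular one. The modular law then reduces the
claim to the growth of μ̃ at arguments with fixed real coordinates (`growth_N7`). -/

theorem theta_eq_jacobiTheta₂ (z τ : ℂ) :
    theta z τ = exp (π * I * τ / 4 + π * I * (z + 1 / 2)) *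
      jacobiTheta₂ (z + 1 / 2 + τ / 2) τ := by
  rw [theta, jacobiTheta₂, ← tsum_mul_left]
  refine tsum_congr fun m => ?_
  rw [jacobiTheta₂_term, ← Complex.exp_add]
  ring_nf

theorem exp_pi_mul_I_div_two : exp (π * I / 2) = I := by
  rw [show (π * I / 2 : ℂ) = π / 2 * I by ring, Complex.exp_pi_div_two_mul_I]

theorem exp_int_mul_pi_mul_I (n : ℤ) : exp (n * (π * I)) = (-1) ^ n := by
  rw [Complex.exp_int_mul, Complex.exp_pi_mul_I]

theorem exp_int_mul_two_pi_mul_I' (n : ℤ) : exp (2 * π * I * n) = 1 := by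
  rw [mul_comm, Complex.exp_int_mul_two_pi_mul_I]

theorem exp_congr {a b : ℂ} (n : ℤ) (h : a = b + 2 * π * I * n) : exp a = exp b := by
  rw [h, Complex.exp_add, exp_int_mul_two_pi_mul_I', mul_one]

theorem exp_congr_neg {a b : ℂ} (n : ℤ) (h : a = b + π * I * (2 * n + 1)) :
    exp a = -exp b := by
  rw [← mul_neg_one, ← Complex.exp_pi_mul_I, ← Complex.exp_add]
  exact exp_congr n (by rw [h]; ring)

theorem theta_add_one (z τ : ℂ) : theta (z + 1) τ = -theta z τ := by
  rw [theta_eq_jacobiTheta₂, theta_eq_jacobiTheta₂,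
    show z + 1 + 1 / 2 + τ / 2 = z + 1 / 2 + τ / 2 + 1 by ring, jacobiTheta₂_add_left,
    show π * I * τ / 4 + π * I * (z + 1 + 1 / 2) =
      (π * I * τ / 4 + π * I * (z + 1 / 2)) + π * I by ring,
    Complex.exp_add _ (π * I), Complex.exp_pi_mul_I]
  ring

theorem theta_add_tau (z τ : ℂ) :
    theta (z + τ) τ = -exp (-(π * I * τ) - 2 * π * I * z) * theta z τ := by
  rw [theta_eq_jacobiTheta₂, theta_eq_jacobiTheta₂,
    show z + τ + 1 / 2 + τ / 2 = z + 1 / 2 + τ / 2 + τ by ring, jacobiTheta₂_add_left',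
    ← mul_assoc, ← mul_assoc, ← Complex.exp_add, neg_mul (exp _) (exp _), ← Complex.exp_add]
  congr 1
  refine exp_congr_neg (-1) ?_
  push_cast
  ring

theorem theta_sub_tau (z τ : ℂ) :
    theta (z - τ) τ = -exp (-(π * I * τ) + 2 * π * I * z) * theta z τ := by
  have h := theta_add_tau (z - τ) τ
  rw [sub_add_cancel] at h
  rw [h, ← mul_assoc, neg_mul_neg, ← Complex.exp_add]
  rw [show -(π * I * τ) + 2 * π * I * z + (-(π * I * τ) - 2 * π * I * (z - τ)) = 0 by ring]
  simp

theorem theta_T (z τ : ℂ) : theta z (τ + 1) = exp (π * I / 4) * theta z τ := by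
  rw [theta, theta, ← tsum_mul_left]
  refine tsum_congr fun m => ?_
  rw [← Complex.exp_add]
  obtain ⟨k, hk⟩ := Int.even_mul_succ_self m
  have hk' : (m : ℂ) * (m + 1) = k + k := by exact_mod_cast hk
  refine exp_congr k ?_
  linear_combination (π * I : ℂ) * hk'

theorem tau_ne_zero {τ : ℂ} (hτ : 0 < τ.im) : τ ≠ 0 := by
  rintro rfl; simp at hτ

theorem neg_one_div_im {τ : ℂ} : (-1 / τ).im = τ.im / Complex.normSq τ := by
  simp [neg_div]

theorem neg_one_div_im_pos {τ : ℂ} (hτ : 0 < τ.im) : 0 < (-1 / τ).im := by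
  rw [neg_one_div_im]
  exact div_pos hτ (Complex.normSq_pos.2 (tau_ne_zero hτ))

theorem theta_S (z : ℂ) {τ : ℂ} (hτ : 0 < τ.im) :
    theta (z / τ) (-1 / τ) =
      -I * (-I * τ) ^ (1 / 2 : ℂ) * exp (π * I * z ^ 2 / τ) * theta z τ := by
  have h0 := tau_ne_zero hτ
  have hsq : (-I * τ) ^ (1 / 2 : ℂ) ≠ 0 := by
    rw [Ne, Complex.cpow_eq_zero_iff]; simp [h0]
  -- Division by τ turns this argument into z/τ + 1/2 + (-1/τ)/2, the half-period shift attached to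
  -- (z/τ, -1/τ). It differs by the period 1 from the shift attached to (z, τ).
  have h := jacobiTheta₂_functional_equation (z + τ / 2 - 1 / 2) τ
  rw [show (z + τ / 2 - 1 / 2) / τ = z / τ + 1 / 2 + -1 / τ / 2 by field_simp; ring] at h
  rw [theta_eq_jacobiTheta₂, theta_eq_jacobiTheta₂,
    show z + 1 / 2 + τ / 2 = (z + τ / 2 - 1 / 2) + 1 by ring, jacobiTheta₂_add_left, h]
  have e : exp (π * I * (-1 / τ) / 4 + π * I * (z / τ + 1 / 2)) =
      -I * exp (π * I * z ^ 2 / τ) * exp (π * I * τ / 4 + π * I * (z + 1 / 2)) *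
        exp (-π * I * (z + τ / 2 - 1 / 2) ^ 2 / τ) := by
    have hI : -I = exp (-(π * I / 2)) := by
      rw [Complex.exp_neg, exp_pi_mul_I_div_two, Complex.inv_I]
    rw [hI, ← Complex.exp_add, ← Complex.exp_add, ← Complex.exp_add]
    congr 1
    field_simp
    ring
  rw [e]
  field_simp

theorem differentiable_theta {τ : ℂ} (hτ : 0 < τ.im) : Differentiable ℂ fun z => theta z τ := by
  intro z
  simp_rw [theta_eq_jacobiTheta₂]
  refine DifferentiableAt.mul (by fun_prop) ?_
  exact (differentiableAt_jacobiTheta₂_fst (z + 1 / 2 + τ / 2) hτ).comp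
    (f := fun z => z + 1 / 2 + τ / 2) z (by fun_prop)

/-! ### Summability estimates -/

/-- A majorant of the terms of theta-like series on `|Im z| ≤ S`, `T ≤ Im τ`. -/
def thetaBound (S T : ℝ) (m : ℤ) : ℝ := Real.exp (-π * (T * m ^ 2 - 2 * S * |(m : ℝ)|))

theorem summable_pow_mul_thetaBound (S : ℝ) {T : ℝ} (hT : 0 < T) (k : ℕ) :
    Summable fun m : ℤ => |(m : ℝ)| ^ k * thetaBound S T m := by
  simpa [thetaBound] using summable_pow_mul_jacobiTheta₂_term_bound S hT k

theorem summable_thetaBound (S : ℝ) {T : ℝ} (hT : 0 < T) : Summable (thetaBound S T) := by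
  simpa using summable_pow_mul_thetaBound S hT 0

theorem thetaBound_pos (S T : ℝ) (m : ℤ) : 0 < thetaBound S T m := Real.exp_pos _

/-! ### The numerator of the Appell-Lerch sum -/

/-- `ϑ(v; τ) μ(u, v; τ)`. -/
def numer (u v τ : ℂ) : ℂ :=
  exp (π * I * u) * ∑' n : ℤ, (-1 : ℂ) ^ n *
    exp (π * I * n * (n + 1) * τ + 2 * π * I * n * v) /
      (1 - exp (2 * π * I * n * τ + 2 * π * I * u))

theorem mu_eq (u v τ : ℂ) : mu u v τ = numer u v τ / theta v τ := by
  rw [mu, numer]; ring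

/-- `u ∉ ℤ + τℤ`. -/
def OffLattice (u τ : ℂ) : Prop := ∀ m n : ℤ, u ≠ m + n * τ

theorem OffLattice.one_sub_exp_ne_zero {u τ : ℂ} (h : OffLattice u τ) (n : ℤ) :
    1 - exp (2 * π * I * n * τ + 2 * π * I * u) ≠ 0 := by
  intro h1
  obtain ⟨m, hm⟩ := Complex.exp_eq_one_iff.1 (sub_eq_zero.1 h1).symm
  refine h m (-n) ?_
  have : (2 * π * I : ℂ) ≠ 0 := by simp [Real.pi_ne_zero]
  apply mul_left_cancel₀ this
  push_cast
  linear_combination hm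

theorem exists_pos_le_abs_int_add (r : ℝ) :
    ∃ δ > 0, ∀ n : ℤ, (n : ℝ) + r = 0 ∨ δ ≤ |(n : ℝ) + r| := by
  by_cases hr : Int.fract r = 0
  · refine ⟨1, one_pos, fun n => ?_⟩
    have : (n : ℝ) + r = ((n + ⌊r⌋ : ℤ) : ℝ) := by
      push_cast; linarith [Int.floor_add_fract r]
    rw [this]
    by_cases h : n + ⌊r⌋ = 0
    · left; exact_mod_cast h
    · right; exact_mod_cast Int.one_le_abs h
  · have h0 : 0 < Int.fract r := lt_of_le_of_ne (Int.fract_nonneg r) (Ne.symm hr)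
    have h1 := Int.fract_lt_one r
    refine ⟨min (Int.fract r) (1 - Int.fract r), lt_min h0 (by linarith), fun n => Or.inr ?_⟩
    have : (n : ℝ) + r = ((n + ⌊r⌋ : ℤ) : ℝ) + Int.fract r := by
      push_cast; linarith [Int.floor_add_fract r]
    rw [this]
    rcases le_or_gt 0 (n + ⌊r⌋) with h | h
    · have : (0 : ℝ) ≤ ((n + ⌊r⌋ : ℤ) : ℝ) := by exact_mod_cast h
      exact (min_le_left _ _).trans ((by linarith : _ ≤ _).trans (le_abs_self _))
    · have : ((n + ⌊r⌋ : ℤ) : ℝ) ≤ -1 := by exact_mod_cast (by omega : n + ⌊r⌋ ≤ -1)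
      exact (min_le_right _ _).trans ((by linarith : _ ≤ _).trans (neg_le_abs _))

/-- The exponential has modulus exp(-2π(n+r) Im τ). Either n + r = 0, and then it is the constant
exp(2πis) ≠ 1, or |n+r| ≥ δ and the modulus stays away from 1. Uniformity in τ for fixed real
coordinates (r, s) is what holomorphy in τ and growth at the cusps require. -/
theorem exists_pos_le_norm_one_sub_exp (r s : ℝ) (hrs : ∀ m n : ℤ, ¬ (r = m ∧ s = n)) {y₀ : ℝ}
    (hy₀ : 0 < y₀) :
    ∃ c > 0, ∀ (n : ℤ) (τ : ℂ), y₀ ≤ τ.im →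
      c ≤ ‖1 - exp (2 * π * I * n * τ + 2 * π * I * (r * τ + s))‖ := by
  obtain ⟨δ, hδ, hδ'⟩ := exists_pos_le_abs_int_add r
  have hlt : Real.exp (-(2 * π * δ * y₀)) < 1 := by
    rw [Real.exp_lt_one_iff]
    have := Real.pi_pos
    have : 0 < 2 * π * δ * y₀ := by positivity
    linarith
  obtain ⟨c₀, hc₀, hc₀'⟩ : ∃ c₀ > 0, ∀ n : ℤ, (n : ℝ) + r = 0 →
      c₀ ≤ ‖1 - exp (2 * π * I * s)‖ := by
    by_cases h : ∃ n : ℤ, (n : ℝ) + r = 0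
    · refine ⟨_, ?_, fun _ _ => le_rfl⟩
      rw [gt_iff_lt, norm_pos_iff]
      intro h1
      obtain ⟨m, hm⟩ := Complex.exp_eq_one_iff.1 (sub_eq_zero.1 h1).symm
      obtain ⟨n, hn⟩ := h
      refine hrs (-n) m ⟨by push_cast; linarith, ?_⟩
      have h2 : (2 * π * I : ℂ) ≠ 0 := by simp [Real.pi_ne_zero]
      have : (s : ℂ) = m := by
        apply mul_left_cancel₀ h2
        linear_combination hm
      exact_mod_cast this
    · exact ⟨1, one_pos, fun n hn => (h ⟨n, hn⟩).elim⟩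
  refine ⟨min c₀ (1 - Real.exp (-(2 * π * δ * y₀))), lt_min hc₀ (by linarith), fun n τ hτ => ?_⟩
  have hnorm : ‖exp (2 * π * I * n * τ + 2 * π * I * (r * τ + s))‖ =
      Real.exp (-(2 * π * (n + r) * τ.im)) := by
    rw [Complex.norm_exp]
    congr 1
    simp
    ring
  rcases hδ' n with h | h
  · refine (min_le_left _ _).trans ((hc₀' n h).trans (le_of_eq ?_))
    have h' : (n : ℂ) + r = 0 := by exact_mod_cast h
    congr 3
    linear_combination -(2 * π * I * τ) * h'
  · refine (min_le_right _ _).trans ?_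
    have hy : 0 < τ.im := hy₀.trans_le hτ
    have hpi := Real.pi_pos
    rcases le_abs.1 h with h1 | h1
    · have h2 := norm_sub_norm_le (1 : ℂ) (exp (2 * π * I * n * τ + 2 * π * I * (r * τ + s)))
      rw [norm_one, hnorm] at h2
      refine le_trans ?_ h2
      have : 0 ≤ n + r := hδ.le.trans h1
      gcongr
    · have h2 := norm_sub_norm_le (exp (2 * π * I * n * τ + 2 * π * I * (r * τ + s))) (1 : ℂ)
      rw [norm_one, hnorm, norm_sub_rev] at h2
      refine le_trans ?_ h2
      have h3 : Real.exp (2 * π * δ * y₀) ≤ Real.exp (-(2 * π * (n + r) * τ.im)) := by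
        rw [Real.exp_le_exp, show -(2 * π * (n + r) * τ.im) = 2 * π * -(n + r) * τ.im by ring]
        have : 0 ≤ -(n + r) := hδ.le.trans h1
        gcongr
      -- Adding the two bounds gives eˣ + e⁻ˣ ≥ 2, that is eˣ - 1 ≥ 1 - e⁻ˣ, so one constant serves
      -- both signs of n + r.
      have h4 := Real.add_one_le_exp (2 * π * δ * y₀)
      have h5 := Real.add_one_le_exp (-(2 * π * δ * y₀))
      linarith

theorem exists_real_coords (u : ℂ) {τ : ℂ} (hτ : 0 < τ.im) : ∃ r s : ℝ, u = r * τ + s := by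
  refine ⟨u.im / τ.im, u.re - u.im / τ.im * τ.re, ?_⟩
  apply Complex.ext <;> simp
  field_simp

theorem OffLattice.real_coords {r s : ℝ} {τ : ℂ} (h : OffLattice (r * τ + s) τ) (m n : ℤ) :
    ¬ (r = m ∧ s = n) := by
  rintro ⟨rfl, rfl⟩
  exact h n m (by push_cast; ring)

theorem OffLattice.exists_pos_le {u τ : ℂ} (h : OffLattice u τ) (hτ : 0 < τ.im) :
    ∃ c > 0, ∀ n : ℤ, c ≤ ‖1 - exp (2 * π * I * n * τ + 2 * π * I * u)‖ := by
  obtain ⟨r, s, rfl⟩ := exists_real_coords u hτ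
  obtain ⟨c, hc, h'⟩ := exists_pos_le_norm_one_sub_exp r s h.real_coords hτ
  exact ⟨c, hc, fun n => h' n τ le_rfl⟩

/-- The numerators of the terms in `numer`. -/
def numerTerm (v τ : ℂ) (n : ℤ) : ℂ :=
  (-1 : ℂ) ^ n * exp (π * I * n * (n + 1) * τ + 2 * π * I * n * v)

/-- This identification supplies the Gaussian majorant for the Appell-Lerch sum and explains why a
theta function appears as its defect of quasi-periodicity. -/
theorem numerTerm_eq (v τ : ℂ) (n : ℤ) :
    numerTerm v τ n = jacobiTheta₂_term n (v + 1 / 2 + τ / 2) τ := by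
  rw [numerTerm, jacobiTheta₂_term, ← exp_int_mul_pi_mul_I, ← Complex.exp_add]
  ring_nf

theorem norm_numerTerm_le {S T : ℝ} (hT : 0 < T) {v τ : ℂ} (hS : |v.im + τ.im / 2| ≤ S)
    (hτ : T ≤ τ.im) (n : ℤ) : ‖numerTerm v τ n‖ ≤ thetaBound S T n := by
  rw [numerTerm_eq, thetaBound]
  have := norm_jacobiTheta₂_term_le hT (z := v + 1 / 2 + τ / 2) (S := S) ?_ hτ n
  · simpa using this
  · simpa using hS

theorem norm_numerTerm_div_le {S T c : ℝ} (hT : 0 < T) (hc : 0 < c) {v τ w : ℂ}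
    (hS : |v.im + τ.im / 2| ≤ S) (hτ : T ≤ τ.im) (n : ℤ) (hw : c ≤ ‖w‖) :
    ‖numerTerm v τ n / w‖ ≤ thetaBound S T n / c := by
  rw [norm_div]
  exact div_le_div₀ (thetaBound_pos _ _ _).le (norm_numerTerm_le hT hS hτ n) hc hw

theorem hasSum_numerTerm (v : ℂ) {τ : ℂ} (hτ : 0 < τ.im) :
    HasSum (numerTerm v τ) (jacobiTheta₂ (v + 1 / 2 + τ / 2) τ) := by
  have := hasSum_jacobiTheta₂_term (v + 1 / 2 + τ / 2) hτ
  simp_rw [← numerTerm_eq] at this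
  exact this

theorem summable_numer {u τ : ℂ} (h : OffLattice u τ) (hτ : 0 < τ.im) (v : ℂ) :
    Summable fun n : ℤ => numerTerm v τ n / (1 - exp (2 * π * I * n * τ + 2 * π * I * u)) := by
  obtain ⟨c, hc, hc'⟩ := h.exists_pos_le hτ
  exact Summable.of_norm_bounded ((summable_thetaBound _ hτ).div_const c)
    fun n => norm_numerTerm_div_le hτ hc le_rfl le_rfl n (hc' n)

theorem numer_eq (u v τ : ℂ) : numer u v τ = exp (π * I * u) *
    ∑' n : ℤ, numerTerm v τ n / (1 - exp (2 * π * I * n * τ + 2 * π * I * u)) := rfl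

theorem numer_add_one_right (u v τ : ℂ) : numer u (v + 1) τ = numer u v τ := by
  rw [numer_eq, numer_eq]
  congr 2 with n
  rw [numerTerm, numerTerm, show (π * I * n * (n + 1) * τ + 2 * π * I * n * (v + 1) : ℂ) =
    π * I * n * (n + 1) * τ + 2 * π * I * n * v + 2 * π * I * n by ring,
    Complex.exp_add _ (2 * π * I * n), exp_int_mul_two_pi_mul_I', mul_one]

/-- Shifting v by τ multiplies the n-th numerator by exp(-2πiu)·w, where 1 - w is the denominator.
Then w/(1-w) = 1/(1-w) - 1, and the summand -1 produces the theta series, the defect that R has to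
correct. -/
theorem numer_add_tau_right {u τ : ℂ} (h : OffLattice u τ) (hτ : 0 < τ.im) (v : ℂ) :
    numer u (v + τ) τ = exp (-(2 * π * I * u)) * numer u v τ -
      exp (-(π * I * u)) * jacobiTheta₂ (v + 1 / 2 + τ / 2) τ := by
  rw [numer_eq, numer_eq, ← (hasSum_numerTerm v hτ).tsum_eq]
  have h1 : ∀ n : ℤ, numerTerm (v + τ) τ n / (1 - exp (2 * π * I * n * τ + 2 * π * I * u)) =
      exp (-(2 * π * I * u)) * (numerTerm v τ n /
        (1 - exp (2 * π * I * n * τ + 2 * π * I * u)) - numerTerm v τ n) := by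
    intro n
    have hne := h.one_sub_exp_ne_zero n
    have h2 : numerTerm (v + τ) τ n = exp (-(2 * π * I * u)) *
        (exp (2 * π * I * n * τ + 2 * π * I * u) * numerTerm v τ n) := by
      rw [numerTerm, numerTerm, mul_left_comm (exp _) ((-1 : ℂ) ^ n),
        mul_left_comm (exp _) ((-1 : ℂ) ^ n), ← Complex.exp_add, ← Complex.exp_add]
      congr 2
      ring
    rw [h2]
    generalize exp (2 * π * I * n * τ + 2 * π * I * u) = w at hne ⊢
    field_simp
    ring
  rw [tsum_congr h1, tsum_mul_left, (summable_numer h hτ v).tsum_sub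
    (hasSum_numerTerm v hτ).summable]
  have h3 : exp (π * I * u) * exp (-(2 * π * I * u)) = exp (-(π * I * u)) := by
    rw [← Complex.exp_add]; ring_nf
  linear_combination -(∑' n, numerTerm v τ n) * h3

theorem numer_add_one_left (u v τ : ℂ) : numer (u + 1) v τ = -numer u v τ := by
  rw [numer_eq, numer_eq]
  have h1 : ∀ n : ℤ, exp (2 * π * I * n * τ + 2 * π * I * (u + 1)) =
      exp (2 * π * I * n * τ + 2 * π * I * u) := fun n => by
    rw [show (2 * π * I * n * τ + 2 * π * I * (u + 1) : ℂ) =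
      2 * π * I * n * τ + 2 * π * I * u + 2 * π * I by ring, Complex.exp_add _ (2 * π * I),
      Complex.exp_two_pi_mul_I, mul_one]
  simp_rw [h1]
  rw [show (π * I * (u + 1) : ℂ) = π * I * u + π * I by ring, Complex.exp_add,
    Complex.exp_pi_mul_I]
  ring

theorem numer_add_tau_left (u v τ : ℂ) :
    numer (u + τ) v τ = -exp (π * I * τ - 2 * π * I * v) * numer u (v - τ) τ := by
  rw [numer_eq, numer_eq, mul_left_comm, ← (Equiv.addRight (1 : ℤ)).tsum_eq (fun n : ℤ =>
    numerTerm (v - τ) τ n / (1 - exp (2 * π * I * n * τ + 2 * π * I * u))),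
    show (π * I * (u + τ) : ℂ) = π * I * u + π * I * τ by ring, Complex.exp_add, mul_assoc]
  congr 1
  rw [← tsum_mul_left, ← tsum_mul_left]
  refine tsum_congr fun n => ?_
  simp only [Equiv.coe_addRight]
  rw [← mul_div_assoc, ← mul_div_assoc]
  congr 1
  · rw [numerTerm, numerTerm, zpow_add₀ (by norm_num), zpow_one]
    have : exp (π * I * τ) * exp (π * I * n * (n + 1) * τ + 2 * π * I * n * v) =
        exp (π * I * τ - 2 * π * I * v) * exp (π * I * (n + 1 : ℤ) * ((n + 1 : ℤ) + 1) * τ +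
          2 * π * I * (n + 1 : ℤ) * (v - τ)) := by
      rw [← Complex.exp_add, ← Complex.exp_add]
      push_cast
      ring_nf
    linear_combination (-1 : ℂ) ^ n * this
  · push_cast
    ring_nf

theorem numer_T (u v τ : ℂ) : numer u v (τ + 1) = numer u v τ := by
  rw [numer_eq, numer_eq]
  congr 2 with n
  congr 1
  · rw [numerTerm, numerTerm]
    obtain ⟨k, hk⟩ := Int.even_mul_succ_self n
    have hk' : (n : ℂ) * (n + 1) = k + k := by exact_mod_cast hk
    congr 1
    refine exp_congr k ?_
    linear_combination (π * I : ℂ) * hk'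
  · congr 1
    refine exp_congr n ?_
    ring

theorem differentiable_numer {u τ : ℂ} (h : OffLattice u τ) (hτ : 0 < τ.im) :
    Differentiable ℂ fun v => numer u v τ := by
  intro v
  obtain ⟨c, hc, hc'⟩ := h.exists_pos_le hτ
  simp_rw [numer_eq]
  refine DifferentiableAt.const_mul ?_ _
  have hs : IsOpen {w : ℂ | |w.im + τ.im / 2| < |v.im + τ.im / 2| + 1} :=
    isOpen_lt (by fun_prop) continuous_const
  refine (Complex.differentiableOn_tsum_of_summable_norm
    (F := fun (n : ℤ) (w : ℂ) => numerTerm w τ n /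
      (1 - exp (2 * π * I * n * τ + 2 * π * I * u)))
    ((summable_thetaBound (|v.im + τ.im / 2| + 1) hτ).div_const c) (fun n => ?_) hs
    fun n w hw => norm_numerTerm_div_le hτ hc (le_of_lt hw) le_rfl n (hc' n)).differentiableAt
    (hs.mem_nhds (by simp))
  unfold numerTerm
  fun_prop

section

open MeasureTheory

/-! ### The error function `E` -/

theorem hasDerivAt_E (x : ℝ) : HasDerivAt E (2 * Real.exp (-π * x ^ 2)) x := by
  have hc : Continuous fun w : ℝ => Real.exp (-π * w ^ 2) := by fun_prop
  exact (intervalIntegral.integral_hasDerivAt_right (hc.intervalIntegrable _ _)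
    hc.stronglyMeasurable.stronglyMeasurableAtFilter hc.continuousAt).const_mul 2

theorem E_neg (x : ℝ) : E (-x) = -E x := by
  have h := intervalIntegral.integral_comp_neg (a := 0) (b := x)
    fun w : ℝ => Real.exp (-π * w ^ 2)
  simp only [neg_sq, neg_zero] at h
  rw [E, E, h, intervalIntegral.integral_symm]
  ring

theorem integrable_gaussian : Integrable fun w : ℝ => Real.exp (-π * w ^ 2) :=
  integrable_exp_neg_mul_sq Real.pi_pos

theorem one_sub_E_eq (x : ℝ) : 1 - E x = 2 * ∫ w in Set.Ioi x, Real.exp (-π * w ^ 2) := by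
  have h1 : ∫ w in Set.Ioi (0 : ℝ), Real.exp (-π * w ^ 2) = 1 / 2 := by
    rw [integral_gaussian_Ioi, div_self Real.pi_ne_zero, Real.sqrt_one]
  have h2 := intervalIntegral.integral_Ioi_sub_Ioi' (a := 0) (b := x) (μ := volume)
    (f := fun w : ℝ => Real.exp (-π * w ^ 2)) integrable_gaussian.integrableOn
    integrable_gaussian.integrableOn
  rw [E, ← h2, h1]
  ring

theorem E_le_one (x : ℝ) : E x ≤ 1 := by
  have h : 0 ≤ ∫ w in Set.Ioi x, Real.exp (-π * w ^ 2) :=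
    integral_nonneg fun w => (Real.exp_pos _).le
  linarith [one_sub_E_eq x]

theorem abs_E_le_one (x : ℝ) : |E x| ≤ 1 :=
  abs_le.2 ⟨by linarith [E_le_one (-x), E_neg x], E_le_one x⟩

/-- For w, x ≥ 0 one has (w+x)² ≥ w² + x², and the Gaussian integral over the half line is 1/2. -/
theorem one_sub_E_le {x : ℝ} (hx : 0 ≤ x) : 1 - E x ≤ Real.exp (-π * x ^ 2) := by
  have h1 : ∫ w in Set.Ioi (0 : ℝ), Real.exp (-π * w ^ 2) = 1 / 2 := by
    rw [integral_gaussian_Ioi, div_self Real.pi_ne_zero, Real.sqrt_one]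
  have h2 : ∫ w in Set.Ioi x, Real.exp (-π * w ^ 2) =
      ∫ w in Set.Ioi (0 : ℝ), Real.exp (-π * (w + x) ^ 2) := by
    have := (measurePreserving_add_right volume x).setIntegral_preimage_emb
      (measurableEmbedding_addRight x) (fun w : ℝ => Real.exp (-π * w ^ 2)) (Set.Ioi x)
    rw [← this]
    congr 2
    ext w
    simp
  have h3 : ∫ w in Set.Ioi (0 : ℝ), Real.exp (-π * (w + x) ^ 2) ≤
      ∫ w in Set.Ioi (0 : ℝ), Real.exp (-π * x ^ 2) * Real.exp (-π * w ^ 2) := by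
    refine setIntegral_mono_on (integrable_gaussian.comp_add_right x).integrableOn
      (integrable_gaussian.const_mul _).integrableOn measurableSet_Ioi fun w hw => ?_
    rw [← Real.exp_add, Real.exp_le_exp]
    have : 0 ≤ π * (w * x) := mul_nonneg Real.pi_pos.le (mul_nonneg (le_of_lt hw) hx)
    nlinarith
  rw [integral_const_mul, h1] at h3
  rw [one_sub_E_eq, h2]
  linarith

/-- `sgn(n) - E((n + a)√(2y))` for `n = m + 1/2`. -/
def rCoeff (m : ℤ) (a y : ℝ) : ℝ :=
  Real.sign ((m : ℝ) + 1 / 2) - E (((m : ℝ) + 1 / 2 + a) * Real.sqrt (2 * y))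

theorem half_pos_or_neg (m : ℤ) : (0 < (m : ℝ) + 1 / 2 ∧ (0 ≤ m)) ∨
    ((m : ℝ) + 1 / 2 < 0 ∧ m < 0) := by
  rcases le_or_gt 0 m with h | h
  · left
    have : (0 : ℝ) ≤ m := by exact_mod_cast h
    exact ⟨by linarith, h⟩
  · right
    have : (m : ℝ) ≤ -1 := by exact_mod_cast (by omega : m ≤ -1)
    exact ⟨by linarith, h⟩

/-- If n + a has the sign of n = m + 1/2, this is the tail bound for 1 - E. Otherwise |n+a| ≤ |a|,
and the factor exp(2πa²y) makes the right side at least the trivial bound 2. -/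
theorem abs_rCoeff_le (m : ℤ) (a : ℝ) {y : ℝ} (hy : 0 < y) :
    |rCoeff m a y| ≤ 2 * Real.exp (2 * π * a ^ 2 * y) *
      Real.exp (-(2 * π * ((m : ℝ) + 1 / 2 + a) ^ 2 * y)) := by
  have hs : Real.sqrt (2 * y) ^ 2 = 2 * y := Real.sq_sqrt (by positivity)
  have hs0 : 0 ≤ Real.sqrt (2 * y) := Real.sqrt_nonneg _
  have hpi := Real.pi_pos
  rw [rCoeff]
  have key : ∀ n : ℝ, 0 < n → ∀ a : ℝ, |1 - E ((n + a) * Real.sqrt (2 * y))| ≤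
      2 * Real.exp (2 * π * a ^ 2 * y) * Real.exp (-(2 * π * (n + a) ^ 2 * y)) := by
    intro n hn a
    rw [abs_of_nonneg (by linarith [E_le_one ((n + a) * Real.sqrt (2 * y))])]
    rcases le_or_gt 0 (n + a) with h | h
    · refine (one_sub_E_le (mul_nonneg h hs0)).trans ?_
      have e : -π * ((n + a) * Real.sqrt (2 * y)) ^ 2 = -(2 * π * (n + a) ^ 2 * y) := by
        rw [mul_pow, hs]; ring
      rw [e]
      have h1 : 1 ≤ Real.exp (2 * π * a ^ 2 * y) := Real.one_le_exp (by positivity)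
      exact le_mul_of_one_le_left (Real.exp_pos _).le (by linarith)
    · have h1 : 1 - E ((n + a) * Real.sqrt (2 * y)) ≤ 2 := by
        linarith [(abs_le.1 (abs_E_le_one ((n + a) * Real.sqrt (2 * y)))).1]
      refine h1.trans ?_
      rw [mul_assoc, ← Real.exp_add]
      have h2 : 0 ≤ 2 * π * a ^ 2 * y + -(2 * π * (n + a) ^ 2 * y) := by
        have h3 : 0 ≤ 2 * π * y * (n * (-(n + a) + -a)) := by
          refine mul_nonneg (by positivity) (mul_nonneg hn.le ?_)
          linarith
        linarith
      linarith [Real.one_le_exp h2]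
  rcases half_pos_or_neg m with ⟨h, -⟩ | ⟨h, -⟩
  · rw [Real.sign_of_pos h]
    exact key _ h a
  · rw [Real.sign_of_neg h]
    have := key (-((m : ℝ) + 1 / 2)) (by linarith) (-a)
    rw [show (-((m : ℝ) + 1 / 2) + -a) * Real.sqrt (2 * y) =
      -(((m : ℝ) + 1 / 2 + a) * Real.sqrt (2 * y)) by ring, E_neg, neg_sq,
      show (-((m : ℝ) + 1 / 2) + -a) ^ 2 = ((m : ℝ) + 1 / 2 + a) ^ 2 by ring] at this
    rw [← abs_neg]
    refine le_trans (le_of_eq ?_) this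
    congr 1
    ring

/-- The absolute values of the terms of the theta series. -/
def thetaNorm (z τ : ℂ) (m : ℤ) : ℝ :=
  Real.exp (-π * ((m : ℝ) + 1 / 2) ^ 2 * τ.im - 2 * π * ((m : ℝ) + 1 / 2) * z.im)

theorem thetaNorm_le {S T : ℝ} {z τ : ℂ} (hS : |z.im + τ.im / 2| ≤ S)
    (hτ : T ≤ τ.im) (m : ℤ) :
    thetaNorm z τ m ≤ Real.exp (-π * (z.im + τ.im / 4)) * thetaBound S T m := by
  rw [thetaNorm, thetaBound, ← Real.exp_add, Real.exp_le_exp]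
  have h1 : -((m : ℝ) * (z.im + τ.im / 2)) ≤ S * |(m : ℝ)| := by
    refine (neg_le_abs _).trans ?_
    rw [abs_mul, mul_comm]
    exact mul_le_mul_of_nonneg_right hS (abs_nonneg _)
  have h2 : T * (m : ℝ) ^ 2 ≤ τ.im * (m : ℝ) ^ 2 :=
    mul_le_mul_of_nonneg_right hτ (sq_nonneg _)
  have hpi := Real.pi_pos
  have h3 := mul_le_mul_of_nonneg_left (add_le_add (add_le_add h1 h1) (neg_le_neg h2)) hpi.le
  nlinarith

/-- The exponential factor of the terms of `R`. -/
def rExp (m : ℤ) (z τ : ℂ) : ℂ :=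
  (-1 : ℂ) ^ m * exp (-π * I * ((m : ℂ) + 1 / 2) ^ 2 * τ - 2 * π * I * ((m : ℂ) + 1 / 2) * z)

theorem R_eq (z τ : ℂ) : R z τ = ∑' m : ℤ, (rCoeff m (z.im / τ.im) τ.im : ℂ) * rExp m z τ := by
  rw [R]
  refine tsum_congr fun m => ?_
  rw [rExp, rCoeff, mul_assoc]

theorem norm_rExp (m : ℤ) (z τ : ℂ) : ‖rExp m z τ‖ =
    Real.exp (π * ((m : ℝ) + 1 / 2) ^ 2 * τ.im + 2 * π * ((m : ℝ) + 1 / 2) * z.im) := by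
  rw [rExp, norm_mul, norm_zpow, norm_neg, norm_one, one_zpow, one_mul, Complex.norm_exp]
  congr 1
  have h : (-π * I * ((m : ℂ) + 1 / 2) ^ 2 * τ - 2 * π * I * ((m : ℂ) + 1 / 2) * z) =
      ((-π * ((m : ℝ) + 1 / 2) ^ 2 : ℝ) : ℂ) * (τ * I) +
      ((-2 * π * ((m : ℝ) + 1 / 2) : ℝ) : ℂ) * (z * I) := by
    push_cast; ring
  rw [h, Complex.add_re, Complex.re_ofReal_mul, Complex.re_ofReal_mul, Complex.mul_I_re,
    Complex.mul_I_re]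
  ring

/-- The Gaussian decay of the coefficient outweighs the growth of `rExp`: with a·Im τ = Im z the
exponents combine to that of a theta term, so R converges as well as ϑ does. -/
theorem norm_rCoeff_mul_rExp_le (m : ℤ) (z : ℂ) {τ : ℂ} (hτ : 0 < τ.im) :
    ‖(rCoeff m (z.im / τ.im) τ.im : ℂ) * rExp m z τ‖ ≤ 2 * thetaNorm z τ m := by
  rw [norm_mul, Complex.norm_real, Real.norm_eq_abs, norm_rExp]
  refine (mul_le_mul_of_nonneg_right (abs_rCoeff_le m _ hτ) (Real.exp_pos _).le).trans
    (le_of_eq ?_)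
  rw [thetaNorm, mul_assoc, mul_assoc, ← Real.exp_add, ← Real.exp_add]
  congr 2
  field_simp
  ring

theorem summable_thetaNorm (z : ℂ) {τ : ℂ} (hτ : 0 < τ.im) : Summable (thetaNorm z τ) :=
  Summable.of_nonneg_of_le (fun _ => (Real.exp_pos _).le) (fun m => thetaNorm_le le_rfl le_rfl m)
    ((summable_thetaBound _ hτ).mul_left _)

theorem summable_R (z : ℂ) {τ : ℂ} (hτ : 0 < τ.im) :
    Summable fun m : ℤ => (rCoeff m (z.im / τ.im) τ.im : ℂ) * rExp m z τ :=
  Summable.of_norm_bounded ((summable_thetaNorm z hτ).mul_left 2)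
    fun m => norm_rCoeff_mul_rExp_le m z hτ

/-! ### Translation laws of R in both variables. -/

theorem R_add_one (z τ : ℂ) : R (z + 1) τ = -R z τ := by
  rw [R_eq, R_eq, ← tsum_neg]
  refine tsum_congr fun m => ?_
  rw [show (z + 1).im = z.im by simp, ← mul_neg, rExp, rExp, ← mul_neg]
  congr 2
  refine exp_congr_neg (-m - 1) ?_
  push_cast
  ring

theorem R_T (z τ : ℂ) : R z (τ + 1) = exp (-(π * I / 4)) * R z τ := by
  rw [R_eq, R_eq, ← tsum_mul_left]
  refine tsum_congr fun m => ?_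
  rw [show (τ + 1).im = τ.im by simp, rExp, rExp, mul_left_comm (exp _),
    mul_left_comm (exp _) ((-1 : ℂ) ^ m), ← Complex.exp_add]
  obtain ⟨k, hk⟩ := Int.even_mul_succ_self m
  have hk' : (m : ℂ) * (m + 1) = k + k := by exact_mod_cast hk
  congr 2
  refine exp_congr (-k) ?_
  push_cast
  linear_combination (-(π * I) : ℂ) * hk'

/-- The combined shift fixes the argument of E. The sign changes only at m = 0, where 1/2 becomes
-1/2; this single term is the inhomogeneity in `R_add_tau`. -/
theorem rCoeff_sub_one (m : ℤ) (a y : ℝ) : rCoeff (m - 1) (a + 1) y =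
    rCoeff m a y - if m = 0 then 2 else 0 := by
  rw [rCoeff, rCoeff]
  have e : ((m - 1 : ℤ) : ℝ) + 1 / 2 + (a + 1) = (m : ℝ) + 1 / 2 + a := by push_cast; ring
  rw [e]
  rcases half_pos_or_neg (m - 1) with ⟨h1, h1'⟩ | ⟨h1, h1'⟩ <;>
  rcases half_pos_or_neg m with ⟨h2, h2'⟩ | ⟨h2, h2'⟩
  · rw [if_neg (by omega), Real.sign_of_pos h1, Real.sign_of_pos h2]; ring
  · omega
  · rw [if_pos (by omega), Real.sign_of_neg h1, Real.sign_of_pos h2]; ring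
  · rw [if_neg (by omega), Real.sign_of_neg h1, Real.sign_of_neg h2]; ring

theorem R_add_tau (z : ℂ) {τ : ℂ} (hτ : 0 < τ.im) :
    R (z + τ) τ = exp (2 * π * I * z + π * I * τ) *
      (2 * exp (-(π * I * z) - π * I * τ / 4) - R z τ) := by
  rw [R_eq, R_eq, ← (Equiv.subRight (1 : ℤ)).tsum_eq]
  simp only [Equiv.subRight_apply]
  have h1 : (z + τ).im / τ.im = z.im / τ.im + 1 := by
    rw [Complex.add_im, add_div, div_self hτ.ne']
  have h2 : ∀ m : ℤ, rExp (m - 1) (z + τ) τ =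
      -exp (2 * π * I * z + π * I * τ) * rExp m z τ := by
    intro m
    rw [rExp, rExp, zpow_sub₀ (by norm_num), zpow_one,
      neg_mul (exp _), mul_left_comm (exp _), ← Complex.exp_add, div_neg, div_one, neg_mul]
    congr 3
    push_cast
    ring
  have h3 : ∀ m : ℤ, ((if m = 0 then (2 : ℝ) else 0 : ℝ) : ℂ) * rExp m z τ =
      if m = 0 then 2 * rExp 0 z τ else 0 := by
    intro m
    split_ifs with h
    · subst h; norm_num
    · simp
  have h4 : ∀ m : ℤ, (rCoeff (m - 1) ((z + τ).im / τ.im) τ.im : ℂ) * rExp (m - 1) (z + τ) τ =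
      -exp (2 * π * I * z + π * I * τ) * ((rCoeff m (z.im / τ.im) τ.im : ℂ) * rExp m z τ -
        if m = 0 then 2 * rExp 0 z τ else 0) := by
    intro m
    rw [h1, h2, rCoeff_sub_one, ← h3]
    push_cast
    ring
  have h5 : HasSum (fun m : ℤ => if m = 0 then 2 * rExp 0 z τ else 0) (2 * rExp 0 z τ) :=
    hasSum_ite_eq 0 _
  rw [tsum_congr h4, tsum_mul_left, (summable_R z hτ).tsum_sub h5.summable, h5.tsum_eq]
  have h6 : rExp 0 z τ = exp (-(π * I * z) - π * I * τ / 4) := by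
    rw [rExp, zpow_zero, one_mul]
    congr 1
    push_cast
    ring
  rw [h6]
  ring

end

theorem I_mul_exp (x : ℂ) : I * exp x = exp (π * I / 2 + x) := by
  rw [Complex.exp_add, exp_pi_mul_I_div_two]

/-! ### The completed numerator `ϑ(v; τ) μ̃(u, v; τ)` -/

/-- `ϑ(v; τ) μ̃(u, v; τ)`. -/
def completedNumer (u v τ : ℂ) : ℂ := numer u v τ + I / 2 * theta v τ * R (u - v) τ

theorem completedNumer_add_one_right (u v τ : ℂ) :
    completedNumer u (v + 1) τ = completedNumer u v τ := by
  have h := R_add_one (u - (v + 1)) τ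
  rw [show u - (v + 1) + 1 = u - v by ring] at h
  rw [completedNumer, completedNumer, numer_add_one_right, theta_add_one, h]
  ring

/-- The theta defect of `numer` cancels against ϑ(v) times the exponential defect of R (`e2`). This
is the reason for adding (i/2)R. -/
theorem completedNumer_add_tau_right {u τ : ℂ} (hu : OffLattice u τ) (hτ : 0 < τ.im) (v : ℂ) :
    completedNumer u (v + τ) τ = exp (-(2 * π * I * u)) * completedNumer u v τ := by
  have h := R_add_tau (u - (v + τ)) hτ
  rw [show u - (v + τ) + τ = u - v by ring] at h
  rw [completedNumer, completedNumer, numer_add_tau_right hu hτ, theta_add_tau, h]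
  have e1 : exp (-(2 * π * I * u)) * exp (2 * π * I * (u - (v + τ)) + π * I * τ) =
      exp (-(π * I * τ) - 2 * π * I * v) := by
    rw [← Complex.exp_add]; ring_nf
  have e2 : I * exp (-(π * I * τ) - 2 * π * I * v) *
      exp (-(π * I * (u - (v + τ))) - π * I * τ / 4) * theta v τ =
      -exp (-(π * I * u)) * jacobiTheta₂ (v + 1 / 2 + τ / 2) τ := by
    have e3 : exp (-(π * I * τ) - 2 * π * I * v) *
        exp (-(π * I * (u - (v + τ))) - π * I * τ / 4) *
        exp (π * I * τ / 4 + π * I * (v + 1 / 2)) = I * exp (-(π * I * u)) := by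
      rw [I_mul_exp, ← Complex.exp_add, ← Complex.exp_add]
      ring_nf
    rw [theta_eq_jacobiTheta₂]
    linear_combination (I * jacobiTheta₂ (v + 1 / 2 + τ / 2) τ) * e3 +
      (exp (-(π * I * u)) * jacobiTheta₂ (v + 1 / 2 + τ / 2) τ) * Complex.I_sq
  linear_combination -(I / 2 * theta v τ * (2 * exp (-(π * I * (u - (v + τ))) - π * I * τ / 4) -
      R (u - (v + τ)) τ)) * e1 - e2

theorem completedNumer_sub_tau_right {u τ : ℂ} (hu : OffLattice u τ) (hτ : 0 < τ.im) (v : ℂ) :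
    completedNumer u (v - τ) τ = exp (2 * π * I * u) * completedNumer u v τ := by
  have h := completedNumer_add_tau_right hu hτ (v - τ)
  rw [sub_add_cancel] at h
  rw [h, ← mul_assoc, ← Complex.exp_add, add_neg_cancel, Complex.exp_zero, one_mul]

theorem completedNumer_add_one_left (u v τ : ℂ) :
    completedNumer (u + 1) v τ = -completedNumer u v τ := by
  rw [completedNumer, completedNumer, numer_add_one_left, show u + 1 - v = u - v + 1 by ring,
    R_add_one]
  ring

theorem completedNumer_add_tau_left {u τ : ℂ} (hu : OffLattice u τ) (hτ : 0 < τ.im) (v : ℂ) :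
    completedNumer (u + τ) v τ =
      -exp (π * I * τ + 2 * π * I * (u - v)) * completedNumer u v τ := by
  -- The difference u - v is unchanged when the shift of u by τ is traded for a shift of v by -τ, so
  -- the law in u follows from the law in v.
  have h1 : completedNumer (u + τ) v τ =
      -exp (π * I * τ - 2 * π * I * v) * completedNumer u (v - τ) τ := by
    rw [completedNumer, completedNumer, numer_add_tau_left, theta_sub_tau,
      show u + τ - v = u - (v - τ) by ring]
    have e : exp (π * I * τ - 2 * π * I * v) * exp (-(π * I * τ) + 2 * π * I * v) = 1 := by
      rw [← Complex.exp_add]; ring_nf; exact Complex.exp_zero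
    linear_combination -(I / 2 * theta v τ * R (u - (v - τ)) τ) * e
  rw [h1, completedNumer_sub_tau_right hu hτ, ← mul_assoc, neg_mul (exp _) (exp _),
    ← Complex.exp_add]
  ring_nf

theorem completedNumer_T (u v τ : ℂ) :
    completedNumer u v (τ + 1) = completedNumer u v τ := by
  rw [completedNumer, completedNumer, numer_T, theta_T, R_T, Complex.exp_neg]
  have := Complex.exp_ne_zero (π * I / 4)
  field_simp

/-! ### The `∂/∂z̄`-derivative -/

/-- `f` is real differentiable at `z`, with `∂f/∂y - i ∂f/∂x = b`. -/
def HasDbar (f : ℂ → ℂ) (b z : ℂ) : Prop :=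
  ∃ L : ℂ →L[ℝ] ℂ, HasFDerivAt f L z ∧ L I = I * L 1 + b

theorem hasDbar_of_differentiableAt {f : ℂ → ℂ} {z : ℂ} (h : DifferentiableAt ℂ f z) :
    HasDbar f 0 z := by
  refine ⟨_, h.hasFDerivAt.restrictScalars ℝ, ?_⟩
  simp

theorem HasDbar.differentiableAt {f : ℂ → ℂ} {z : ℂ} (h : HasDbar f 0 z) :
    DifferentiableAt ℂ f z := by
  obtain ⟨L, hL, h1⟩ := h
  rw [differentiableAt_complex_iff_differentiableAt_real]
  refine ⟨hL.differentiableAt, ?_⟩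
  rw [hL.fderiv, h1]
  simp

theorem HasDbar.add {f g : ℂ → ℂ} {b c z : ℂ} (hf : HasDbar f b z) (hg : HasDbar g c z) :
    HasDbar (fun w => f w + g w) (b + c) z := by
  obtain ⟨L, hL, h1⟩ := hf
  obtain ⟨M, hM, h2⟩ := hg
  refine ⟨L + M, hL.add hM, ?_⟩
  simp only [add_apply, h1, h2]
  ring

theorem HasDbar.mul {f g : ℂ → ℂ} {b c z : ℂ} (hf : HasDbar f b z) (hg : HasDbar g c z) :
    HasDbar (fun w => f w * g w) (f z * c + b * g z) z := by
  obtain ⟨L, hL, h1⟩ := hf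
  obtain ⟨M, hM, h2⟩ := hg
  refine ⟨_, hL.mul hM, ?_⟩
  simp only [add_apply, smul_apply, h1, h2, smul_eq_mul]
  ring

theorem HasDbar.comp_affine {f : ℂ → ℂ} {b : ℂ} (α β z : ℂ) (hf : HasDbar f b (α * z + β)) :
    HasDbar (fun w => f (α * w + β)) (b * conj α) z := by
  obtain ⟨L, hL, h1⟩ := hf
  have h2 : HasDerivAt (fun w : ℂ => α * w + β) α z := by
    simpa using ((hasDerivAt_id z).const_mul α).add_const β
  refine ⟨_, hL.comp z (h2.hasFDerivAt.restrictScalars ℝ), ?_⟩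
  have h3 : ∀ w : ℂ, L w = w.re * L 1 + w.im * L I := by
    intro w
    conv_lhs => rw [← Complex.re_add_im w]
    rw [map_add, show (w.re : ℂ) = w.re • (1 : ℂ) by simp,
      show (w.im : ℂ) * I = w.im • I by simp, L.map_smul, L.map_smul]
    simp
  have h4 : conj α = α.re - α.im * I := by
    apply Complex.ext <;> simp
  simp only [ContinuousLinearMap.comp_apply, ContinuousLinearMap.coe_restrictScalars',
    ContinuousLinearMap.toSpanSingleton_apply, smul_eq_mul]
  rw [h3 (I * α), h3 (1 * α), h1, h4]
  simp
  linear_combination (-(L 1 * α.im)) * Complex.I_sq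

/-- Multiplication by the Gaussian coming from the derivative of E replaces τ and z by their
conjugates in the exponent. Hence the antiholomorphic derivative of R sums to a conjugated theta
function. -/
theorem conj_rExp (m : ℤ) (z τ : ℂ) : ((Real.exp (-(2 * π * ((m : ℝ) + 1 / 2 + z.im / τ.im) ^ 2 *
      τ.im)) : ℝ) : ℂ) * rExp m z τ = (Real.exp (-(2 * π * (z.im / τ.im) ^ 2 * τ.im)) : ℝ) *
    (I * conj (exp (π * I * ((m : ℂ) + 1 / 2) ^ 2 * τ +
      2 * π * I * ((m : ℂ) + 1 / 2) * (z + 1 / 2)))) ∨ τ.im = 0 := by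
  by_cases hτ : τ.im = 0
  · exact Or.inr hτ
  left
  rw [rExp, ← Complex.exp_conj, ← exp_int_mul_pi_mul_I, I_mul_exp,
    Complex.ofReal_exp, Complex.ofReal_exp, ← Complex.exp_add, ← Complex.exp_add,
    ← Complex.exp_add]
  refine exp_congr m ?_
  have hz : conj z = z - 2 * z.im * I := by apply Complex.ext <;> simp; ring
  have ht : conj τ = τ - 2 * τ.im * I := by apply Complex.ext <;> simp; ring
  have hd : (z.im / τ.im : ℂ) * τ.im = z.im := div_mul_cancel₀ _ (by exact_mod_cast hτ)
  simp only [map_add, map_mul, map_pow, Complex.conj_I, Complex.conj_ofReal, map_div₀,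
    map_one, map_ofNat, map_intCast, hz, ht]
  push_cast
  linear_combination (-(4 * π * ((m : ℂ) + 1 / 2))) * hd -
    (2 * π * ((m : ℂ) + 1 / 2) ^ 2 * τ.im + 4 * π * ((m : ℂ) + 1 / 2) * z.im) * Complex.I_sq

/-- The real derivative of a term of `R`. -/
def rFDeriv (m : ℤ) (z τ : ℂ) : ℂ →L[ℝ] ℂ :=
  (((-(2 * Real.exp (-(2 * π * ((m : ℝ) + 1 / 2 + z.im / τ.im) ^ 2 * τ.im)) *
      (Real.sqrt (2 * τ.im) / τ.im)) : ℝ) : ℂ) * rExp m z τ) •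
    (Complex.ofRealCLM.comp Complex.imCLM) +
  ((rCoeff m (z.im / τ.im) τ.im : ℂ) * rExp m z τ * (-(2 * π * I * ((m : ℂ) + 1 / 2)))) •
    (1 : ℂ →L[ℝ] ℂ)

theorem hasFDerivAt_rTerm (m : ℤ) (z : ℂ) {τ : ℂ} (hτ : 0 < τ.im) :
    HasFDerivAt (fun z : ℂ => (rCoeff m (z.im / τ.im) τ.im : ℂ) * rExp m z τ)
      (rFDeriv m z τ) z := by
  have h1 : HasFDerivAt (fun z : ℂ => rExp m z τ)
      ((rExp m z τ * (-(2 * π * I * ((m : ℂ) + 1 / 2)))) • (1 : ℂ →L[ℝ] ℂ)) z := by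
    have : HasDerivAt (fun z : ℂ => rExp m z τ)
        (rExp m z τ * (-(2 * π * I * ((m : ℂ) + 1 / 2)))) z := by
      have h := ((((hasDerivAt_id z).const_mul (2 * π * I * ((m : ℂ) + 1 / 2))).const_sub
        (-π * I * ((m : ℂ) + 1 / 2) ^ 2 * τ)).cexp).const_mul ((-1 : ℂ) ^ m)
      simp only [id, mul_one] at h
      rw [rExp, mul_assoc]
      exact h
    refine (this.hasFDerivAt.restrictScalars ℝ).congr_fderiv ?_
    ext
    simp [mul_comm]
  have h2 : HasFDerivAt (fun z : ℂ => ((rCoeff m (z.im / τ.im) τ.im : ℝ) : ℂ))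
      (((-(2 * Real.exp (-(2 * π * ((m : ℝ) + 1 / 2 + z.im / τ.im) ^ 2 * τ.im)) *
      (Real.sqrt (2 * τ.im) / τ.im)) : ℝ) : ℂ) • (Complex.ofRealCLM.comp Complex.imCLM)) z := by
    have h3 : HasDerivAt (fun t : ℝ => rCoeff m (t / τ.im) τ.im)
        (-(2 * Real.exp (-(2 * π * ((m : ℝ) + 1 / 2 + z.im / τ.im) ^ 2 * τ.im)) *
          (Real.sqrt (2 * τ.im) / τ.im))) z.im := by
      have h4 : HasDerivAt (fun t : ℝ => ((m : ℝ) + 1 / 2 + t / τ.im) * Real.sqrt (2 * τ.im))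
          (Real.sqrt (2 * τ.im) / τ.im) z.im := by
        have := ((((hasDerivAt_id z.im).div_const τ.im).const_add ((m : ℝ) + 1 / 2)).mul_const
          (Real.sqrt (2 * τ.im)))
        refine this.congr_deriv ?_
        ring
      have h5 := ((hasDerivAt_E _).comp z.im h4).const_sub (Real.sign ((m : ℝ) + 1 / 2))
      refine h5.congr_deriv ?_
      rw [mul_pow, Real.sq_sqrt (by positivity)]
      ring_nf
    have h6 := (Complex.ofRealCLM.hasFDerivAt.comp z
      (h3.hasFDerivAt.comp z Complex.imCLM.hasFDerivAt))
    refine h6.congr_fderiv ?_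
    ext w
    simp
    ring
  refine (h2.mul h1).congr_fderiv ?_
  ext w
  simp [rFDeriv]
  ring

theorem norm_rFDeriv_le (m : ℤ) (z : ℂ) {τ : ℂ} (hτ : 0 < τ.im) :
    ‖rFDeriv m z τ‖ ≤ (2 * (Real.sqrt (2 * τ.im) / τ.im) + 4 * π * (|(m : ℝ)| + 1)) *
      thetaNorm z τ m := by
  have hs : 0 ≤ Real.sqrt (2 * τ.im) / τ.im := by positivity
  have hpi := Real.pi_pos
  have h0 : ‖(Complex.ofRealCLM.comp Complex.imCLM : ℂ →L[ℝ] ℂ)‖ ≤ 1 := by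
    refine ContinuousLinearMap.opNorm_le_bound _ zero_le_one fun w => ?_
    simpa using Complex.abs_im_le_norm w
  have h1 : ‖(((-(2 * Real.exp (-(2 * π * ((m : ℝ) + 1 / 2 + z.im / τ.im) ^ 2 * τ.im)) *
      (Real.sqrt (2 * τ.im) / τ.im)) : ℝ) : ℂ) * rExp m z τ)‖ ≤
      2 * (Real.sqrt (2 * τ.im) / τ.im) * thetaNorm z τ m := by
    rw [norm_mul, norm_rExp, Complex.norm_real, norm_neg, Real.norm_of_nonneg (by positivity),
      mul_right_comm 2 (Real.exp _), mul_assoc, ← Real.exp_add, thetaNorm]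
    gcongr
    have : 0 ≤ 2 * π * (z.im / τ.im) ^ 2 * τ.im := by positivity
    have e : -(2 * π * ((m : ℝ) + 1 / 2 + z.im / τ.im) ^ 2 * τ.im) +
        (π * ((m : ℝ) + 1 / 2) ^ 2 * τ.im + 2 * π * ((m : ℝ) + 1 / 2) * z.im) =
        -π * ((m : ℝ) + 1 / 2) ^ 2 * τ.im - 2 * π * ((m : ℝ) + 1 / 2) * z.im -
          2 * π * (z.im / τ.im) ^ 2 * τ.im := by
      field_simp
      ring
    rw [e]
    linarith
  have h2 : ‖(rCoeff m (z.im / τ.im) τ.im : ℂ) * rExp m z τ *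
      (-(2 * π * I * ((m : ℂ) + 1 / 2)))‖ ≤ 4 * π * (|(m : ℝ)| + 1) * thetaNorm z τ m := by
    rw [norm_mul]
    have h3 : ‖(-(2 * π * I * ((m : ℂ) + 1 / 2)))‖ ≤ 2 * π * (|(m : ℝ)| + 1) := by
      rw [norm_neg, norm_mul, show ((m : ℂ) + 1 / 2) = (((m : ℝ) + 1 / 2 : ℝ) : ℂ) by push_cast; rfl,
        Complex.norm_real, Real.norm_eq_abs]
      have h4 : ‖(2 * π * I : ℂ)‖ = 2 * π := by simp [abs_of_pos hpi]
      rw [h4]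
      gcongr
      refine (abs_add_le _ _).trans ?_
      rw [abs_of_pos (by norm_num : (0 : ℝ) < 1 / 2)]
      linarith
    have h5 := norm_rCoeff_mul_rExp_le m z hτ
    have h6 : 0 ≤ thetaNorm z τ m := (Real.exp_pos _).le
    calc _ ≤ (2 * thetaNorm z τ m) * (2 * π * (|(m : ℝ)| + 1)) := by gcongr
      _ = _ := by ring
  rw [rFDeriv]
  refine (norm_add_le _ _).trans ?_
  rw [norm_smul, norm_smul, add_mul]
  have h7 : ‖(1 : ℂ →L[ℝ] ℂ)‖ ≤ 1 := ContinuousLinearMap.norm_id_le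
  exact add_le_add ((mul_le_of_le_one_right (norm_nonneg _) h0).trans h1)
    ((mul_le_of_le_one_right (norm_nonneg _) h7).trans h2)

/-- Up to the factor `-2i`, the derivative `∂R/∂z̄`. -/
def dbarR (z τ : ℂ) : ℂ :=
  -(2 * (Real.sqrt (2 * τ.im) / τ.im) * Real.exp (-(2 * π * (z.im / τ.im) ^ 2 * τ.im)) : ℝ) *
    (I * conj (theta z τ))

theorem hasDbar_R (z : ℂ) {τ : ℂ} (hτ : 0 < τ.im) :
    HasDbar (fun z => R z τ) (dbarR z τ) z := by
  have hpi := Real.pi_pos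
  set S : ℝ := |z.im + τ.im / 2| + 1 with hS
  set K : ℝ := 2 * (Real.sqrt (2 * τ.im) / τ.im) with hK
  have hK0 : 0 ≤ K := by positivity
  set C : ℝ := Real.exp (π * (|z.im| + 1)) with hC
  have hu : Summable fun m : ℤ => (K + 4 * π * (|(m : ℝ)| + 1)) * (C * thetaBound S τ.im m) := by
    have h1 := ((summable_thetaBound S hτ).mul_left ((K + 4 * π) * C)).add
      ((summable_pow_mul_thetaBound S hτ 1).mul_left (4 * π * C))
    refine h1.congr fun m => ?_
    ring
  have him : ∀ w ∈ Metric.ball z 1, |w.im - z.im| < 1 := fun w hw => by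
    rw [Metric.mem_ball, Complex.dist_eq] at hw
    exact (by simpa using Complex.abs_im_le_norm (w - z) : |w.im - z.im| ≤ _).trans_lt hw
  have hb : ∀ (m : ℤ) (w : ℂ), w ∈ Metric.ball z 1 →
      ‖rFDeriv m w τ‖ ≤ (K + 4 * π * (|(m : ℝ)| + 1)) * (C * thetaBound S τ.im m) := by
    intro m w hw
    have hw' := abs_lt.1 (him w hw)
    refine (norm_rFDeriv_le m w hτ).trans ?_
    have h1 : |w.im + τ.im / 2| ≤ S := by
      rw [hS, show w.im + τ.im / 2 = (z.im + τ.im / 2) + (w.im - z.im) by ring]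
      exact (abs_add_le _ _).trans (by gcongr; exact (him w hw).le)
    refine mul_le_mul_of_nonneg_left ((thetaNorm_le h1 le_rfl m).trans ?_) (by positivity)
    refine mul_le_mul_of_nonneg_right ?_ (thetaBound_pos _ _ _).le
    rw [hC, Real.exp_le_exp, show -π * (w.im + τ.im / 4) = π * (-w.im - τ.im / 4) by ring]
    gcongr
    have := neg_abs_le z.im
    linarith
  have hz : z ∈ Metric.ball z 1 := Metric.mem_ball_self one_pos
  have h := hasFDerivAt_tsum_of_isPreconnected hu Metric.isOpen_ball
    (convex_ball z (1 : ℝ)).isPreconnected (fun m w _ => hasFDerivAt_rTerm m w hτ) hb hz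
    (summable_R z hτ) hz
  have hsum : Summable fun m => rFDeriv m z τ := Summable.of_norm_bounded hu fun m => hb m z hz
  have h' : HasFDerivAt (fun z => R z τ) (∑' m, rFDeriv m z τ) z := by
    simp_rw [R_eq]
    exact h
  refine ⟨_, h', ?_⟩
  have hI := hsum.hasSum.mapL (ContinuousLinearMap.apply ℝ ℂ I)
  have h1 := (hsum.hasSum.mapL (ContinuousLinearMap.apply ℝ ℂ (1 : ℂ))).mul_left I
  simp only [ContinuousLinearMap.apply_apply] at hI h1
  have hθ : HasSum (fun m : ℤ => conj (exp (π * I * ((m : ℂ) + 1 / 2) ^ 2 * τ +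
      2 * π * I * ((m : ℂ) + 1 / 2) * (z + 1 / 2)))) (conj (theta z τ)) := by
    have h2 : Summable fun m : ℤ => exp (π * I * ((m : ℂ) + 1 / 2) ^ 2 * τ +
        2 * π * I * ((m : ℂ) + 1 / 2) * (z + 1 / 2)) := by
      refine ((hasSum_jacobiTheta₂_term (z + 1 / 2 + τ / 2) hτ).summable.mul_left
        (exp (π * I * τ / 4 + π * I * (z + 1 / 2)))).congr fun m => ?_
      rw [jacobiTheta₂_term, ← Complex.exp_add]
      ring_nf
    exact Complex.hasSum_conj'.2 (by simpa [theta] using h2.hasSum)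
  have h3 := hθ.mul_left (-(2 * (Real.sqrt (2 * τ.im) / τ.im) *
    Real.exp (-(2 * π * (z.im / τ.im) ^ 2 * τ.im)) : ℝ) * I : ℂ)
  -- The combination L(i) - i·L(1) annihilates the complex linear part of each term. Only the
  -- derivative of E survives, and `conj_rExp` turns it into a conjugated theta term.
  rw [← sub_eq_iff_eq_add']
  refine ((hI.sub h1).unique ?_)
  rw [dbarR, ← mul_assoc]
  refine h3.congr_fun fun m => ?_
  have h4 := (conj_rExp m z τ).resolve_right hτ.ne'
  simp only [rFDeriv, add_apply, smul_apply,
    ContinuousLinearMap.comp_apply, Complex.imCLM_apply, Complex.ofRealCLM_apply,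
    one_apply_eq_self, Complex.I_im, Complex.one_im, smul_eq_mul]
  push_cast at h4 ⊢
  linear_combination (-(2 * ((Real.sqrt (2 * τ.im) : ℂ) / τ.im))) * h4

/-! ### The inversion `τ ↦ -1/τ` -/

theorem hasDbar_completedNumer {u τ : ℂ} (hu : OffLattice u τ) (hτ : 0 < τ.im) (v : ℂ) :
    HasDbar (fun v => completedNumer u v τ)
      (-(I / 2 * theta v τ * dbarR (u - v) τ)) v := by
  have h1 := hasDbar_of_differentiableAt (differentiable_numer hu hτ v)
  have h2 := hasDbar_of_differentiableAt ((differentiable_theta hτ v).const_mul (I / 2))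
  have h3 := HasDbar.comp_affine (-1) u v (f := fun z => R z τ)
    (by simpa using hasDbar_R (-1 * v + u) hτ)
  have h4 := h1.add (h2.mul h3)
  have e : ∀ w : ℂ, -1 * w + u = u - w := fun w => by ring
  simp only [e] at h4
  refine (congrArg (HasDbar _ · v) ?_).mpr h4
  rw [map_neg, map_one, show -v + u = u - v by ring]
  ring

/-- A quasi-periodic entire function whose multipliers are those of an off-lattice point
vanishes. -/
theorem eq_zero_of_quasiperiodic {f : ℂ → ℂ} (hf : Differentiable ℂ f) {u τ : ℂ}
    (hτ : 0 < τ.im) (h1 : ∀ v, f (v + 1) = f v)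
    (h2 : ∀ v, f (v + τ) = exp (-(2 * π * I * u)) * f v) (hu : OffLattice u τ) (v : ℂ) :
    f v = 0 := by
  obtain ⟨r, s, rfl⟩ := exists_real_coords u hτ
  -- With u = rτ + s, this twist makes both multipliers unimodular: exp(2πir) for 1 and exp(-2πis)
  -- for τ. Thus |g| is doubly periodic, so g is bounded and constant.
  set g : ℂ → ℂ := fun v => exp (2 * π * I * r * v) * f v with hg
  have hgd : Differentiable ℂ g := by
    intro v
    exact DifferentiableAt.mul (by fun_prop) (hf v)
  have g1 : ∀ v, g (v + 1) = exp (2 * π * I * r) * g v := fun v => by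
    rw [hg]
    simp only
    rw [h1, mul_add, Complex.exp_add]
    ring_nf
  have g2 : ∀ v, g (v + τ) = exp (-(2 * π * I * s)) * g v := fun v => by
    rw [hg]
    simp only
    rw [h2, ← mul_assoc, ← mul_assoc, ← Complex.exp_add, ← Complex.exp_add]
    ring_nf
  have n1 : ∀ t : ℝ, ‖exp (2 * π * I * t)‖ = 1 := fun t => by
    rw [show (2 * π * I * t : ℂ) = ((2 * π * t : ℝ) : ℂ) * I by push_cast; ring,
      Complex.norm_exp_ofReal_mul_I]
  have p1 : Function.Periodic (fun v => ‖g v‖) 1 := fun v => by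
    simp only
    rw [g1, norm_mul, n1, one_mul]
  have p2 : Function.Periodic (fun v => ‖g v‖) τ := fun v => by
    simp only
    rw [g2, norm_mul, show -(2 * π * I * s : ℂ) = 2 * π * I * ((-s : ℝ) : ℂ) by push_cast; ring,
      n1, one_mul]
  have hbdd : Bornology.IsBounded (Set.range g) := by
    have hK : IsCompact ((fun p : ℝ × ℝ => (p.1 * τ + p.2 : ℂ)) ''
        (Set.Icc (0 : ℝ) 1 ×ˢ Set.Icc (0 : ℝ) 1)) :=
      (isCompact_Icc.prod isCompact_Icc).image (by fun_prop)
    obtain ⟨C, hC⟩ := hK.exists_bound_of_continuousOn hgd.continuous.continuousOn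
    refine isBounded_iff_forall_norm_le.2 ⟨C, ?_⟩
    rintro _ ⟨w, rfl⟩
    obtain ⟨a, b, rfl⟩ := exists_real_coords w hτ
    have hw := hC (Int.fract a * τ + Int.fract b) ⟨(Int.fract a, Int.fract b),
      ⟨⟨Int.fract_nonneg a, (Int.fract_lt_one a).le⟩,
        ⟨Int.fract_nonneg b, (Int.fract_lt_one b).le⟩⟩, rfl⟩
    have e : (a * τ + b : ℂ) = Int.fract a * τ + Int.fract b + ⌊a⌋ * τ + ⌊b⌋ * 1 := by
      have ha : (a : ℂ) = ⌊a⌋ + Int.fract a := by exact_mod_cast (Int.floor_add_fract a).symm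
      have hb : (b : ℂ) = ⌊b⌋ + Int.fract b := by exact_mod_cast (Int.floor_add_fract b).symm
      linear_combination τ * ha + hb
    rw [e]
    have q1 := p1.int_mul ⌊b⌋ (Int.fract a * τ + Int.fract b + ⌊a⌋ * τ)
    have q2 := p2.int_mul ⌊a⌋ (Int.fract a * τ + Int.fract b)
    exact (q1.trans q2).trans_le hw
  have hconst : ∀ w, g w = g 0 := fun w => hgd.apply_eq_apply_of_bounded hbdd w 0
  -- A nonzero constant would force both multipliers to be 1, so r and s would be integers, contrary
  -- to u being off the lattice.
  have hg0 : g 0 = 0 := by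
    by_contra hne
    have c1 : exp (2 * π * I * r) = 1 := by
      have := g1 0
      rw [hconst (0 + 1)] at this
      exact mul_right_cancel₀ hne (by rw [one_mul]; exact this.symm)
    have c2 : exp (-(2 * π * I * s)) = 1 := by
      have := g2 0
      rw [hconst (0 + τ)] at this
      exact mul_right_cancel₀ hne (by rw [one_mul]; exact this.symm)
    obtain ⟨m, hm⟩ := Complex.exp_eq_one_iff.1 c1
    obtain ⟨n, hn⟩ := Complex.exp_eq_one_iff.1 c2
    have hpi : (2 * π * I : ℂ) ≠ 0 := by simp [Real.pi_ne_zero]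
    refine hu (-n) m ?_
    apply mul_left_cancel₀ hpi
    push_cast
    linear_combination τ * hm - hn
  have := hconst v
  rw [hg0, hg] at this
  exact (mul_eq_zero.1 this).resolve_left (Complex.exp_ne_zero _)

theorem OffLattice.inv {u τ : ℂ} (hu : OffLattice u τ) (hτ : 0 < τ.im) :
    OffLattice (u / τ) (-1 / τ) := by
  intro m n h
  have h0 := tau_ne_zero hτ
  refine hu (-n) m ?_
  field_simp at h
  push_cast
  linear_combination h

/-- With z = u - v, this matches the antiholomorphic derivatives of the two sides of the inversion
law. The root in `theta_S` occurs together with its conjugate and contributes |τ|; Im(-1/τ) = Im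
τ/|τ|² accounts for the square root factor. The Gaussian identity is a computation in the
coordinates z = pτ + q. -/
theorem dbar_S (v z : ℂ) {τ : ℂ} (hτ : 0 < τ.im) :
    exp (-(π * I * (v ^ 2 - z ^ 2) / τ)) / τ * theta (v / τ) (-1 / τ) *
      dbarR (z / τ) (-1 / τ) * conj (1 / τ) = theta v τ * dbarR z τ := by
  have h0 := tau_ne_zero hτ
  have hc0 : conj τ ≠ 0 := by simpa using h0
  set κ : ℂ := (-I * τ) ^ (1 / 2 : ℂ) with hκ
  have hκ2 : κ * conj κ = (‖τ‖ : ℂ) := by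
    have h1 : ‖κ‖ ^ 2 = ‖τ‖ := by
      rw [← norm_pow, hκ, ← Complex.cpow_nat_mul]
      simp
    rw [Complex.mul_conj, Complex.normSq_eq_norm_sq, h1]
  have hn : (‖τ‖ : ℂ) * ‖τ‖ = τ * conj τ := by
    rw [Complex.mul_conj, Complex.normSq_eq_norm_sq]
    push_cast; ring
  have hnp : 0 < ‖τ‖ := norm_pos_iff.2 h0
  have hy' : (-1 / τ).im = τ.im / ‖τ‖ ^ 2 := by
    rw [neg_one_div_im, Complex.normSq_eq_norm_sq]
  have hsq : Real.sqrt (2 * (-1 / τ).im) / (-1 / τ).im =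
      ‖τ‖ * (Real.sqrt (2 * τ.im) / τ.im) := by
    rw [hy', ← mul_div_assoc, Real.sqrt_div (by positivity), Real.sqrt_sq hnp.le]
    field_simp
  have hexp : (Real.exp (-(2 * π * ((z / τ).im / (-1 / τ).im) ^ 2 * (-1 / τ).im)) : ℂ) *
      exp (π * I * z ^ 2 / τ) * conj (exp (π * I * z ^ 2 / τ)) =
      (Real.exp (-(2 * π * (z.im / τ.im) ^ 2 * τ.im)) : ℂ) := by
    have h1 : exp (π * I * z ^ 2 / τ) * conj (exp (π * I * z ^ 2 / τ)) =
        (Real.exp (-(2 * π * (z ^ 2 / τ).im)) : ℂ) := by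
      rw [← Complex.exp_conj, ← Complex.exp_add, Complex.add_conj, Complex.ofReal_exp]
      congr 2
      rw [show (π * I * z ^ 2 / τ : ℂ) = ((π : ℝ) : ℂ) * (z ^ 2 / τ * I) by ring,
        Complex.re_ofReal_mul, Complex.mul_I_re]
      ring
    rw [mul_assoc, h1, ← Complex.ofReal_mul, ← Real.exp_add]
    congr 2
    obtain ⟨p, q, hpq⟩ := exists_real_coords z hτ
    have e1 : (z / τ).im = -(q * τ.im / ‖τ‖ ^ 2) := by
      rw [hpq, add_div, mul_div_cancel_right₀ _ h0, Complex.add_im, Complex.ofReal_im, zero_add,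
        show (q : ℂ) / τ = ((-q : ℝ) : ℂ) * (-1 / τ) by push_cast; ring, Complex.im_ofReal_mul, hy']
      ring
    have e2 : (z ^ 2 / τ).im = p ^ 2 * τ.im - q ^ 2 * τ.im / ‖τ‖ ^ 2 := by
      have : z ^ 2 / τ = ((p ^ 2 : ℝ) : ℂ) * τ + ((2 * p * q : ℝ) : ℂ) +
          ((-q ^ 2 : ℝ) : ℂ) * (-1 / τ) := by
        rw [hpq]; push_cast; field_simp; ring
      rw [this, Complex.add_im, Complex.add_im, Complex.im_ofReal_mul, Complex.im_ofReal_mul, hy',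
        Complex.ofReal_im]
      ring
    have e3 : z.im = p * τ.im := by rw [hpq]; simp
    rw [e1, e2, e3, hy']
    field_simp
    ring
  have hv : exp (-(π * I * (v ^ 2 - z ^ 2) / τ)) * exp (π * I * v ^ 2 / τ) =
      exp (π * I * z ^ 2 / τ) := by
    rw [← Complex.exp_add]; ring_nf
  rw [dbarR, dbarR, theta_S v hτ, theta_S z hτ, hsq, ← hκ]
  simp only [map_mul, map_neg, Complex.conj_I, map_div₀, map_one]
  push_cast at hexp ⊢
  rw [← hexp, ← hv]
  simp only [map_mul]
  set X := exp (-(π * I * (v ^ 2 - z ^ 2) / τ))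
  set V := exp (π * I * v ^ 2 / τ)
  set s : ℂ := (Real.sqrt (2 * τ.im) : ℂ) / τ.im
  have hX : conj X * conj V = conj (exp (π * I * z ^ 2 / τ)) := by rw [← map_mul, hv]
  rw [hX]
  have hk : κ * conj κ * ‖τ‖ / (τ * conj τ) = 1 := by
    rw [hκ2, hn, div_self (mul_ne_zero h0 hc0)]
  set e := exp (-(2 * π * ((z / τ).im / (-1 / τ).im : ℂ) ^ 2 * (-1 / τ).im))
  set C := X * V * theta v τ * (-(2 * s * e)) * conj (exp (π * I * z ^ 2 / τ)) * conj (theta z τ)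
  linear_combination C * I * hk -
    C * I * (κ * conj κ * ‖τ‖ / (τ * conj τ)) * Complex.I_sq

theorem completedNumer_S {u τ : ℂ} (hu : OffLattice u τ) (hτ : 0 < τ.im) (v : ℂ) :
    completedNumer (u / τ) (v / τ) (-1 / τ) =
      τ * exp (π * I * (2 * u * v - u ^ 2) / τ) * completedNumer u v τ := by
  have h0 := tau_ne_zero hτ
  have hτ' := neg_one_div_im_pos hτ
  have hu' := hu.inv hτ
  -- D is the difference of the two sides, normalized to have the multipliers of `completedNumer u ·
  -- τ`. The translations of v by 1 and τ become translations of v/τ by -(-1/τ) and 1.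
  set D : ℂ → ℂ := fun v => exp (-(π * I * (2 * u * v - u ^ 2) / τ)) / τ *
    completedNumer (u / τ) (v / τ) (-1 / τ) + -1 * completedNumer u v τ with hD
  have hdiff : Differentiable ℂ D := by
    intro v
    apply HasDbar.differentiableAt
    have h1 := HasDbar.comp_affine (1 / τ) 0 v (f := fun w => completedNumer (u / τ) w (-1 / τ))
      (hasDbar_completedNumer hu' hτ' (1 / τ * v + 0))
    have h2 : HasDbar (fun v => exp (-(π * I * (2 * u * v - u ^ 2) / τ)) / τ) 0 v :=
      hasDbar_of_differentiableAt (by fun_prop)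
    have h3 : HasDbar (fun _ : ℂ => (-1 : ℂ)) 0 v :=
      hasDbar_of_differentiableAt (by fun_prop)
    have h4 := (h2.mul h1).add (h3.mul (hasDbar_completedNumer hu hτ v))
    have e : ∀ w : ℂ, 1 / τ * w + 0 = w / τ := fun w => by ring
    simp only [e] at h4
    convert h4 using 1
    have h5 := dbar_S v (u - v) hτ
    rw [show v ^ 2 - (u - v) ^ 2 = 2 * u * v - u ^ 2 by ring, sub_div] at h5
    linear_combination (I / 2) * h5
  have hq1 : ∀ v, D (v + 1) = D v := by
    intro v
    have h1 := completedNumer_sub_tau_right hu' hτ' (v / τ)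
    rw [show v / τ - -1 / τ = (v + 1) / τ by ring] at h1
    simp only [hD]
    rw [completedNumer_add_one_right, h1]
    have : exp (-(π * I * (2 * u * (v + 1) - u ^ 2) / τ)) * exp (2 * π * I * (u / τ)) =
        exp (-(π * I * (2 * u * v - u ^ 2) / τ)) := by
      rw [← Complex.exp_add]; ring_nf
    linear_combination (completedNumer (u / τ) (v / τ) (-1 / τ) / τ) * this
  have hq2 : ∀ v, D (v + τ) = exp (-(2 * π * I * u)) * D v := by
    intro v
    have h1 := completedNumer_add_one_right (u / τ) (v / τ) (-1 / τ)
    rw [show v / τ + 1 = (v + τ) / τ by field_simp] at h1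
    simp only [hD]
    rw [completedNumer_add_tau_right hu hτ, h1]
    have : exp (-(π * I * (2 * u * (v + τ) - u ^ 2) / τ)) =
        exp (-(2 * π * I * u)) * exp (-(π * I * (2 * u * v - u ^ 2) / τ)) := by
      rw [← Complex.exp_add]
      congr 1
      field_simp
      ring
    rw [this]
    ring
  have h := eq_zero_of_quasiperiodic hdiff hτ hq1 hq2 hu v
  simp only [hD] at h
  have e : exp (π * I * (2 * u * v - u ^ 2) / τ) * exp (-(π * I * (2 * u * v - u ^ 2) / τ)) = 1 := by
    rw [← Complex.exp_add, add_neg_cancel, Complex.exp_zero]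
  have h6 : τ * (1 / τ) = 1 := by field_simp
  linear_combination (τ * exp (π * I * (2 * u * v - u ^ 2) / τ)) * h -
    completedNumer (u / τ) (v / τ) (-1 / τ) * (e * (τ * (1 / τ)) + h6)

open UpperHalfPlane hiding I

/-! ### The action of `SL(2, ℤ)` -/

theorem autFactor_ne_zero (A : SL(2, ℤ)) (τ : ℍ) : autFactor A τ ≠ 0 := by
  have h := UpperHalfPlane.denom_ne_zero (A : GL (Fin 2) ℝ) τ
  rwa [ModularGroup.denom_apply] at h

theorem coe_smul_eq (A : SL(2, ℤ)) (τ : ℍ) :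
    ((A • τ : ℍ) : ℂ) = ((A 0 0 : ℤ) * τ + (A 0 1 : ℤ)) / autFactor A τ := by
  rw [UpperHalfPlane.coe_specialLinearGroup_apply]
  simp [autFactor]

theorem coe_smul_mul_autFactor (A : SL(2, ℤ)) (τ : ℍ) :
    ((A • τ : ℍ) : ℂ) * autFactor A τ = (A 0 0 : ℤ) * τ + (A 0 1 : ℤ) := by
  rw [coe_smul_eq, div_mul_cancel₀ _ (autFactor_ne_zero A τ)]

theorem det_eq (A : SL(2, ℤ)) : A 0 0 * A 1 1 - A 0 1 * A 1 0 = 1 := by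
  have := A.det_coe
  rwa [Matrix.det_fin_two] at this

theorem det_eq_complex (A : SL(2, ℤ)) :
    ((A 0 0 : ℤ) : ℂ) * (A 1 1 : ℤ) - (A 0 1 : ℤ) * (A 1 0 : ℤ) = 1 := by
  exact_mod_cast det_eq A

theorem mul_apply_one_zero (A B : SL(2, ℤ)) : (A * B) 1 0 = A 1 0 * B 0 0 + A 1 1 * B 1 0 := by
  rw [Matrix.SpecialLinearGroup.coe_mul, Matrix.mul_apply, Fin.sum_univ_two]

theorem mul_apply_one_one (A B : SL(2, ℤ)) : (A * B) 1 1 = A 1 0 * B 0 1 + A 1 1 * B 1 1 := by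
  rw [Matrix.SpecialLinearGroup.coe_mul, Matrix.mul_apply, Fin.sum_univ_two]

theorem mul_apply_zero_zero (A B : SL(2, ℤ)) : (A * B) 0 0 = A 0 0 * B 0 0 + A 0 1 * B 1 0 := by
  rw [Matrix.SpecialLinearGroup.coe_mul, Matrix.mul_apply, Fin.sum_univ_two]

theorem mul_apply_zero_one (A B : SL(2, ℤ)) : (A * B) 0 1 = A 0 0 * B 0 1 + A 0 1 * B 1 1 := by
  rw [Matrix.SpecialLinearGroup.coe_mul, Matrix.mul_apply, Fin.sum_univ_two]

theorem autFactor_mul (A B : SL(2, ℤ)) (τ : ℍ) :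
    autFactor (A * B) τ = autFactor A (B • τ) * autFactor B τ := by
  have h := coe_smul_mul_autFactor B τ
  rw [autFactor, mul_apply_one_zero, mul_apply_one_one, autFactor, add_mul, mul_assoc, h, autFactor]
  push_cast
  ring

theorem OffLattice.smul {u : ℂ} {τ : ℍ} (h : OffLattice u τ) (A : SL(2, ℤ)) :
    OffLattice (u / autFactor A τ) (A • τ : ℍ) := by
  intro m n e
  have h0 := autFactor_ne_zero A τ
  rw [div_eq_iff h0, add_mul, mul_assoc, coe_smul_mul_autFactor] at e
  refine h (m * A 1 1 + n * A 0 1) (m * A 1 0 + n * A 0 0) ?_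
  rw [e, autFactor]
  push_cast
  ring

/-- A function on the Jacobi half space that transforms like a Jacobi form under `S` and `T`
transforms like a Jacobi form under `SL(2, ℤ)`. -/
theorem jacobi_transform (f : ℂ → ℂ → ℍ → ℂ) (k : ℤ) (Q : ℂ → ℂ → ℂ)
    (hQ : ∀ t u v, Q (t * u) (t * v) = t ^ 2 * Q u v)
    (hT : ∀ u v (τ : ℍ), OffLattice u τ → f u v (ModularGroup.T • τ) = f u v τ)
    (hS : ∀ u v (τ : ℍ), OffLattice u τ → f (u / τ) (v / τ) (ModularGroup.S • τ) =
      (τ : ℂ) ^ k * exp (π * I * Q u v / τ) * f u v τ)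
    (A : SL(2, ℤ)) : ∀ u v (τ : ℍ), OffLattice u τ →
      f (u / autFactor A τ) (v / autFactor A τ) (A • τ) =
        autFactor A τ ^ k * exp (π * I * (A 1 0 : ℤ) * Q u v / autFactor A τ) * f u v τ := by
  have hA : A ∈ Subgroup.closure {ModularGroup.S, ModularGroup.T} := by
    rw [SpecialLinearGroup.SL2Z_generators]; trivial
  have hQ' : ∀ t u v, Q (u / t) (v / t) = Q u v / t ^ 2 := fun t u v => by
    rw [div_eq_inv_mul, div_eq_inv_mul, hQ]; ring
  induction hA using Subgroup.closure_induction with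
  | one =>
    intro u v τ _
    have : autFactor 1 τ = 1 := by simp [autFactor]
    rw [this]
    simp
  | mem g hg =>
    simp only [Set.mem_insert_iff, Set.mem_singleton_iff] at hg
    rcases hg with rfl | rfl
    · intro u v τ hu
      have : autFactor ModularGroup.S τ = τ := by simp [autFactor, ModularGroup.S]
      rw [this, hS u v τ hu]
      simp [ModularGroup.S]
    · intro u v τ hu
      have : autFactor ModularGroup.T τ = 1 := by simp [autFactor, ModularGroup.T]
      rw [this, div_one, div_one, hT u v τ hu]
      simp [ModularGroup.T]
  | mul A B _ _ hA hB =>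
    intro u v τ hu
    have hb := autFactor_ne_zero B τ
    have ha := autFactor_ne_zero A (B • τ)
    rw [autFactor_mul, mul_smul, mul_comm (autFactor A (B • τ)), ← div_div, ← div_div,
      hA _ _ _ (hu.smul B), hB u v τ hu, hQ', mul_zpow]
    have e : exp (π * I * ((A * B) 1 0 : ℤ) * Q u v / (autFactor B τ * autFactor A (B • τ))) =
        exp (π * I * (A 1 0 : ℤ) * (Q u v / autFactor B τ ^ 2) / autFactor A (B • τ)) *
        exp (π * I * (B 1 0 : ℤ) * Q u v / autFactor B τ) := by
      rw [← Complex.exp_add]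
      congr 1
      -- Divided by j(A,Bτ) j(B,τ)², this is the additive cocycle relation for c/j, which makes the
      -- exponential factors compose. It uses det B = 1.
      have e1 : (((A * B) 1 0 : ℤ) : ℂ) * autFactor B τ = (A 1 0 : ℤ) +
          (B 1 0 : ℤ) * autFactor A (B • τ) * autFactor B τ := by
        have h1 := coe_smul_mul_autFactor B τ
        have h2 := det_eq_complex B
        rw [autFactor] at h1
        rw [mul_apply_one_zero, autFactor, autFactor]
        push_cast
        linear_combination (A 1 0 : ℂ) * h2 - (B 1 0 : ℂ) * (A 1 0) * h1
      field_simp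
      linear_combination Q u v * e1
    rw [e]
    ring
  | inv A _ hA =>
    intro u v τ hu
    have hb := autFactor_ne_zero A⁻¹ τ
    have ha := autFactor_ne_zero A (A⁻¹ • τ)
    have h1 : autFactor A (A⁻¹ • τ) * autFactor A⁻¹ τ = 1 := by
      rw [← autFactor_mul, mul_inv_cancel]; simp [autFactor]
    have h2 := hA (u / autFactor A⁻¹ τ) (v / autFactor A⁻¹ τ) _ (hu.smul A⁻¹)
    rw [div_div, div_div, mul_comm (autFactor A⁻¹ τ), h1, div_one, div_one, smul_inv_smul, hQ'] at h2
    rw [h2, ← mul_assoc, mul_mul_mul_comm, ← mul_zpow, mul_comm (autFactor A⁻¹ τ), h1, one_zpow,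
      one_mul, ← Complex.exp_add]
    have h3 : (A⁻¹ 1 0 : ℤ) = -A 1 0 := by
      rw [Matrix.SpecialLinearGroup.SL2_inv_expl]; simp
    have h4 : autFactor A (A⁻¹ • τ) = (autFactor A⁻¹ τ)⁻¹ := eq_inv_of_mul_eq_one_left h1
    rw [h3, h4]
    symm
    convert one_mul _ using 2
    rw [← Complex.exp_zero]
    congr 1
    push_cast
    field_simp
    ring

/-! ### The eta function -/

theorem eta_add_one (τ : ℂ) :
    ModularForm.eta (τ + 1) = exp (π * I / 12) * ModularForm.eta τ := by
  have h1 : ∀ n : ℕ, ModularForm.eta_q n (τ + 1) = ModularForm.eta_q n τ := fun n => by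
    rw [ModularForm.eta_q_eq_cexp, ModularForm.eta_q_eq_cexp]
    refine exp_congr (n + 1) ?_
    push_cast
    ring
  rw [ModularForm.eta, ModularForm.eta]
  simp_rw [h1]
  rw [← mul_assoc]
  congr 1
  rw [Function.Periodic.qParam, Function.Periodic.qParam, ← Complex.exp_add]
  push_cast
  ring_nf

theorem coe_T_smul (τ : ℍ) : ((ModularGroup.T • τ : ℍ) : ℂ) = τ + 1 := by
  rw [UpperHalfPlane.modular_T_smul]
  simp [add_comm]

theorem coe_S_smul (τ : ℍ) : ((ModularGroup.S • τ : ℍ) : ℂ) = -1 / τ := by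
  rw [UpperHalfPlane.modular_S_smul]
  simp [neg_div, inv_neg]

theorem sqrt_sq (z : ℂ) : Complex.sqrt z ^ 2 = z := by
  simp [Complex.sqrt]

theorem sqrt_ne_zero {z : ℂ} (h : z ≠ 0) : Complex.sqrt z ≠ 0 := by
  simp [Complex.sqrt, h]

theorem sqrt_mul {x y : ℂ} (hx : x ≠ 0) (hy : y ≠ 0)
    (h : Complex.arg x + Complex.arg y ∈ Set.Ioc (-π) π) :
    Complex.sqrt (x * y) = Complex.sqrt x * Complex.sqrt y := by
  rw [sqrt_eq_exp (mul_ne_zero hx hy), sqrt_eq_exp hx, sqrt_eq_exp hy, ← Complex.exp_add,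
    (Complex.log_mul_eq_add_log_iff hx hy).2 h]
  ring_nf

theorem sqrt_I_mul_sqrt {τ : ℂ} (hτ : 0 < τ.im) :
    Complex.sqrt τ = Complex.sqrt I * (-I * τ) ^ (1 / 2 : ℂ) := by
  have h0 : -I * τ ≠ 0 := mul_ne_zero (neg_ne_zero.2 Complex.I_ne_zero) (tau_ne_zero hτ)
  have h1 : I * (-I * τ) = τ := by linear_combination -τ * Complex.I_sq
  rw [show (1 / 2 : ℂ) = 2⁻¹ by norm_num]
  change _ = Complex.sqrt I * Complex.sqrt (-I * τ)
  rw [← sqrt_mul Complex.I_ne_zero h0, h1]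
  have h2 : 0 < (-I * τ).re := by simpa using hτ
  have h3 := abs_lt.1 (Complex.abs_arg_lt_pi_div_two_iff.2 (Or.inl h2))
  rw [Complex.arg_I]
  constructor <;> linarith [Real.pi_pos]

/-- The point i is fixed by S, so the two values of η in the definition cancel. -/
theorem etaMultiplier_S : etaMultiplier ModularGroup.S * Complex.sqrt I = 1 := by
  have h1 : ModularGroup.S • UpperHalfPlane.I = UpperHalfPlane.I := by
    ext
    rw [coe_S_smul]
    simp [neg_div]
  have h2 : ModularForm.eta ((UpperHalfPlane.I : ℍ) : ℂ) ≠ 0 :=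
    ModularForm.eta_ne_zero UpperHalfPlane.I.2
  have h3 : autFactor ModularGroup.S UpperHalfPlane.I = I := by simp [autFactor, ModularGroup.S]
  rw [etaMultiplier, h1, h3]
  have := sqrt_ne_zero Complex.I_ne_zero
  field_simp

theorem eta_S (τ : ℍ) : ModularForm.eta (-1 / τ : ℂ) =
    (-I * τ) ^ (1 / 2 : ℂ) * ModularForm.eta τ := by
  have h := eta_smul ModularGroup.S τ
  rw [coe_S_smul, show autFactor ModularGroup.S τ = τ by simp [autFactor, ModularGroup.S],
    sqrt_I_mul_sqrt τ.2] at h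
  rw [h, ← mul_assoc, etaMultiplier_S, one_mul]

theorem eta_coe_ne_zero (τ : ℍ) : ModularForm.eta (τ : ℂ) ≠ 0 := ModularForm.eta_ne_zero τ.2

theorem cpow_half_sq (τ : ℂ) : ((τ) ^ (1 / 2 : ℂ)) ^ 2 = τ := by
  rw [← Complex.cpow_nat_mul]; simp

/-- The transformation law of `ϑ` under `SL(2, ℤ)`, with `η³` as reference. -/
theorem theta_smul (A : SL(2, ℤ)) (z : ℂ) (τ : ℍ) :
    theta (z / autFactor A τ) (A • τ : ℍ) / ModularForm.eta (A • τ : ℍ) ^ 3 =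
      (autFactor A τ)⁻¹ * exp (π * I * (A 1 0 : ℤ) * z ^ 2 / autFactor A τ) *
        (theta z τ / ModularForm.eta τ ^ 3) := by
  -- ϑ/η³ has weight -1 and no multiplier: the factor exp(πi/4) cancels under T, and the roots leave
  -- 1/τ under S. The first argument 1/2 is a dummy chosen off the lattice.
  have h := jacobi_transform (fun _ v τ => theta v τ / ModularForm.eta τ ^ 3) (-1)
    (fun _ v => v ^ 2) (fun t u v => by ring) ?_ ?_ A (1 / 2) z τ ?_
  · simpa using h
  · intro _ v τ _
    rw [coe_T_smul, theta_T, eta_add_one, mul_pow, ← Complex.exp_nat_mul,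
      show ((3 : ℕ) * (π * I / 12) : ℂ) = π * I / 4 by push_cast; ring]
    rw [mul_div_mul_left _ _ (Complex.exp_ne_zero _)]
  · intro _ v τ _
    have h1 := cpow_half_sq (-I * τ)
    have h0 : (τ : ℂ) ≠ 0 := tau_ne_zero τ.2
    have hη := eta_coe_ne_zero τ
    have h2 : (-I * τ : ℂ) ^ (1 / 2 : ℂ) ≠ 0 := by
      intro h; rw [h] at h1; simp at h1; exact h0 h1
    rw [coe_S_smul, theta_S v τ.2, eta_S, mul_pow, zpow_neg_one]
    set κ := (-I * τ : ℂ) ^ (1 / 2 : ℂ)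
    field_simp
    rw [h1]
    ring
  · intro m n h
    have h1 := congrArg Complex.im h
    have h2 := congrArg Complex.re h
    simp at h1 h2
    rcases h1 with h1 | h1
    · rw [h1] at h2
      have : ((2 * m : ℤ) : ℝ) = 1 := by push_cast; linarith
      have : 2 * m = 1 := by exact_mod_cast this
      omega
    · exact absurd h1 τ.2.ne'

/-! ### The zeros of the theta function -/

/-- By induction, since consecutive odd multiples differ by 2 sin w cos((2m+2)w). Keeping the factor
|sin w| lets all theta terms be compared with the first one, even near its zeros. -/
theorem norm_sin_odd_mul_le (w : ℂ) (m : ℕ) :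
    ‖Complex.sin ((2 * m + 1) * w)‖ ≤
      (2 * m + 1) * Real.exp (2 * m * |w.im|) * ‖Complex.sin w‖ := by
  induction m with
  | zero => simp
  | succ m ih =>
    have h1 : Complex.sin ((2 * (m + 1 : ℕ) + 1) * w) = Complex.sin ((2 * m + 1) * w) +
        2 * Complex.sin w * Complex.cos ((2 * m + 2) * w) := by
      have h := Complex.sin_sub_sin ((2 * (m + 1 : ℕ) + 1) * w) ((2 * m + 1) * w)
      rw [show ((2 * (m + 1 : ℕ) + 1) * w - (2 * m + 1) * w) / 2 = w by push_cast; ring,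
        show ((2 * (m + 1 : ℕ) + 1) * w + (2 * m + 1) * w) / 2 = (2 * m + 2) * w by
          push_cast; ring] at h
      linear_combination h
    have h2 : ‖Complex.cos ((2 * m + 2) * w)‖ ≤ Real.exp (2 * (m + 1) * |w.im|) := by
      rw [Complex.cos, norm_div, Complex.norm_ofNat, div_le_iff₀ two_pos]
      have him : (((2 * m + 2) * w : ℂ) * I).re = -((2 * m + 2) * w.im) := by simp
      have him' : (-((2 * m + 2) * w : ℂ) * I).re = (2 * m + 2) * w.im := by simp
      refine (norm_add_le _ _).trans ?_
      rw [Complex.norm_exp, Complex.norm_exp, him, him', mul_two]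
      have h3 := neg_abs_le w.im
      have h4 := le_abs_self w.im
      have h5 : (0 : ℝ) ≤ 2 * m + 2 := by positivity
      have h6 := mul_le_mul_of_nonneg_left h3 h5
      have h7 := mul_le_mul_of_nonneg_left h4 h5
      refine add_le_add (Real.exp_le_exp.2 ?_) (Real.exp_le_exp.2 ?_) <;> linarith
    rw [h1]
    refine (norm_add_le _ _).trans ?_
    rw [norm_mul, norm_mul, Complex.norm_ofNat]
    have h3 : Real.exp (2 * m * |w.im|) ≤ Real.exp (2 * (m + 1) * |w.im|) := by
      gcongr; linarith
    have h4 := norm_nonneg (Complex.sin w)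
    push_cast
    calc _ ≤ (2 * m + 1) * Real.exp (2 * (m + 1) * |w.im|) * ‖Complex.sin w‖ +
          2 * ‖Complex.sin w‖ * Real.exp (2 * (m + 1) * |w.im|) := by
          refine add_le_add (ih.trans ?_) ?_
          · gcongr
          · gcongr
      _ = _ := by ring

theorem hasSum_theta_sin (v : ℂ) {τ : ℂ} (hτ : 0 < τ.im) :
    HasSum (fun m : ℕ => -2 * (-1 : ℂ) ^ m * exp (π * I * ((m : ℂ) + 1 / 2) ^ 2 * τ) *
      Complex.sin ((2 * m + 1) * (π * v))) (theta v τ) := by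
  have h2 : Summable fun m : ℤ => exp (π * I * ((m : ℂ) + 1 / 2) ^ 2 * τ +
      2 * π * I * ((m : ℂ) + 1 / 2) * (v + 1 / 2)) := by
    refine ((hasSum_jacobiTheta₂_term (v + 1 / 2 + τ / 2) hτ).summable.mul_left
      (exp (π * I * τ / 4 + π * I * (v + 1 / 2)))).congr fun m => ?_
    rw [jacobiTheta₂_term, ← Complex.exp_add]
    ring_nf
  have h3 := h2.hasSum.nat_add_neg_add_one
  rw [theta]
  refine h3.congr_fun fun m => ?_
  have e1 : (-1 : ℂ) ^ m * exp (π * I * ((m : ℂ) + 1 / 2) ^ 2 * τ) *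
      exp (-((2 * m + 1) * (π * v)) * I) =
      I * exp (π * I * (((-(m + 1 : ℤ) : ℤ) : ℂ) + 1 / 2) ^ 2 * τ +
      2 * π * I * (((-(m + 1 : ℤ) : ℤ) : ℂ) + 1 / 2) * (v + 1 / 2)) := by
    rw [I_mul_exp]
    have := exp_int_mul_pi_mul_I m
    rw [zpow_natCast] at this
    rw [← this, ← Complex.exp_add, ← Complex.exp_add]
    refine exp_congr m ?_
    push_cast
    ring
  have e2 : (-1 : ℂ) ^ m * exp (π * I * ((m : ℂ) + 1 / 2) ^ 2 * τ) *
      exp (((2 * m + 1) * (π * v)) * I) =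
      -I * exp (π * I * (((m : ℤ) : ℂ) + 1 / 2) ^ 2 * τ +
      2 * π * I * (((m : ℤ) : ℂ) + 1 / 2) * (v + 1 / 2)) := by
    rw [neg_mul, I_mul_exp]
    have := exp_int_mul_pi_mul_I m
    rw [zpow_natCast] at this
    rw [← this, ← Complex.exp_add, ← Complex.exp_add]
    refine exp_congr_neg (-1) ?_
    push_cast
    ring
  rw [Complex.sin]
  linear_combination (-I) * e1 + I * e2 - (exp (π * I * (((m : ℤ) : ℂ) + 1 / 2) ^ 2 * τ +
      2 * π * I * (((m : ℤ) : ℂ) + 1 / 2) * (v + 1 / 2)) +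
      exp (π * I * (((-(m + 1 : ℤ) : ℤ) : ℂ) + 1 / 2) ^ 2 * τ +
      2 * π * I * (((-(m + 1 : ℤ) : ℤ) : ℂ) + 1 / 2) * (v + 1 / 2))) * Complex.I_sq

/-- The first term of the sine series dominates. Its modulus is K, and the m-th term is at most
K(3x)^m with x = exp(-π Im τ) ≤ 1/7, because π·2/3 > 2 and e² > 7. The tail is then at most 3K/4,
which leaves K/4. The bound yields both the nonvanishing of ϑ and the growth of 1/ϑ. -/
theorem le_norm_theta {v τ : ℂ} (hτ : 2 / 3 ≤ τ.im) (hv : |v.im| ≤ τ.im / 2) :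
    1 / 2 * Real.exp (-(π * τ.im / 4)) * ‖Complex.sin (π * v)‖ ≤ ‖theta v τ‖ := by
  have hτ0 : 0 < τ.im := by linarith
  have hpi := Real.pi_pos
  have hpi3 := Real.pi_gt_three
  set K : ℝ := 2 * Real.exp (-(π * τ.im / 4)) * ‖Complex.sin (π * v)‖ with hK
  have hK0 : 0 ≤ K := by positivity
  set x : ℝ := Real.exp (-(π * τ.im)) with hx
  have hx7 : x ≤ 1 / 7 := by
    have h1 : x ≤ Real.exp (-2) := by
      rw [hx]; gcongr; nlinarith
    have h2 : Real.exp (-2) = (Real.exp 1 ^ 2)⁻¹ := by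
      rw [← Real.exp_nat_mul, ← Real.exp_neg]; norm_num
    have h3 : (7 : ℝ) ≤ Real.exp 1 ^ 2 := by nlinarith [Real.exp_one_gt_d9]
    rw [h2] at h1
    refine h1.trans ?_
    rw [one_div]
    gcongr
  set f : ℕ → ℂ := fun m : ℕ => -2 * (-1 : ℂ) ^ m * exp (π * I * ((m : ℂ) + 1 / 2) ^ 2 * τ) *
      Complex.sin ((2 * m + 1) * (π * v)) with hf
  have hnexp : ∀ m : ℕ, ‖exp (π * I * ((m : ℂ) + 1 / 2) ^ 2 * τ)‖ =
      Real.exp (-(π * ((m : ℝ) + 1 / 2) ^ 2 * τ.im)) := fun m => by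
    rw [Complex.norm_exp, show (π * I * ((m : ℂ) + 1 / 2) ^ 2 * τ) =
      ((π * ((m : ℝ) + 1 / 2) ^ 2 : ℝ) : ℂ) * (τ * I) by push_cast; ring,
      Complex.re_ofReal_mul, Complex.mul_I_re]
    ring_nf
  have hbound : ∀ m, ‖f m‖ ≤ K * (3 / 7) ^ m := by
    intro m
    rw [hf]
    simp only [norm_mul, norm_neg, Complex.norm_ofNat, norm_pow, norm_one, one_pow, mul_one, hnexp]
    have h1 := norm_sin_odd_mul_le (π * v) m
    have h2 : 2 * (m : ℝ) * |(π * v : ℂ).im| ≤ π * m * τ.im := by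
      rw [Complex.im_ofReal_mul, abs_mul, abs_of_pos hpi]
      have : 0 ≤ 2 * (m : ℝ) * π := by positivity
      nlinarith
    have h3 : (2 * (m : ℝ) + 1) ≤ 3 ^ m := by
      have := one_add_mul_le_pow (a := (2 : ℝ)) (by norm_num) m
      norm_num at this
      linarith
    have h4 : Real.exp (-(π * ((m : ℝ) + 1 / 2) ^ 2 * τ.im)) * Real.exp (π * m * τ.im) ≤
        Real.exp (-(π * τ.im / 4)) * x ^ m := by
      rw [hx, ← Real.exp_nat_mul, ← Real.exp_add, ← Real.exp_add]
      refine Real.exp_le_exp.2 ?_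
      have h5 : (m : ℝ) ≤ m ^ 2 := by
        exact_mod_cast Nat.le_self_pow two_ne_zero m
      have h6 : 0 ≤ π * τ.im := by positivity
      nlinarith
    calc _ ≤ 2 * Real.exp (-(π * ((m : ℝ) + 1 / 2) ^ 2 * τ.im)) *
          (3 ^ m * Real.exp (π * m * τ.im) * ‖Complex.sin (π * v)‖) := by
          gcongr
          refine h1.trans ?_
          gcongr
      _ = 2 * (Real.exp (-(π * ((m : ℝ) + 1 / 2) ^ 2 * τ.im)) * Real.exp (π * m * τ.im)) * 3 ^ m *
          ‖Complex.sin (π * v)‖ := by ring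
      _ ≤ 2 * (Real.exp (-(π * τ.im / 4)) * x ^ m) * 3 ^ m * ‖Complex.sin (π * v)‖ := by gcongr
      _ = K * (3 * x) ^ m := by rw [hK, mul_pow]; ring
      _ ≤ K * (3 / 7) ^ m := by
          gcongr
          linarith
  have hs := hasSum_theta_sin v hτ0
  have h1 : theta v τ = f 0 + ∑' m : ℕ, f (m + 1) := by
    rw [← hs.tsum_eq, hs.summable.tsum_eq_zero_add]
  have h2 : HasSum (fun m : ℕ => K * (3 / 7) ^ (m + 1)) (K * (3 / 4)) := by
    have := (hasSum_geometric_of_lt_one (r := (3 / 7 : ℝ)) (by norm_num) (by norm_num)).mul_left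
      (K * (3 / 7))
    convert! this using 1
    · funext m; rw [pow_succ]; ring
    · norm_num; ring
  have h3 : ‖∑' m : ℕ, f (m + 1)‖ ≤ K * (3 / 4) :=
    tsum_of_norm_bounded h2 fun m => hbound (m + 1)
  have h4 : ‖f 0‖ = K := by
    rw [hf, hK]
    simp only [norm_mul, norm_neg, Complex.norm_ofNat, norm_pow, norm_one, one_pow, mul_one, hnexp]
    norm_num
    left
    ring_nf
  have h5 := norm_sub_norm_le (f 0) (-∑' m : ℕ, f (m + 1))
  rw [norm_neg, sub_neg_eq_add, ← h1, h4] at h5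
  linarith

theorem sin_pi_mul_ne_zero {v τ : ℂ} (hv : OffLattice v τ) : Complex.sin (π * v) ≠ 0 := by
  rw [Complex.sin_ne_zero_iff]
  intro k hk
  have hpi : (π : ℂ) ≠ 0 := by exact_mod_cast Real.pi_ne_zero
  refine hv k 0 ?_
  apply mul_left_cancel₀ hpi
  rw [hk]; push_cast; ring

theorem OffLattice.add_int_mul {v τ : ℂ} (hv : OffLattice v τ) (n : ℤ) :
    OffLattice (v + n * τ) τ := by
  intro m k h
  refine hv m (k - n) ?_
  push_cast
  linear_combination h

theorem OffLattice.add_int {v τ : ℂ} (hv : OffLattice v τ) (n : ℤ) : OffLattice (v + n) τ := by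
  intro m k h
  refine hv (m - n) k ?_
  push_cast
  linear_combination h

/-- Iteration of a quasi-periodicity. -/
theorem add_int_mul_of_add {F : ℂ → ℂ} {S : Set ℂ} {τ a b : ℂ}
    (hS : ∀ z ∈ S, ∀ n : ℤ, z + n * τ ∈ S)
    (hF : ∀ z ∈ S, F (z + τ) = -exp (a + b * z) * F z) {z : ℂ} (hz : z ∈ S) (n : ℤ) :
    F (z + n * τ) = (-1) ^ n * exp (n * a + n * b * z + b * τ * (n * (n - 1) / 2)) * F z := by
  have step : ∀ n : ℤ, F (z + (n + 1 : ℤ) * τ) =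
      -exp (a + b * (z + n * τ)) * F (z + n * τ) := fun n => by
    rw [← hF _ (hS z hz n)]
    congr 1
    push_cast
    ring
  induction n using Int.induction_on with
  | zero => simp
  | succ n ih =>
    have e : exp (a + b * (z + (n : ℤ) * τ)) *
        exp ((n : ℤ) * a + (n : ℤ) * b * z + b * τ * ((n : ℤ) * ((n : ℤ) - 1) / 2)) =
        exp ((n + 1 : ℤ) * a + (n + 1 : ℤ) * b * z +
          b * τ * ((n + 1 : ℤ) * ((n + 1 : ℤ) - 1) / 2)) := by
      rw [← Complex.exp_add]
      push_cast
      ring_nf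
    rw [step, ih, zpow_add₀ (by norm_num), zpow_one]
    linear_combination (-(-1) ^ (n : ℤ) * F z) * e
  | pred n ih =>
    have h := step (-n - 1)
    rw [sub_add_cancel, ih] at h
    have h0 := Complex.exp_ne_zero (a + b * (z + (-n - 1 : ℤ) * τ))
    have h1 : F (z + (-n - 1 : ℤ) * τ) = -exp (-(a + b * (z + (-n - 1 : ℤ) * τ))) *
        ((-1) ^ (-n : ℤ) * exp ((-n : ℤ) * a + (-n : ℤ) * b * z +
          b * τ * ((-n : ℤ) * ((-n : ℤ) - 1) / 2)) * F z) := by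
      rw [h, Complex.exp_neg]
      field_simp
    rw [h1, zpow_sub₀ (by norm_num), zpow_one, div_neg, div_one, ← mul_assoc, mul_left_comm,
      neg_mul (exp _) (exp _), ← Complex.exp_add, mul_neg, neg_mul]
    push_cast
    ring_nf

theorem theta_add_int_mul_tau (z τ : ℂ) (n : ℤ) : theta (z + n * τ) τ =
    (-1) ^ n * exp (-(π * I * n ^ 2 * τ) - 2 * π * I * n * z) * theta z τ := by
  have h := add_int_mul_of_add (F := fun z => theta z τ) (S := Set.univ) (τ := τ)
    (a := -(π * I * τ)) (b := -(2 * π * I)) (fun _ _ _ => trivial)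
    (fun z _ => by rw [theta_add_tau, neg_mul _ z, ← sub_eq_add_neg]) (Set.mem_univ z) n
  rw [h]
  congr 3
  ring

theorem abs_im_sub_round_le (r s : ℝ) {τ : ℂ} (hτ : 0 < τ.im) :
    |(r * τ + s + (-round r : ℤ) * τ : ℂ).im| ≤ τ.im / 2 := by
  have : (r * τ + s + (-round r : ℤ) * τ : ℂ).im = (r - round r) * τ.im := by
    push_cast
    simp
    ring
  rw [this, abs_mul, abs_of_pos hτ]
  have := abs_sub_round r
  nlinarith

/-- The modular law moves τ into the fundamental domain, where Im τ ≥ √3/2 > 2/3. A translation by a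
multiple of τ then brings v into the strip of `le_norm_theta`, where the sine is nonzero off the
lattice. -/
theorem theta_ne_zero {v : ℂ} {τ : ℍ} (hv : OffLattice v τ) : theta v τ ≠ 0 := by
  obtain ⟨A, hA⟩ := ModularGroup.exists_smul_mem_fd τ
  have hy : 2 / 3 ≤ (A • τ).im := by
    have := ModularGroup.three_le_four_mul_im_sq_of_mem_fd hA
    nlinarith [(A • τ).im_pos]
  have hj := autFactor_ne_zero A τ
  have hv' := hv.smul A
  intro h0
  have h1 := theta_smul A v τ
  rw [h0, zero_div, mul_zero, div_eq_zero_iff] at h1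
  have h2 := h1.resolve_right (pow_ne_zero _ (eta_coe_ne_zero _))
  obtain ⟨r, s, hrs⟩ := exists_real_coords (v / autFactor A τ) (A • τ).2
  rw [hrs] at h2 hv'
  have h3 := theta_add_int_mul_tau (r * (A • τ : ℍ) + s) (A • τ : ℍ) (-round r)
  rw [h2, mul_zero] at h3
  have h4 := le_norm_theta (v := r * (A • τ : ℍ) + s + (-round r : ℤ) * (A • τ : ℍ))
    (τ := (A • τ : ℍ)) hy (abs_im_sub_round_le r s (A • τ).2)
  rw [h3, norm_zero] at h4
  have h5 := norm_pos_iff.2 (sin_pi_mul_ne_zero (hv'.add_int_mul (-round r)))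
  have h6 := Real.exp_pos (-(π * ((A • τ : ℍ) : ℂ).im / 4))
  have : 0 < 1 / 2 * Real.exp (-(π * ((A • τ : ℍ) : ℂ).im / 4)) *
    ‖Complex.sin (π * (r * (A • τ : ℍ) + s + (-round r : ℤ) * (A • τ : ℍ)))‖ := by positivity
  linarith

/-! ### Transformation laws of `μ̃` -/

theorem muTilde_eq {v : ℂ} {τ : ℍ} (hv : OffLattice v τ) (u : ℂ) :
    muTilde u v τ = completedNumer u v τ / theta v τ := by
  have := theta_ne_zero hv
  rw [muTilde, mu_eq, completedNumer]
  field_simp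

theorem muTilde_add_tau_left {u v : ℂ} {τ : ℍ} (hu : OffLattice u τ) (hv : OffLattice v τ) :
    muTilde (u + τ) v τ = -exp (π * I * τ + 2 * π * I * (u - v)) * muTilde u v τ := by
  rw [muTilde_eq hv, muTilde_eq hv, completedNumer_add_tau_left hu τ.2, mul_div_assoc]

theorem muTilde_add_tau_right {u v : ℂ} {τ : ℍ} (hu : OffLattice u τ) (hv : OffLattice v τ) :
    muTilde u (v + τ) τ = -exp (π * I * τ - 2 * π * I * (u - v)) * muTilde u v τ := by
  have hv' : OffLattice (v + τ) τ := by simpa using hv.add_int_mul 1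
  rw [muTilde_eq hv, muTilde_eq hv', completedNumer_add_tau_right hu τ.2, theta_add_tau]
  have h0 := theta_ne_zero hv
  have e : exp (-(2 * π * I * u)) = exp (π * I * τ - 2 * π * I * (u - v)) *
      exp (-(π * I * τ) - 2 * π * I * v) := by
    rw [← Complex.exp_add]; ring_nf
  have h1 := Complex.exp_ne_zero (-(π * I * τ) - 2 * π * I * v)
  rw [e]
  field_simp

theorem muTilde_add_one_left {u v : ℂ} {τ : ℍ} (hv : OffLattice v τ) :
    muTilde (u + 1) v τ = -muTilde u v τ := by
  rw [muTilde_eq hv, muTilde_eq hv, completedNumer_add_one_left, neg_div]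

theorem muTilde_add_one_right {u v : ℂ} {τ : ℍ} (hv : OffLattice v τ) :
    muTilde u (v + 1) τ = -muTilde u v τ := by
  have hv' : OffLattice (v + 1) τ := by simpa using hv.add_int 1
  rw [muTilde_eq hv, muTilde_eq hv', completedNumer_add_one_right, theta_add_one, div_neg]

/-- The elliptic transformation law of `μ̃`. -/
theorem muTilde_add {u v : ℂ} {τ : ℍ} (hu : OffLattice u τ) (hv : OffLattice v τ)
    (k l m n : ℤ) : muTilde (u + k * τ + l) (v + m * τ + n) τ =
      (-1) ^ (k + l + m + n) *
        exp (π * I * (k - m) ^ 2 * τ + 2 * π * I * (k - m) * (u - v)) * muTilde u v τ := by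
  have n1 : (-1 : ℂ) ≠ 0 := by norm_num
  have h1 : ∀ u v, OffLattice u τ → OffLattice v τ → ∀ k : ℤ, muTilde (u + k * τ) v τ =
      (-1) ^ k * exp (π * I * k ^ 2 * τ + 2 * π * I * k * (u - v)) * muTilde u v τ := by
    intro u v hu hv k
    have h := add_int_mul_of_add (F := fun z => muTilde z v τ) (S := {z | OffLattice z τ})
      (τ := τ) (a := π * I * τ - 2 * π * I * v) (b := 2 * π * I)
      (fun z hz n => OffLattice.add_int_mul hz n)
      (fun z hz => by rw [muTilde_add_tau_left hz hv]; ring_nf) hu k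
    rw [h]
    congr 3
    ring
  have h2 : ∀ u v, OffLattice u τ → OffLattice v τ → ∀ m : ℤ, muTilde u (v + m * τ) τ =
      (-1) ^ m * exp (π * I * m ^ 2 * τ - 2 * π * I * m * (u - v)) * muTilde u v τ := by
    intro u v hu hv k
    have h := add_int_mul_of_add (F := fun z => muTilde u z τ) (S := {z | OffLattice z τ})
      (τ := τ) (a := π * I * τ - 2 * π * I * u) (b := 2 * π * I)
      (fun z hz n => OffLattice.add_int_mul hz n)
      (fun z hz => by rw [muTilde_add_tau_right hu hz]; ring_nf) hv k
    rw [h]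
    congr 3
    ring
  have hint : ∀ {F : ℂ → ℂ} {v : ℂ}, (∀ z, OffLattice z τ → F (z + 1) = -F z) →
      OffLattice v τ → ∀ n : ℤ, F (v + n) = (-1) ^ n * F v := by
    intro F v hF hv n
    induction n using Int.induction_on with
    | zero => simp
    | succ n ih =>
      push_cast at ih ⊢
      rw [← add_assoc, hF _ (by simpa using hv.add_int n), ih, zpow_add₀ n1, zpow_one]
      ring
    | pred n ih =>
      have h := hF (v + ((-n - 1 : ℤ) : ℂ)) (hv.add_int _)
      rw [show v + ((-n - 1 : ℤ) : ℂ) + 1 = v + ((-n : ℤ) : ℂ) by push_cast; ring, ih] at h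
      rw [zpow_sub₀ n1, zpow_one]
      linear_combination h
  rw [hint (F := fun z => muTilde z (v + m * τ + n) τ)
      (fun z _ => muTilde_add_one_left ((hv.add_int_mul m).add_int n)) (hu.add_int_mul k) l,
    hint (F := fun z => muTilde (u + k * τ) z τ) (fun z hz => muTilde_add_one_right hz)
      (hv.add_int_mul m) n, h1 _ _ hu (hv.add_int_mul m), h2 _ _ hu hv, zpow_add₀ n1,
    zpow_add₀ n1, zpow_add₀ n1]
  have e : exp (π * I * (k - m) ^ 2 * τ + 2 * π * I * (k - m) * (u - v)) =
      exp (π * I * k ^ 2 * τ + 2 * π * I * k * (u - (v + m * τ))) *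
      exp (π * I * m ^ 2 * τ - 2 * π * I * m * (u - v)) := by
    rw [← Complex.exp_add]; ring_nf
  rw [e]
  ring

/-- The modular transformation law of `μ̃`. -/
theorem muTilde_smul {u v : ℂ} {τ : ℍ} (hu : OffLattice u τ) (hv : OffLattice v τ)
    (A : SL(2, ℤ)) :
    muTilde (u / autFactor A τ) (v / autFactor A τ) (A • τ : ℍ) =
      etaMultiplier A ^ (-3 : ℤ) * Complex.sqrt (autFactor A τ) *
        exp (-(π * I * (A 1 0 : ℤ) * (u - v) ^ 2 / autFactor A τ)) * muTilde u v τ := by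
  have hj := autFactor_ne_zero A τ
  have h1 := jacobi_transform (fun u v τ => completedNumer u v τ) 1 (fun u v => 2 * u * v - u ^ 2)
    (fun t u v => by ring) (fun u v τ _ => by rw [coe_T_smul, completedNumer_T])
    (fun u v τ hu => by rw [coe_S_smul, zpow_one, completedNumer_S hu τ.2]) A u v τ hu
  have h2 := theta_smul A v τ
  have h3 := eta_smul A τ
  have hη := eta_coe_ne_zero τ
  have hη' := eta_coe_ne_zero (A • τ)
  have hs := sqrt_ne_zero hj
  have hs2 := sqrt_sq (autFactor A τ)
  have hν : etaMultiplier A ≠ 0 := by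
    intro h; rw [h, zero_mul, zero_mul] at h3; exact hη' h3
  have hθ := theta_ne_zero hv
  have hθ' := theta_ne_zero (hv.smul A)
  rw [muTilde_eq hv, muTilde_eq (hv.smul A), h1, zpow_one]
  -- The quadratic form of μ̃ is that of the numerator minus that of ϑ: (2uv - u²) - v² = -(u-v)².
  have e : exp (π * I * (A 1 0 : ℤ) * (2 * u * v - u ^ 2) / autFactor A τ) =
      exp (-(π * I * (A 1 0 : ℤ) * (u - v) ^ 2 / autFactor A τ)) *
      exp (π * I * (A 1 0 : ℤ) * v ^ 2 / autFactor A τ) := by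
    rw [← Complex.exp_add]; ring_nf
  have hE := Complex.exp_ne_zero (π * I * (A 1 0 : ℤ) * v ^ 2 / autFactor A τ)
  have h4 : theta (v / autFactor A τ) (A • τ : ℍ) = etaMultiplier A ^ 3 *
      Complex.sqrt (autFactor A τ) * exp (π * I * (A 1 0 : ℤ) * v ^ 2 / autFactor A τ) *
        theta v τ := by
    rw [div_eq_iff (pow_ne_zero _ hη'), h3] at h2
    rw [h2]
    field_simp
    exact hs2
  rw [h4, e, zpow_neg]
  norm_cast
  set j := autFactor A τ
  field_simp
  rw [hs2]
  ring

/-! ### Jacobi symbols -/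

theorem jacobiSym_add_four_mul (c : ℤ) {n : ℕ} (hn : Odd n) :
    J(c | n + 4 * c.natAbs) = J(c | n) := by
  have h2 : Odd (n + 4 * c.natAbs) := by
    rw [Nat.odd_iff] at hn ⊢; omega
  rw [jacobiSym.mod_right c h2, Nat.add_mod_right, ← jacobiSym.mod_right c hn]

/-- Modulo 4e - 1 one has 4e ≡ 1, and the symbol of 4 is 1. -/
theorem jacobiSym_four_mul_sub_one {e : ℕ} (he : 0 < e) : J(e | 4 * e - 1) = 1 := by
  have hodd : Odd (4 * e - 1) := by rw [Nat.odd_iff]; omega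
  have h1 : J((4 : ℤ) * e | 4 * e - 1) = J(1 | 4 * e - 1) := by
    apply jacobiSym.mod_left'
    have : ((4 : ℤ) * e) = 1 + ((4 * e - 1 : ℕ) : ℤ) := by
      rw [Nat.cast_sub (by omega)]; push_cast; ring
    rw [this, Int.add_emod_right]
  rw [jacobiSym.mul_left, jacobiSym.at_four hodd, one_mul, jacobiSym.one_left] at h1
  exact h1

/-- The symbol has period 4e in its odd denominator, and m(4e-m) ≡ -m² ≡ m²(4e-1) mod 4e. Hence the
product of the two symbols is 1. -/
theorem jacobiSym_four_mul_sub {e m : ℕ} (hm : Odd m) (hlt : m < 4 * e)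
    (hco : (e : ℤ).gcd m = 1) : J(e | 4 * e - m) = J(e | m) := by
  have he : 0 < e := by omega
  have hm0 : m ≠ 0 := by rintro rfl; simp at hm
  have hodd : Odd (4 * e - m) := by rw [Nat.odd_iff] at hm ⊢; omega
  have hodd1 : Odd (4 * e - 1) := by rw [Nat.odd_iff]; omega
  have h1 : J(e | m * (4 * e - m)) = J(e | m ^ 2 * (4 * e - 1)) := by
    rw [jacobiSym.mod_right' e (hm.mul hodd), jacobiSym.mod_right' e (hm.pow.mul hodd1)]
    congr 1
    change m * (4 * e - m) ≡ m ^ 2 * (4 * e - 1) [MOD 4 * e]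
    rw [← Int.natCast_modEq_iff, Int.modEq_iff_dvd]
    push_cast [Nat.cast_sub hlt.le, Nat.cast_sub (by omega : 1 ≤ 4 * e)]
    exact ⟨m ^ 2 - m, by ring⟩
  rw [jacobiSym.mul_right' _ hm0 (by omega), jacobiSym.mul_right' _ (pow_ne_zero 2 hm0) (by omega),
    jacobiSym.pow_right, jacobiSym.sq_one hco, jacobiSym_four_mul_sub_one he, one_mul] at h1
  rcases jacobiSym.eq_one_or_neg_one hco with h | h <;> rw [h] at h1 ⊢ <;> linarith

theorem jacobiSym_neg_four_mul_sub {e m : ℕ} (hm : Odd m) (hlt : m < 4 * e)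
    (hco : (e : ℤ).gcd m = 1) : J(-e | 4 * e - m) = -J(-e | m) := by
  have hodd : Odd (4 * e - m) := by rw [Nat.odd_iff] at hm ⊢; omega
  rw [jacobiSym.neg _ hodd, jacobiSym.neg _ hm, jacobiSym_four_mul_sub hm hlt hco]
  have : ZMod.χ₄ ((4 * e - m : ℕ) : ZMod 4) = -ZMod.χ₄ (m : ZMod 4) := by
    rcases Nat.odd_mod_four_iff.1 (Nat.odd_iff.1 hm) with h | h
    · rw [ZMod.χ₄_nat_one_mod_four h, ZMod.χ₄_nat_three_mod_four (by omega)]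
    · rw [ZMod.χ₄_nat_three_mod_four h, ZMod.χ₄_nat_one_mod_four (by omega)]; rfl
  rw [this]
  ring

/-- For |n| this is the periodicity of the Jacobi symbol as long as d and d + 4c have the same sign.
When the sign changes, 4|c| - |d| replaces |d|, and for c < 0 the resulting sign is absorbed by the
convention for two negative entries. -/
theorem jacobiExt_add_four_mul {c d : ℤ} (hd : Odd d) (hco : IsCoprime c d) :
    jacobiExt c (d + 4 * c) = jacobiExt c d := by
  obtain ⟨m, rfl | rfl⟩ := d.eq_nat_or_neg <;> obtain ⟨e, rfl | rfl⟩ := c.eq_nat_or_neg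
  · have hm : Odd m := by simpa using hd
    rw [jacobiExt, jacobiExt, if_neg (by omega), if_neg (by omega)]
    have := jacobiSym_add_four_mul e hm
    rw [show ((m : ℤ) + 4 * e).natAbs = m + 4 * (e : ℤ).natAbs by omega, this, Int.natAbs_natCast]
  · have hm : Odd m := by simpa using hd
    have hco' : (e : ℤ).gcd m = 1 :=
      Int.isCoprime_iff_gcd_eq_one.1 ((IsCoprime.neg_left_iff _ _).1 hco)
    rcases lt_or_ge m (4 * e) with h | h
    · rw [jacobiExt, jacobiExt, if_pos (by omega), if_neg (by omega),
        show ((m : ℤ) + 4 * -e).natAbs = 4 * e - m by omega, jacobiSym_neg_four_mul_sub hm h hco',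
        neg_neg, Int.natAbs_natCast]
    · rw [jacobiExt, jacobiExt, if_neg (by omega), if_neg (by omega)]
      have hodd : Odd (m - 4 * e) := by rw [Nat.odd_iff] at hm ⊢; omega
      have := jacobiSym_add_four_mul (-e) hodd
      rw [Int.natAbs_neg, Int.natAbs_natCast, Nat.sub_add_cancel h] at this
      rw [show ((m : ℤ) + 4 * -e).natAbs = m - 4 * e by omega, Int.natAbs_natCast, this]
  · have hm : Odd m := by simpa using hd
    have hco' : (e : ℤ).gcd m = 1 :=
      Int.isCoprime_iff_gcd_eq_one.1 ((IsCoprime.neg_right_iff _ _).1 hco)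
    rw [jacobiExt, jacobiExt, if_neg (by omega), if_neg (by omega), Int.natAbs_neg,
      Int.natAbs_natCast]
    rcases lt_or_ge m (4 * e) with h | h
    · rw [show (-(m : ℤ) + 4 * e).natAbs = 4 * e - m by omega, jacobiSym_four_mul_sub hm h hco']
    · have hodd : Odd (m - 4 * e) := by rw [Nat.odd_iff] at hm ⊢; omega
      have := jacobiSym_add_four_mul e hodd
      rw [Int.natAbs_natCast, Nat.sub_add_cancel h] at this
      rw [show (-(m : ℤ) + 4 * e).natAbs = m - 4 * e by omega, this]
  · have hm : Odd m := by simpa using hd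
    have hm0 : m ≠ 0 := by rintro rfl; simp at hm
    have := jacobiSym_add_four_mul (-e) hm
    rw [Int.natAbs_neg, Int.natAbs_natCast] at this
    rw [jacobiExt, jacobiExt, show (-(m : ℤ) + 4 * -e).natAbs = m + 4 * e by omega, this,
      Int.natAbs_neg, Int.natAbs_natCast]
    by_cases he : e = 0
    · rw [if_neg (by omega), if_neg (by omega)]
    · rw [if_pos (by omega), if_pos (by omega)]

/-- The ordinary symbol depends only on c mod d. A sign arises only if d < 0 and the sign of the
upper entry changes; this condition coincides with that of `signFactor`. -/
theorem jacobiExt_add_self (c d : ℤ) :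
    jacobiExt (c + d) d = (if 0 ≤ c ∧ c + d < 0 then -1 else 1) * jacobiExt c d := by
  have h : jacobiSym (c + d) d.natAbs = jacobiSym c d.natAbs := by
    apply jacobiSym.mod_left'
    rw [Int.natCast_natAbs, Int.emod_abs, Int.emod_abs, Int.add_emod_right]
  rw [jacobiExt, jacobiExt, h]
  split_ifs <;> omega

/-! ### Signs of square roots -/

theorem sqrt_I : Complex.sqrt I = exp (π * I / 4) := by
  rw [sqrt_eq_exp Complex.I_ne_zero, Complex.log_I]
  ring_nf

theorem sqrt_neg_one : Complex.sqrt (-1) = I := by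
  rw [sqrt_eq_exp (by norm_num), Complex.log_neg_one, exp_pi_mul_I_div_two]

theorem sqrt_eq_sqrt_neg_mul {w : ℂ} (hw : 0 < w.im ∨ w.im = 0 ∧ w.re < 0) :
    Complex.sqrt w = Complex.sqrt (-w) * I := by
  have h0 : w ≠ 0 := by
    rintro rfl; simp at hw
  have h1 := Complex.arg_neg_eq_arg_sub_pi_iff.2 hw
  have h2 := sqrt_mul (neg_ne_zero.2 h0) (by norm_num : (-1 : ℂ) ≠ 0) (by
    rw [h1, Complex.arg_neg_one, sub_add_cancel]
    exact Complex.arg_mem_Ioc w)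
  rw [sqrt_neg_one] at h2
  rw [← h2]
  ring_nf

theorem sqrt_mul_of_im_pos {x y : ℂ} (hy : 0 < y.im)
    (hx : x.im < 0 ∨ x.im = 0 ∧ 0 < x.re) :
    Complex.sqrt (x * y) = Complex.sqrt x * Complex.sqrt y := by
  have hx0 : x ≠ 0 := by rintro rfl; simp at hx
  refine sqrt_mul hx0 (tau_ne_zero hy) ?_
  have h1 : 0 ≤ y.arg := Complex.arg_nonneg_iff.2 hy.le
  have h2 := Complex.neg_pi_lt_arg x
  have h3 : x.arg ≤ 0 := by
    rcases hx with hx | ⟨hx, hx'⟩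
    · exact (Complex.arg_neg_iff.2 hx).le
    · exact (Complex.arg_eq_zero_iff.2 ⟨hx'.le, hx⟩).le
  exact ⟨by linarith, by linarith [Complex.arg_le_pi y]⟩

theorem sqrt_mul_of_im_pos' {x y : ℂ} (hy : 0 < y.im)
    (hx : 0 < x.im ∨ x.im = 0 ∧ x.re < 0) :
    Complex.sqrt (-(x * y)) * I = Complex.sqrt x * Complex.sqrt y := by
  rw [sqrt_eq_sqrt_neg_mul hx, ← neg_mul, sqrt_mul_of_im_pos hy (by simpa using hx)]
  ring

/-- The sign in `√(j(A, Uτ)) √(τ + 1) = ± √((c + d)τ + d)`. -/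
def signFactor (c d : ℤ) : ℤ := if 0 ≤ c ∧ c + d < 0 then -1 else 1

/-- The principal root is multiplicative unless arg x + arg y exceeds π. With y in the upper half
plane, this happens exactly when x lies in the upper half plane or on the negative axis while xy has
fallen into the lower half plane. The hypotheses translate this into 0 ≤ c and c + d < 0. -/
theorem sqrt_mul_sqrt {c d : ℤ} (hcd : c ≠ 0 ∨ d ≠ 0) {x y : ℂ} (hy : 0 < y.im)
    (hx : 0 < x.im ↔ 0 < c) (hx1 : x.im = 0 ↔ c = 0) (hx2 : c = 0 → x.re = d)
    (hz : 0 < (x * y).im ↔ 0 < c + d) (hz1 : (x * y).im = 0 ↔ c + d = 0)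
    (hz2 : c + d = 0 → (x * y).re = d) :
    Complex.sqrt x * Complex.sqrt y = signFactor c d * Complex.sqrt (x * y) := by
  rw [signFactor]
  rcases lt_trichotomy c 0 with hc | hc | hc
  · rw [if_neg (by omega), Int.cast_one, one_mul, sqrt_mul_of_im_pos hy]
    left
    refine lt_of_le_of_ne (not_lt.1 fun h => ?_) fun h => ?_
    · have := hx.1 h; omega
    · have := hx1.1 h; omega
  · rcases lt_or_ge d 0 with hd | hd
    · have h1 : x.im = 0 ∧ x.re < 0 := ⟨hx1.2 hc, by rw [hx2 hc]; exact_mod_cast hd⟩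
      rw [← sqrt_mul_of_im_pos' hy (Or.inr h1), if_pos (by omega)]
      have h2 : (x * y).im < 0 := by
        refine lt_of_le_of_ne (not_lt.1 fun h => ?_) fun h => ?_
        · have := hz.1 h; omega
        · have := hz1.1 h; omega
      rw [sqrt_eq_sqrt_neg_mul (w := -(x * y)) (Or.inl (by rw [Complex.neg_im]; linarith)), neg_neg]
      push_cast
      linear_combination Complex.sqrt (x * y) * Complex.I_sq
    · have hd' : 0 < d := by omega
      rw [if_neg (by omega), Int.cast_one, one_mul, sqrt_mul_of_im_pos hy]
      exact Or.inr ⟨hx1.2 hc, by rw [hx2 hc]; exact_mod_cast hd'⟩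
  · rw [← sqrt_mul_of_im_pos' hy (Or.inl (hx.2 hc))]
    rcases lt_or_ge (c + d) 0 with h | h
    · rw [if_pos (by omega)]
      have h2 : (x * y).im < 0 := by
        refine lt_of_le_of_ne (not_lt.1 fun h => ?_) fun h => ?_
        · have := hz.1 h; omega
        · have := hz1.1 h; omega
      rw [sqrt_eq_sqrt_neg_mul (w := -(x * y)) (Or.inl (by rw [Complex.neg_im]; linarith)), neg_neg]
      push_cast
      linear_combination Complex.sqrt (x * y) * Complex.I_sq
    · rw [if_neg (by omega), Int.cast_one, one_mul, ← sqrt_eq_sqrt_neg_mul]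
      rcases h.lt_or_eq with h | h
      · exact Or.inl (hz.2 h)
      · refine Or.inr ⟨hz1.2 h.symm, ?_⟩
        rw [hz2 h.symm]
        exact_mod_cast (by omega : d < 0)

/-! ### The multiplier of `η³` -/

theorem etaMultiplier_mul_T (A : SL(2, ℤ)) :
    etaMultiplier (A * ModularGroup.T) = exp (π * I / 12) * etaMultiplier A := by
  have h1 := eta_smul (A * ModularGroup.T) UpperHalfPlane.I
  have h2 := eta_smul A (ModularGroup.T • UpperHalfPlane.I)
  have h3 : autFactor ModularGroup.T UpperHalfPlane.I = 1 := by simp [autFactor, ModularGroup.T]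
  rw [mul_smul, h2, autFactor_mul, h3, mul_one, coe_T_smul, eta_add_one] at h1
  have h4 := eta_coe_ne_zero UpperHalfPlane.I
  have h5 := sqrt_ne_zero (autFactor_ne_zero A (ModularGroup.T • UpperHalfPlane.I))
  apply mul_right_cancel₀ (mul_ne_zero h5 h4)
  linear_combination -h1

theorem etaMultiplier_T_mul (A : SL(2, ℤ)) :
    etaMultiplier (ModularGroup.T * A) = exp (π * I / 12) * etaMultiplier A := by
  have h1 := eta_smul (ModularGroup.T * A) UpperHalfPlane.I
  have h2 := eta_smul A UpperHalfPlane.I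
  have h3 : autFactor ModularGroup.T (A • UpperHalfPlane.I) = 1 := by
    simp [autFactor, ModularGroup.T]
  rw [mul_smul, autFactor_mul, h3, one_mul, coe_T_smul, eta_add_one, h2] at h1
  have h4 := eta_coe_ne_zero UpperHalfPlane.I
  have h5 := sqrt_ne_zero (autFactor_ne_zero A UpperHalfPlane.I)
  apply mul_right_cancel₀ (mul_ne_zero h5 h4)
  linear_combination -h1

/-- The matrix `(1, 0; 1, 1)`. -/
def lowerU : SL(2, ℤ) := ⟨!![1, 0; 1, 1], by simp⟩

theorem lowerU_eq : lowerU = ModularGroup.T * ModularGroup.S * ModularGroup.T := by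
  ext i j
  fin_cases i <;> fin_cases j <;> rfl

theorem etaMultiplier_lowerU : etaMultiplier lowerU = exp (-(π * I / 12)) := by
  rw [lowerU_eq, etaMultiplier_mul_T, etaMultiplier_T_mul]
  have h := etaMultiplier_S
  rw [sqrt_I] at h
  rw [eq_div_of_mul_eq (Complex.exp_ne_zero _) h, one_div, ← Complex.exp_neg, ← Complex.exp_add,
    ← Complex.exp_add]
  ring_nf

theorem etaMultiplier_mul_lowerU (A : SL(2, ℤ)) : etaMultiplier (A * lowerU) =
    signFactor (A 1 0) (A 1 1) * exp (-(π * I / 12)) * etaMultiplier A := by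
  have h1 := eta_smul (A * lowerU) UpperHalfPlane.I
  have h2 := eta_smul A (lowerU • UpperHalfPlane.I)
  have h3 := eta_smul lowerU UpperHalfPlane.I
  have hy : 0 < (autFactor lowerU UpperHalfPlane.I).im := by simp [autFactor, lowerU]
  have him : ∀ (B : SL(2, ℤ)) (τ : ℍ), (autFactor B τ).im = (B 1 0 : ℝ) * τ.im := fun B τ => by
    simp [autFactor]
  have hre : ∀ (B : SL(2, ℤ)) (τ : ℍ), (autFactor B τ).re = (B 1 0 : ℝ) * τ.re + (B 1 1 : ℝ) :=
    fun B τ => by simp [autFactor]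
  have e1 : (A * lowerU) 1 0 = A 1 0 + A 1 1 := by
    rw [mul_apply_one_zero]; simp [lowerU]
  have e2 : (A * lowerU) 1 1 = A 1 1 := by
    rw [mul_apply_one_one]; simp [lowerU]
  have hcd : A 1 0 ≠ 0 ∨ A 1 1 ≠ 0 := by
    by_contra! h
    have := det_eq A
    rw [h.1, h.2] at this
    simp at this
  have h4 := sqrt_mul_sqrt hcd (x := autFactor A (lowerU • UpperHalfPlane.I)) hy
    (by rw [him, mul_pos_iff_of_pos_right (im_pos _)]; exact Int.cast_pos)
    (by rw [him, mul_eq_zero, or_iff_left (im_pos _).ne']; exact Int.cast_eq_zero)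
    (fun h => by rw [hre, h]; simp)
    (by rw [← autFactor_mul, him, mul_pos_iff_of_pos_right (im_pos _), e1]; exact Int.cast_pos)
    (by rw [← autFactor_mul, him, mul_eq_zero, or_iff_left (im_pos _).ne', e1]
        exact Int.cast_eq_zero)
    (fun h => by rw [← autFactor_mul, hre, e1, e2, h]; simp)
  rw [mul_smul, h2, h3, autFactor_mul, etaMultiplier_lowerU] at h1
  have h5 := eta_coe_ne_zero UpperHalfPlane.I
  have h6 := sqrt_ne_zero (mul_ne_zero (autFactor_ne_zero A (lowerU • UpperHalfPlane.I))
    (autFactor_ne_zero lowerU UpperHalfPlane.I))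
  apply mul_right_cancel₀ (mul_ne_zero h6 h5)
  linear_combination -h1 + (etaMultiplier A * exp (-(π * I / 12)) *
    ModularForm.eta (UpperHalfPlane.I : ℍ)) * h4

/-- The exponent in the formula for the multiplier of `η³`. -/
def etaExponent (a b c d : ℤ) : ℤ := (a + d) * c - b * d * (c ^ 2 - 1) + 3 * d - 3 - 3 * c * d

/-- The multiplier of `η³` for matrices with odd lower right entry. -/
def etaCubeFormula (A : SL(2, ℤ)) : ℂ :=
  jacobiExt (A 1 0) (A 1 1) * exp (π * I / 4 * etaExponent (A 0 0) (A 0 1) (A 1 0) (A 1 1))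

theorem exp_congr_mod_eight {m n : ℤ} (k : ℤ) (h : m = n + 8 * k) :
    exp (π * I / 4 * m) = exp (π * I / 4 * n) := by
  refine exp_congr k ?_
  rw [h]; push_cast; ring

theorem isCoprime_row (A : SL(2, ℤ)) : IsCoprime (A 1 0) (A 1 1) :=
  ⟨-A 0 1, A 0 0, by linear_combination det_eq A⟩

/-- T⁴ is used because d ↦ d + 4c keeps d odd and preserves the extended symbol. The exponent
changes by 4 mod 8, in agreement with (exp(πi/12))¹² = -1. -/
theorem etaCubeFormula_mul_T (A : SL(2, ℤ)) (hd : Odd (A 1 1)) :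
    etaCubeFormula (A * ModularGroup.T * ModularGroup.T * ModularGroup.T * ModularGroup.T) =
      -etaCubeFormula A := by
  set B := A * ModularGroup.T * ModularGroup.T * ModularGroup.T * ModularGroup.T with hB
  have e00 : B 0 0 = A 0 0 := by
    simp only [hB, mul_apply_zero_zero]; simp [ModularGroup.T]
  have e01 : B 0 1 = A 0 1 + 4 * A 0 0 := by
    simp only [hB, mul_apply_zero_zero, mul_apply_zero_one]; simp [ModularGroup.T]; ring
  have e10 : B 1 0 = A 1 0 := by
    simp only [hB, mul_apply_one_zero]; simp [ModularGroup.T]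
  have e11 : B 1 1 = A 1 1 + 4 * A 1 0 := by
    simp only [hB, mul_apply_one_zero, mul_apply_one_one]; simp [ModularGroup.T]; ring
  rw [etaCubeFormula, etaCubeFormula, e00, e01, e10, e11,
    jacobiExt_add_four_mul hd (isCoprime_row A), ← mul_neg]
  congr 1
  obtain ⟨t, ht⟩ := Int.even_mul_pred_self (A 1 0)
  have hdet := det_eq A
  generalize A 0 0 = a at *
  generalize A 0 1 = b at *
  generalize A 1 0 = c at *
  generalize A 1 1 = d at *
  have h1 : etaExponent a (b + 4 * a) c (d + 4 * c) = (etaExponent a b c d + 4) +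
      8 * (-c ^ 2 + c - (b * c + 2 * a * c) * (c ^ 2 - 1) - t) := by
    rw [etaExponent, etaExponent]
    linear_combination -4 * ht - 4 * (c ^ 2 - 1) * hdet
  rw [exp_congr_mod_eight _ h1]
  refine exp_congr_neg 0 ?_
  push_cast
  ring

/-- The sign of the extended Jacobi symbol matches the sign of the principal square roots, and d² ≡
1 mod 8 shows that the exponent drops by 1 mod 8. -/
theorem etaCubeFormula_mul_lowerU (A : SL(2, ℤ)) (hd : Odd (A 1 1)) :
    etaCubeFormula (A * lowerU) =
      signFactor (A 1 0) (A 1 1) * exp (-(π * I / 4)) * etaCubeFormula A := by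
  have e00 : (A * lowerU) 0 0 = A 0 0 + A 0 1 := by
    rw [mul_apply_zero_zero]; simp [lowerU]
  have e01 : (A * lowerU) 0 1 = A 0 1 := by
    rw [mul_apply_zero_one]; simp [lowerU]
  have e10 : (A * lowerU) 1 0 = A 1 0 + A 1 1 := by
    rw [mul_apply_one_zero]; simp [lowerU]
  have e11 : (A * lowerU) 1 1 = A 1 1 := by
    rw [mul_apply_one_one]; simp [lowerU]
  rw [etaCubeFormula, etaCubeFormula, e00, e01, e10, e11, jacobiExt_add_self]
  obtain ⟨e, he⟩ := hd
  obtain ⟨t, ht⟩ := Int.even_mul_succ_self e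
  have hdet := det_eq A
  have hsq : A 1 1 ^ 2 = 1 + 8 * t := by rw [he]; linear_combination 4 * ht
  have h1 : etaExponent (A 0 0 + A 0 1) (A 0 1) (A 1 0 + A 1 1) (A 1 1) =
      (etaExponent (A 0 0) (A 0 1) (A 1 0) (A 1 1) - 1) +
        8 * (-(2 * t * A 0 1 * A 1 0 + t * A 0 1 * A 1 1 + 2 * t)) := by
    rw [etaExponent, etaExponent]
    linear_combination hdet - (2 * A 0 1 * A 1 0 + A 0 1 * A 1 1 + 2) * hsq
  have h2 : exp (π * I / 4 * ((etaExponent (A 0 0) (A 0 1) (A 1 0) (A 1 1) - 1 : ℤ) : ℂ)) =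
      exp (-(π * I / 4)) * exp (π * I / 4 * etaExponent (A 0 0) (A 0 1) (A 1 0) (A 1 1)) := by
    rw [← Complex.exp_add]
    push_cast
    ring_nf
  rw [exp_congr_mod_eight _ h1, h2, signFactor]
  push_cast
  ring

theorem etaMultiplier_cube_mul_T (A : SL(2, ℤ)) :
    etaMultiplier (A * ModularGroup.T * ModularGroup.T * ModularGroup.T * ModularGroup.T) ^ 3 =
      -etaMultiplier A ^ 3 := by
  have h : exp (π * I / 12) ^ 12 = -1 := by
    rw [← Complex.exp_nat_mul, ← Complex.exp_pi_mul_I]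
    congr 1
    push_cast
    ring
  simp only [etaMultiplier_mul_T]
  linear_combination etaMultiplier A ^ 3 * h

theorem etaMultiplier_cube_mul_lowerU (A : SL(2, ℤ)) : etaMultiplier (A * lowerU) ^ 3 =
    signFactor (A 1 0) (A 1 1) * exp (-(π * I / 4)) * etaMultiplier A ^ 3 := by
  have h : exp (-(π * I / 12)) ^ 3 = exp (-(π * I / 4)) := by
    rw [← Complex.exp_nat_mul]
    congr 1
    push_cast
    ring
  have h2 : (signFactor (A 1 0) (A 1 1) : ℂ) ^ 3 = signFactor (A 1 0) (A 1 1) := by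
    rw [signFactor]; split_ifs <;> norm_num
  rw [etaMultiplier_mul_lowerU, mul_pow, mul_pow, h, h2]

theorem signFactor_ne_zero (c d : ℤ) : (signFactor c d : ℂ) ≠ 0 := by
  rw [signFactor]; split_ifs <;> norm_num

/-- Base case of the descent: A is ± a power of T, and the branch √(-1) = i decides the sign for d =
-1. -/
theorem etaMultiplier_cube_of_lower_zero (A : SL(2, ℤ)) (hc : A 1 0 = 0) :
    etaMultiplier A ^ 3 = etaCubeFormula A := by
  have hdet := det_eq A
  rw [hc, mul_zero, sub_zero] at hdet
  have hη : ∀ (n : ℤ) (z : ℂ), ModularForm.eta (z + n) =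
      exp (π * I / 12 * n) * ModularForm.eta z := by
    intro n z
    induction n using Int.induction_on with
    | zero => simp
    | succ n ih =>
      push_cast at ih ⊢
      rw [← add_assoc, eta_add_one, ih, ← mul_assoc, ← Complex.exp_add]
      ring_nf
    | pred n ih =>
      have h := eta_add_one (z + ((-n - 1 : ℤ) : ℂ))
      rw [show z + ((-n - 1 : ℤ) : ℂ) + 1 = z + ((-n : ℤ) : ℂ) by push_cast; ring, ih] at h
      have e : exp (π * I / 12) * exp (π * I / 12 * ((-n - 1 : ℤ) : ℂ)) =
          exp (π * I / 12 * ((-n : ℤ) : ℂ)) := by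
        rw [← Complex.exp_add]; push_cast; ring_nf
      apply mul_left_cancel₀ (Complex.exp_ne_zero (π * I / 12))
      rw [← h, ← mul_assoc, e]
  have h1 := eta_smul A UpperHalfPlane.I
  have h2 := eta_coe_ne_zero UpperHalfPlane.I
  have h3 := coe_smul_mul_autFactor A UpperHalfPlane.I
  rcases Int.eq_one_or_neg_one_of_mul_eq_one' hdet with ⟨ha, hd⟩ | ⟨ha, hd⟩
  · have hj : autFactor A UpperHalfPlane.I = 1 := by simp [autFactor, hc, hd]
    rw [hj, ha] at h3
    simp only [mul_one, Int.cast_one, one_mul] at h3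
    rw [h3, hη, hj, Complex.sqrt_one, mul_one] at h1
    rw [← mul_right_cancel₀ h2 h1, etaCubeFormula, ha, hc, hd, ← Complex.exp_nat_mul, jacobiExt]
    simp [etaExponent]
    congr 1
    ring
  · have hj : autFactor A UpperHalfPlane.I = -1 := by simp [autFactor, hc, hd]
    rw [hj, ha] at h3
    have h3' : ((A • UpperHalfPlane.I : ℍ) : ℂ) = UpperHalfPlane.I + ((-A 0 1 : ℤ) : ℂ) := by
      push_cast at h3 ⊢
      linear_combination -h3
    rw [h3', hη, hj, sqrt_neg_one] at h1
    have h4 : etaMultiplier A = -I * exp (π * I / 12 * ((-A 0 1 : ℤ) : ℂ)) := by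
      apply mul_right_cancel₀ h2
      linear_combination I * h1 + etaMultiplier A * ModularForm.eta UpperHalfPlane.I * Complex.I_sq
    have hI : (-I) ^ 3 = I := by linear_combination -I * Complex.I_sq
    rw [h4, etaCubeFormula, ha, hc, hd, mul_pow, ← Complex.exp_nat_mul, jacobiExt, hI, I_mul_exp]
    simp [etaExponent]
    refine exp_congr 1 ?_
    push_cast
    ring

/-- The multiplier of `η³` for matrices with odd lower right entry. -/
theorem etaMultiplier_cube (A : SL(2, ℤ)) (hd : Odd (A 1 1)) :
    etaMultiplier A ^ 3 = etaCubeFormula A := by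
  -- Euclidean descent on the bottom row with moves preserving the parity of d. If |d| > 2|c|, a
  -- step d ↦ d ± 4c lowers |d|; otherwise |d| < 2|c|, as d is odd, and c ↦ c ± d lowers |c|.
  -- Equality of multiplier and formula is invariant under both moves.
  induction hn : (A 1 0).natAbs + (A 1 1).natAbs using Nat.strong_induction_on generalizing A with
  | _ n ih =>
  have hT : ∀ B : SL(2, ℤ), Odd (B 1 1) → (etaMultiplier (B * ModularGroup.T * ModularGroup.T *
      ModularGroup.T * ModularGroup.T) ^ 3 = etaCubeFormula (B * ModularGroup.T * ModularGroup.T *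
      ModularGroup.T * ModularGroup.T) ↔ etaMultiplier B ^ 3 = etaCubeFormula B) := by
    intro B hB
    rw [etaMultiplier_cube_mul_T, etaCubeFormula_mul_T B hB, neg_inj]
  have hU : ∀ B : SL(2, ℤ), Odd (B 1 1) → (etaMultiplier (B * lowerU) ^ 3 =
      etaCubeFormula (B * lowerU) ↔ etaMultiplier B ^ 3 = etaCubeFormula B) := by
    intro B hB
    rw [etaMultiplier_cube_mul_lowerU, etaCubeFormula_mul_lowerU B hB]
    exact mul_right_inj' (mul_ne_zero (signFactor_ne_zero _ _) (Complex.exp_ne_zero _))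
  have hTi : ∀ B : SL(2, ℤ), (B * ModularGroup.T⁻¹) 1 0 = B 1 0 ∧
      (B * ModularGroup.T⁻¹) 1 1 = B 1 1 - B 1 0 := fun B => by
    rw [mul_apply_one_zero, mul_apply_one_one, ModularGroup.coe_T_inv]
    simp; ring
  have hTe : ∀ B : SL(2, ℤ), (B * ModularGroup.T) 1 0 = B 1 0 ∧
      (B * ModularGroup.T) 1 1 = B 1 1 + B 1 0 := fun B => by
    rw [mul_apply_one_zero, mul_apply_one_one, ModularGroup.coe_T]
    simp; ring
  by_cases hc : A 1 0 = 0
  · exact etaMultiplier_cube_of_lower_zero A hc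
  obtain ⟨e, he⟩ := id hd
  rcases lt_or_ge (2 * (A 1 0).natAbs) (A 1 1).natAbs with h | h
  · by_cases hs : (0 < A 1 0 ∧ 0 < A 1 1) ∨ (A 1 0 < 0 ∧ A 1 1 < 0)
    · set B := A * ModularGroup.T⁻¹ * ModularGroup.T⁻¹ * ModularGroup.T⁻¹ * ModularGroup.T⁻¹ with hB
      have h10 : B 1 0 = A 1 0 := by simp only [hB, hTi]
      have h11 : B 1 1 = A 1 1 - 4 * A 1 0 := by simp only [hB, hTi]; ring
      have hBd : Odd (B 1 1) := ⟨e - 2 * A 1 0, by rw [h11, he]; ring⟩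
      have := (hT B hBd).2 (ih _ (by rw [← hn, h10, h11]; omega) B hBd rfl)
      simpa [hB, mul_assoc] using this
    · set B := A * ModularGroup.T * ModularGroup.T * ModularGroup.T * ModularGroup.T with hB
      have h10 : B 1 0 = A 1 0 := by simp only [hB, hTe]
      have h11 : B 1 1 = A 1 1 + 4 * A 1 0 := by simp only [hB, hTe]; ring
      have hBd : Odd (B 1 1) := ⟨e + 2 * A 1 0, by rw [h11, he]; ring⟩
      exact (hT A hd).1 (ih _ (by rw [← hn, h10, h11]; omega) B hBd rfl)
  · by_cases hs : (0 < A 1 0 ∧ 0 < A 1 1) ∨ (A 1 0 < 0 ∧ A 1 1 < 0)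
    · have hUi : (lowerU⁻¹ : SL(2, ℤ)) = ⟨!![1, 0; -1, 1], by simp⟩ := by
        rw [Matrix.SpecialLinearGroup.SL2_inv_expl]
        ext i j
        fin_cases i <;> fin_cases j <;> simp [lowerU]
      have h10 : (A * lowerU⁻¹) 1 0 = A 1 0 - A 1 1 := by
        rw [mul_apply_one_zero, hUi]; simp; ring
      have h11 : (A * lowerU⁻¹) 1 1 = A 1 1 := by
        rw [mul_apply_one_one, hUi]; simp
      have := (hU (A * lowerU⁻¹) (by rwa [h11])).2
        (ih _ (by rw [← hn, h10, h11]; omega) _ (by rwa [h11]) rfl)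
      simpa using this
    · have h10 : (A * lowerU) 1 0 = A 1 0 + A 1 1 := by
        rw [mul_apply_one_zero]; simp [lowerU]
      have h11 : (A * lowerU) 1 1 = A 1 1 := by
        rw [mul_apply_one_one]; simp [lowerU]
      exact (hU A hd).1 (ih _ (by rw [← hn, h10, h11]; omega) _ (by rwa [h11]) rfl)

/-! ### Transformation of `N₇` -/

/-- The point `98τ`. -/
def dilate (τ : ℍ) : ℍ := ⟨98 * τ, by simpa using τ.im_pos⟩

theorem coe_dilate (τ : ℍ) : (dilate τ : ℂ) = 98 * τ := rfl

theorem offLattice_mul {x : ℝ} (hx : ∀ n : ℤ, x ≠ n) (τ : ℍ) : OffLattice (x * τ) τ := by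
  intro m n h
  have h1 := congrArg Complex.im h
  simp only [Complex.mul_im, Complex.add_im, Complex.ofReal_re, Complex.ofReal_im,
    Complex.intCast_re, Complex.intCast_im, zero_mul, add_zero, zero_add] at h1
  exact hx n (mul_right_cancel₀ τ.im_pos.ne' h1)

theorem offLattice_left {k : ℤ} (hk : ¬ (7 : ℤ) ∣ k) (τ : ℍ) : OffLattice (k / 7 * τ) τ := by
  have := offLattice_mul (x := k / 7) (fun n h => hk ⟨n, ?_⟩) τ
  · push_cast at this
    exact this
  · rw [div_eq_iff (by norm_num)] at h
    rw [mul_comm]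
    exact_mod_cast h

theorem offLattice_right (τ : ℍ) : OffLattice (1 / 2 * τ) τ := by
  have := offLattice_mul (x := 1 / 2) (fun n h => ?_) τ
  · push_cast at this
    exact this
  · rw [div_eq_iff (by norm_num)] at h
    have : (1 : ℤ) = n * 2 := by exact_mod_cast h
    omega

/-- Completing the square, -k² + 7k - 49/4 = -(k - 7/2)². The power of q is therefore
exp(-πi(u-v)²/σ), the factor that absorbs the automorphy exponential of μ̃. -/
theorem N7_eq (k : ℤ) (τ : ℍ) : N7 k τ =
    exp (-(π * I * (k / 7 - 1 / 2) ^ 2 * dilate τ)) *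
      muTilde (k / 7 * dilate τ) (1 / 2 * dilate τ) (dilate τ) := by
  rw [N7, coe_dilate]
  congr 2 <;> ring

@[simp] theorem twist_zero_zero (m : ℤ) (A : SL(2, ℤ)) (h : m ∣ A 1 0) :
    twist m A h 0 0 = A 0 0 := rfl

@[simp] theorem twist_zero_one (m : ℤ) (A : SL(2, ℤ)) (h : m ∣ A 1 0) :
    twist m A h 0 1 = m * A 0 1 := rfl

@[simp] theorem twist_one_zero (m : ℤ) (A : SL(2, ℤ)) (h : m ∣ A 1 0) :
    twist m A h 1 0 = A 1 0 / m := rfl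

@[simp] theorem twist_one_one (m : ℤ) (A : SL(2, ℤ)) (h : m ∣ A 1 0) :
    twist m A h 1 1 = A 1 1 := rfl

theorem autFactor_twist {m : ℤ} {A : SL(2, ℤ)} (h : m ∣ A 1 0) {σ τ : ℍ}
    (hσ : (σ : ℂ) = m * τ) : autFactor (twist m A h) σ = autFactor A τ := by
  have h' : m * (A 1 0 / m) = A 1 0 := Int.mul_ediv_cancel' h
  have h'' : (m : ℂ) * ((A 1 0 / m : ℤ) : ℂ) = (A 1 0 : ℤ) := by exact_mod_cast h'
  rw [autFactor, autFactor, hσ, ← h'', twist_one_zero, twist_one_one]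
  ring

theorem dilate_smul {A : SL(2, ℤ)} (h : 98 ∣ A 1 0) (τ : ℍ) :
    dilate (A • τ) = twist 98 A h • dilate τ := by
  apply UpperHalfPlane.ext
  have h0 := autFactor_ne_zero A τ
  rw [coe_dilate, coe_smul_eq, coe_smul_eq,
    autFactor_twist h (τ := τ) (by rw [coe_dilate]; norm_num), coe_dilate]
  simp
  ring

theorem N7_smul {k : ℤ} (hk : ¬ (7 : ℤ) ∣ k) {A : SL(2, ℤ)} (h : 98 ∣ A 1 0)
    (ha : 14 ∣ A 0 0 - 1) (τ : ℍ) : N7 k (A • τ) =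
      etaMultiplier (twist 98 A h) ^ (-3 : ℤ) * (-1) ^ (A 0 1 + (A 0 0 - 1) / 2) *
        I ^ (-(A 0 0 * A 0 1)) * Complex.sqrt (autFactor A τ) * N7 k τ := by
  obtain ⟨s, hs⟩ := ha
  have hα : A 0 0 = 1 + 14 * s := by linarith
  have hα' : ((A 0 0 : ℤ) : ℂ) = 1 + 14 * s := by rw [hα]; push_cast; ring
  set B := twist 98 A h with hB
  set σ := dilate τ with hσ
  have e00 : B 0 0 = A 0 0 := rfl
  have e01 : B 0 1 = 98 * A 0 1 := rfl
  have hj : autFactor B σ = autFactor A τ := autFactor_twist h (by rw [coe_dilate]; norm_num)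
  have h0 := autFactor_ne_zero A τ
  -- With α = 1 + 14s, multiplying ασ + 98β by k/7 or by 1/2 gives the original point plus a lattice
  -- vector.
  set u : ℂ := k / 7 * σ + (2 * k * s : ℤ) * σ + (14 * k * A 0 1 : ℤ) with hu
  set v : ℂ := 1 / 2 * σ + (7 * s : ℤ) * σ + (49 * A 0 1 : ℤ) with hv
  have hBσ : ((B • σ : ℍ) : ℂ) = ((A 0 0 : ℤ) * σ + 98 * (A 0 1 : ℤ)) / autFactor A τ := by
    rw [coe_smul_eq, hj, e00, e01]; push_cast; rfl
  have hu' : (k / 7 : ℂ) * (B • σ : ℍ) = u / autFactor B σ := by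
    rw [hBσ, hj, hu, hα']; push_cast; ring
  have hv' : (1 / 2 : ℂ) * (B • σ : ℍ) = v / autFactor B σ := by
    rw [hBσ, hj, hv, hα']; push_cast; ring
  have hu0 := offLattice_left hk σ
  have hv0 := offLattice_right σ
  rw [N7_eq, N7_eq, dilate_smul h, ← hB, ← hσ, hu', hv',
    muTilde_smul ((hu0.add_int_mul _).add_int _) ((hv0.add_int_mul _).add_int _),
    muTilde_add hu0 hv0, hj]
  have hsign : (-1 : ℂ) ^ (2 * k * s + 14 * k * A 0 1 + 7 * s + 49 * A 0 1) =
      (-1) ^ (A 0 1 + (A 0 0 - 1) / 2) := by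
    have : 2 * k * s + 14 * k * A 0 1 + 7 * s + 49 * A 0 1 =
        (A 0 1 + (A 0 0 - 1) / 2) + 2 * (k * s + 7 * k * A 0 1 + 24 * A 0 1) := by
      rw [hs, show 14 * s / 2 = 7 * s by omega]; ring
    rw [this, zpow_add₀ (by norm_num), zpow_mul]
    norm_num
  have hexp : exp (-(π * I * (k / 7 - 1 / 2) ^ 2 * (B • σ : ℍ))) *
      (exp (-(π * I * (B 1 0 : ℤ) * ((k / 7 * σ + (2 * k * s : ℤ) * σ + (14 * k * A 0 1 : ℤ)) -
        (1 / 2 * σ + (7 * s : ℤ) * σ + (49 * A 0 1 : ℤ))) ^ 2 / autFactor A τ)) *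
      exp (π * I * ((2 * k * s : ℤ) - (7 * s : ℤ)) ^ 2 * σ +
        2 * π * I * ((2 * k * s : ℤ) - (7 * s : ℤ)) * (k / 7 * σ - 1 / 2 * σ))) =
      I ^ (-(A 0 0 * A 0 1)) * exp (-(π * I * (k / 7 - 1 / 2) ^ 2 * σ)) := by
    have hI : I ^ (-(A 0 0 * A 0 1)) = exp (((-(A 0 0 * A 0 1) : ℤ) : ℂ) * (π * I / 2)) := by
      rw [Complex.exp_int_mul, exp_pi_mul_I_div_two]
    obtain ⟨t, ht⟩ := Int.even_mul_pred_self k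
    have ht' : (k : ℂ) * (k - 1) = t + t := by exact_mod_cast ht
    have hdet := det_eq_complex B
    rw [e00, e01] at hdet
    have hjB : ((B 1 0 : ℤ) : ℂ) * σ + (B 1 1 : ℤ) = autFactor A τ := by rw [← hj]; rfl
    -- For w = ασ + 98β and B of bottom row (c, d), det B = 1 gives 1 + cw = α(cσ + d), so all
    -- denominators disappear.
    have e1 : (((A 0 0 : ℤ) : ℂ) * σ + 98 * (A 0 1 : ℤ)) / autFactor A τ +
        (B 1 0 : ℤ) * (((A 0 0 : ℤ) : ℂ) * σ + 98 * (A 0 1 : ℤ)) ^ 2 / autFactor A τ =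
        (A 0 0 : ℤ) * (((A 0 0 : ℤ) : ℂ) * σ + 98 * (A 0 1 : ℤ)) := by
      rw [← add_div, div_eq_iff h0, ← hjB]
      push_cast at hdet
      linear_combination (-(((A 0 0 : ℤ) : ℂ) * σ + 98 * (A 0 1 : ℤ))) * hdet
    rw [hI, ← Complex.exp_add, ← Complex.exp_add, ← Complex.exp_add, hBσ]
    -- The leftover exponent is -πiαβ·2(k - 7/2)², where 2(k - 7/2)² = 2k(k-1) - 12k + 24 + 1/2 and
    -- k(k-1) = 2t. The part 1/2 gives i^{-αβ}; the rest is even and gives this multiple of 2πi.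
    refine exp_congr (-(A 0 0 * A 0 1 * (2 * t - 6 * k + 12))) ?_
    push_cast
    rw [hα'] at e1 ⊢
    linear_combination (-(π * I * (k / 7 - 1 / 2) ^ 2) : ℂ) * e1 -
      2 * π * I * (1 + 14 * s) * (A 0 1 : ℤ) * ht'
  rw [hsign]
  linear_combination (etaMultiplier B ^ (-3 : ℤ) * Complex.sqrt (autFactor A τ) *
    (-1) ^ (A 0 1 + (A 0 0 - 1) / 2) * muTilde (k / 7 * σ) (1 / 2 * σ) σ) * hexp

/-! ### Comparison and evaluation of the multipliers. -/

theorem jacobiExt_mul {a : ℤ} (ha : 0 < a) (c d : ℤ) :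
    jacobiExt (a * c) d = J(a | d.natAbs) * jacobiExt c d := by
  have h : a * c < 0 ↔ c < 0 := by
    rw [mul_neg_iff]; constructor
    · rintro (h | h) <;> omega
    · intro h; exact Or.inl ⟨ha, h⟩
  simp only [jacobiExt, h, jacobiSym.mul_left]
  split_ifs <;> ring

theorem odd_of_two_dvd {A : SL(2, ℤ)} (h : 2 ∣ A 1 0) : Odd (A 1 1) := by
  obtain ⟨c, hc⟩ := h
  have hdet := det_eq A
  rw [hc] at hdet
  have h1 : Odd (A 0 0 * A 1 1) := ⟨A 0 1 * c, by linear_combination hdet⟩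
  exact (Int.odd_mul.1 h1).2

/-- Passing between the twists multiplies the lower left entry by 7² and divides the upper right one
by 49. The symbol is unchanged since 7 is prime to δ, and the exponent changes by a multiple of 8
since 49 ≡ 1 mod 8. -/
theorem etaMultiplier_twist_cube {A : SL(2, ℤ)} (h : 98 ∣ A 1 0) (h2 : 2 ∣ A 1 0) :
    etaMultiplier (twist 98 A h) ^ 3 = etaMultiplier (twist 2 A h2) ^ 3 := by
  have hd := odd_of_two_dvd h2
  rw [etaMultiplier_cube (twist 98 A h) hd, etaMultiplier_cube (twist 2 A h2) hd, etaCubeFormula,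
    etaCubeFormula]
  obtain ⟨g, hg⟩ := id h
  have hdet := det_eq A
  simp only [twist_zero_zero, twist_zero_one, twist_one_zero, twist_one_one]
  rw [hg] at hdet ⊢
  rw [show 98 * g / 98 = g by omega, show 98 * g / 2 = 7 ^ 2 * g by omega,
    jacobiExt_mul (by norm_num)]
  have hco : (7 : ℤ).gcd ((A 1 1).natAbs : ℤ) = 1 := by
    have : IsCoprime (7 : ℤ) (A 1 1) := ⟨-A 0 1 * 14 * g, A 0 0, by linear_combination hdet⟩
    rw [Int.gcd, Int.natAbs_natCast]
    exact Int.isCoprime_iff_gcd_eq_one.1 this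
  rw [jacobiSym.pow_left, jacobiSym.sq_one hco, one_mul]
  congr 1
  refine exp_congr_mod_eight (-(6 * g * (A 0 0 + A 1 1) -
    2 * A 0 1 * A 1 1 * (294 * g ^ 2 + 6) - 18 * g * A 1 1)) ?_
  rw [etaExponent, etaExponent]
  ring

theorem dvd_of_mem_Gamma0 {n : ℕ} {A : SL(2, ℤ)} (h : A ∈ CongruenceSubgroup.Gamma0 n) :
    (n : ℤ) ∣ A 1 0 :=
  (ZMod.intCast_zmod_eq_zero_iff_dvd _ _).1 (CongruenceSubgroup.Gamma0_mem.1 h)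

theorem dvd_of_mem_Gamma1 {n : ℕ} {A : SL(2, ℤ)} (h : A ∈ CongruenceSubgroup.Gamma1 n) :
    (n : ℤ) ∣ A 0 0 - 1 ∧ (n : ℤ) ∣ A 1 1 - 1 := by
  have := (CongruenceSubgroup.Gamma1_mem _ _).1 h
  rw [← ZMod.intCast_zmod_eq_zero_iff_dvd, ← ZMod.intCast_zmod_eq_zero_iff_dvd]
  push_cast
  exact ⟨by rw [this.1, sub_self], by rw [this.2.1, sub_self]⟩

theorem zpow_neg_three (x : ℂ) : x ^ (-3 : ℤ) = (x ^ 3)⁻¹ := by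
  rw [zpow_neg]; norm_cast

theorem N7_smul_of_mem {k : ℤ} (hk : ¬ (7 : ℤ) ∣ k) {A : SL(2, ℤ)}
    (hA : A ∈ CongruenceSubgroup.Gamma1 14 ⊓ CongruenceSubgroup.Gamma0 98) (τ : ℍ) :
    N7 k (A • τ) = etaMultiplier (twist 2 A (two_dvd_of_mem hA)) ^ (-3 : ℤ) *
      (-1 : ℂ) ^ (A 0 1 + (A 0 0 - 1) / 2) * I ^ (-(A 0 0 * A 0 1)) *
        Complex.sqrt (autFactor A τ) * N7 k τ := by
  have h98 : 98 ∣ A 1 0 := dvd_of_mem_Gamma0 hA.2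
  rw [N7_smul hk h98 (dvd_of_mem_Gamma1 hA.1).1, zpow_neg_three, zpow_neg_three,
    etaMultiplier_twist_cube h98 (two_dvd_of_mem hA)]

theorem jacobiSym_two_natAbs {d t : ℤ} (h : d = 1 + 4 * t) :
    (J(2 | d.natAbs) : ℂ) = (-1) ^ t := by
  have hodd : Odd d.natAbs := by rw [Int.natAbs_odd]; exact ⟨2 * t, by rw [h]; ring⟩
  rw [jacobiSym.at_two hodd]
  rcases Int.even_or_odd' t with ⟨e, rfl | rfl⟩
  · have h8 : d.natAbs % 8 = 1 ∨ d.natAbs % 8 = 7 := by omega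
    rw [ZMod.χ₈_nat_eq_if_mod_eight, if_neg (by omega), if_pos h8, zpow_mul]
    norm_num
  · have h8 : ¬ (d.natAbs % 8 = 1 ∨ d.natAbs % 8 = 7) := by omega
    rw [ZMod.χ₈_nat_eq_if_mod_eight, if_neg (by omega), if_neg h8, zpow_add₀ (by norm_num),
      zpow_mul]
    norm_num

/-- Here ²A has lower left entry divisible by 8, so with δ = 1 + 4t the exponential in ν³ reduces to
(-1)^t i^β. The root of unity i^β cancels against the elementary factors, and (-1)^t is the symbol
(2/δ), which turns (γ/2 over δ) into (γ/δ). -/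
theorem multiplier_eq_jacobiExt {A : SL(2, ℤ)} (h2 : 2 ∣ A 1 0) (h16 : 16 ∣ A 1 0)
    (ha : 4 ∣ A 0 0 - 1) (hd : 4 ∣ A 1 1 - 1) :
    etaMultiplier (twist 2 A h2) ^ (-3 : ℤ) * (-1 : ℂ) ^ (A 0 1 + (A 0 0 - 1) / 2) *
      I ^ (-(A 0 0 * A 0 1)) = jacobiExt (A 1 0) (A 1 1) := by
  have hodd := odd_of_two_dvd h2
  have hν := etaMultiplier_cube (twist 2 A h2) hodd
  rw [etaCubeFormula] at hν
  obtain ⟨g, hg⟩ := h16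
  obtain ⟨s, hs⟩ := ha
  obtain ⟨t, ht⟩ := hd
  have hα : A 0 0 = 1 + 4 * s := by linarith
  have hδ : A 1 1 = 1 + 4 * t := by linarith
  simp only [twist_zero_zero, twist_zero_one, twist_one_zero, twist_one_one] at hν
  have hJ := jacobiExt_mul (a := 2) (by norm_num) (8 * g) (A 1 1)
  have hJ2 := jacobiSym_two_natAbs hδ
  have hsq : (jacobiExt (8 * g) (A 1 1) : ℂ) ^ 2 = 1 := by
    have hco : (8 * g).gcd ((A 1 1).natAbs : ℤ) = 1 := by
      have : IsCoprime (8 * g) (A 1 1) :=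
        ⟨-A 0 1 * 2, A 0 0, by linear_combination det_eq A + A 0 1 * hg⟩
      rw [Int.gcd, Int.natAbs_natCast]
      exact Int.isCoprime_iff_gcd_eq_one.1 this
    have := jacobiSym.sq_one hco
    rw [jacobiExt]
    split_ifs
    · push_cast; rw [neg_sq]; exact_mod_cast this
    · exact_mod_cast this
  rw [hg, show 16 * g / 2 = 8 * g by omega] at hν
  have hexp : exp (π * I / 4 * etaExponent (A 0 0) (2 * A 0 1) (8 * g) (A 1 1)) =
      (-1) ^ t * ((-1) ^ A 0 1 * I ^ (-A 0 1)) := by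
    have e1 : (-1 : ℂ) ^ A 0 1 = exp (A 0 1 * (π * I)) := (exp_int_mul_pi_mul_I _).symm
    have e2 : I ^ (-A 0 1) = exp ((-A 0 1 : ℤ) * (π * I / 2)) := by
      rw [Complex.exp_int_mul, exp_pi_mul_I_div_two]
    rw [e1, e2, ← exp_int_mul_pi_mul_I, ← Complex.exp_add, ← Complex.exp_add]
    refine exp_congr (g * (2 + 4 * s + 4 * t) - 16 * A 0 1 * A 1 1 * g ^ 2 + A 0 1 * t + t -
      3 * g * A 1 1) ?_
    rw [etaExponent, hα, hδ]
    push_cast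
    ring
  rw [hexp] at hν
  rw [hα, show (1 + 4 * s - 1) / 2 = 2 * s by omega, show -((1 + 4 * s) * A 0 1) =
    -A 0 1 + 4 * -(s * A 0 1) by ring, zpow_add₀ Complex.I_ne_zero, zpow_mul I,
    zpow_add₀ (by norm_num : (-1 : ℂ) ≠ 0), zpow_mul, hg,
    show 16 * g = 2 * (8 * g) by ring, hJ]
  push_cast
  rw [hJ2]
  have hI4 : I ^ (4 : ℤ) = 1 := by
    have : I ^ 4 = 1 := Complex.I_pow_four
    exact_mod_cast this
  have h12 : (-1 : ℂ) ^ (2 : ℤ) = 1 := by norm_num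
  rw [hI4, h12, one_zpow, one_zpow, mul_one, mul_one, zpow_neg_three]
  have ht2 : ((-1 : ℂ) ^ t) ^ 2 = 1 := by
    rw [← zpow_natCast, ← zpow_mul, mul_comm, zpow_mul]; norm_num
  have hne : etaMultiplier (twist 2 A h2) ^ 3 ≠ 0 := by
    rw [hν]
    refine mul_ne_zero ?_ (mul_ne_zero (zpow_ne_zero _ (by norm_num))
      (mul_ne_zero (zpow_ne_zero _ (by norm_num)) (zpow_ne_zero _ Complex.I_ne_zero)))
    intro h; rw [h] at hsq; norm_num at hsq
  rw [mul_assoc, inv_mul_eq_iff_eq_mul₀ hne, hν]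
  linear_combination (-(-1 : ℂ) ^ A 0 1 * I ^ (-A 0 1)) * (((-1 : ℂ) ^ t) ^ 2 * hsq + ht2)

theorem N7_smul_of_mem_of_mem {k : ℤ} (hk : ¬ (7 : ℤ) ∣ k) {A : SL(2, ℤ)}
    (hA : A ∈ CongruenceSubgroup.Gamma1 28 ⊓ CongruenceSubgroup.Gamma0 784) (τ : ℍ) :
    N7 k (A • τ) = jacobiExt (A 1 0) (A 1 1) * Complex.sqrt (autFactor A τ) * N7 k τ := by
  have h784 : (784 : ℤ) ∣ A 1 0 := dvd_of_mem_Gamma0 hA.2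
  have ha : (28 : ℤ) ∣ A 0 0 - 1 := (dvd_of_mem_Gamma1 hA.1).1
  have hd : (28 : ℤ) ∣ A 1 1 - 1 := (dvd_of_mem_Gamma1 hA.1).2
  have h98 : 98 ∣ A 1 0 := dvd_trans (by norm_num) h784
  have h2 : 2 ∣ A 1 0 := dvd_trans (by norm_num) h784
  rw [N7_smul hk h98 (dvd_trans (by norm_num) ha),
    ← multiplier_eq_jacobiExt h2 (dvd_trans (by norm_num) h784) (dvd_trans (by norm_num) ha)
    (dvd_trans (by norm_num) hd), zpow_neg_three, zpow_neg_three,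
    etaMultiplier_twist_cube h98 h2]

/-! ### Termwise differentiation on the half plane -/

theorem isOpen_upperHalfPlane : IsOpen {z : ℂ | 0 < z.im} :=
  isOpen_lt continuous_const Complex.continuous_im

theorem isOpen_strip (a b : ℝ) : IsOpen {z : ℂ | a < z.im ∧ z.im < b} :=
  (isOpen_lt continuous_const Complex.continuous_im).inter
    (isOpen_lt Complex.continuous_im continuous_const)

theorem isPreconnected_strip (a b : ℝ) : IsPreconnected {z : ℂ | a < z.im ∧ z.im < b} :=
  ((convex_halfSpace_im_gt a).inter (convex_halfSpace_im_lt b)).isPreconnected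

theorem hasFDerivAt_tsum_of_strip {f : ℤ → ℂ → ℂ} {f' : ℤ → ℂ → ℂ →L[ℝ] ℂ}
    (hf : ∀ m z, 0 < z.im → HasFDerivAt (f m) (f' m z) z)
    (hb : ∀ a b : ℝ, 0 < a → ∃ u : ℤ → ℝ, Summable u ∧ ∀ m z, a < z.im → z.im < b →
      ‖f m z‖ ≤ u m ∧ ‖f' m z‖ ≤ u m) {z : ℂ} (hz : 0 < z.im) :
    HasFDerivAt (fun w => ∑' m, f m w) (∑' m, f' m z) z := by
  obtain ⟨u, hu, hu'⟩ := hb (z.im / 2) (z.im + 1) (by linarith)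
  have hmem : z ∈ {z' : ℂ | z.im / 2 < z'.im ∧ z'.im < z.im + 1} :=
    ⟨by linarith, by linarith⟩
  refine hasFDerivAt_tsum_of_isPreconnected hu (isOpen_strip _ _) (isPreconnected_strip _ _)
    (fun m w hw => hf m w (lt_trans (by linarith) hw.1)) (fun m w hw => (hu' m w hw.1 hw.2).2)
    hmem ?_ hmem
  exact Summable.of_norm_bounded hu fun m => (hu' m z hmem.1 hmem.2).1

/-- The differential of the imaginary part. -/
def dIm : ℂ →L[ℝ] ℂ := Complex.ofRealCLM ∘L Complex.imCLM

/-- The differential of the complex conjugation. -/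
def dConj : ℂ →L[ℝ] ℂ := (Complex.conjCLE : ℂ →L[ℝ] ℂ)

theorem dIm_apply (w : ℂ) : dIm w = w.im := rfl

theorem dConj_apply (w : ℂ) : dConj w = conj w := rfl

theorem norm_dIm_le : ‖dIm‖ ≤ 1 :=
  ContinuousLinearMap.opNorm_le_bound _ zero_le_one fun w => by
    rw [dIm_apply, Complex.norm_real, one_mul]; exact Complex.abs_im_le_norm w

theorem norm_dConj_le : ‖dConj‖ ≤ 1 :=
  ContinuousLinearMap.opNorm_le_bound _ zero_le_one fun w => by
    rw [dConj_apply, Complex.norm_conj, one_mul]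

theorem hasFDerivAt_exp_mul (c z : ℂ) :
    HasFDerivAt (fun w : ℂ => exp (c * w))
      ((c * exp (c * z)) • (1 : ℂ →L[ℝ] ℂ)) z := by
  have h : HasDerivAt (fun w : ℂ => exp (c * w)) (c * exp (c * z)) z := by
    have := ((hasDerivAt_id z).const_mul c).cexp
    simpa [mul_comm] using this
  refine (h.hasFDerivAt.restrictScalars ℝ).congr_fderiv ?_
  ext w
  simp [mul_comm]

theorem hasFDerivAt_exp_mul_conj (c z : ℂ) :
    HasFDerivAt (fun w : ℂ => exp (c * conj w)) ((c * exp (c * conj z)) • dConj) z := by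
  refine ((hasFDerivAt_exp_mul c (conj z)).comp z
    (Complex.conjCLE : ℂ →L[ℝ] ℂ).hasFDerivAt).congr_fderiv ?_
  ext w
  simp [dConj]

theorem hasFDerivAt_E_sqrt (n : ℝ) {z : ℂ} (hz : 0 < z.im) :
    HasFDerivAt (fun w : ℂ => (E (2 * n * √w.im) : ℂ))
      (((2 * n * (√z.im)⁻¹ * Real.exp (-(4 * π * n ^ 2 * z.im)) : ℝ) : ℂ) • dIm) z := by
  have h1 : HasDerivAt (fun y : ℝ => E (2 * n * √y))
      (2 * Real.exp (-π * (2 * n * √z.im) ^ 2) * (2 * n * (1 / (2 * √z.im)))) z.im :=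
    (hasDerivAt_E _).comp z.im ((Real.hasDerivAt_sqrt hz.ne').const_mul (2 * n))
  have h2 := h1.comp_hasFDerivAt z Complex.imCLM.hasFDerivAt
  refine (Complex.ofRealCLM.hasFDerivAt.comp z h2).congr_fderiv ?_
  have e : -π * (2 * n * √z.im) ^ 2 = -(4 * π * n ^ 2 * z.im) := by
    rw [mul_pow, Real.sq_sqrt hz.le]; ring
  rw [e]
  ext w
  simp only [dIm, ContinuousLinearMap.comp_apply, smul_apply,
    Complex.imCLM_apply, Complex.ofRealCLM_apply, smul_eq_mul]
  push_cast
  ring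

theorem hasFDerivAt_inv_sqrt_im {z : ℂ} (hz : 0 < z.im) :
    HasFDerivAt (fun w : ℂ => (((√w.im)⁻¹ : ℝ) : ℂ))
      (((-((√z.im)⁻¹ ^ 3 / 2) : ℝ) : ℂ) • dIm) z := by
  have h0 : √z.im ≠ 0 := (Real.sqrt_pos.2 hz).ne'
  have h1 := ((Real.hasDerivAt_sqrt hz.ne').inv h0).comp_hasFDerivAt z Complex.imCLM.hasFDerivAt
  refine (Complex.ofRealCLM.hasFDerivAt.comp z h1).congr_fderiv ?_
  have e : -(1 / (2 * √z.im)) / √z.im ^ 2 = -((√z.im)⁻¹ ^ 3 / 2) := by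
    field_simp
  rw [e]
  ext w
  simp [dIm]

/-! ### The non-holomorphic part of `N₇` -/

/-- The terms of the antiholomorphic theta series in the derivative of the non-holomorphic part. -/
def shadowTerm (k : ℤ) (p : ℕ) (m : ℤ) (z : ℂ) : ℂ :=
  (-1) ^ m * ((7 * m + k : ℤ) : ℂ) ^ p * exp (-2 * π * I * ((7 * m + k : ℤ) : ℂ) ^ 2 * conj z)

/-- The antiholomorphic theta series in the derivative of the non-holomorphic part. -/
def shadow (k : ℤ) (p : ℕ) (z : ℂ) : ℂ := ∑' m, shadowTerm k p m z

/-- The terms of the non-holomorphic part, multiplied by powers of `7m + k`. -/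
def nonholoTerm (k : ℤ) (p : ℕ) (m : ℤ) (z : ℂ) : ℂ :=
  (-1) ^ m * ((7 * m + k : ℤ) : ℂ) ^ p *
    ((Real.sign ((m : ℝ) + 1 / 2) : ℂ) - E (2 * ((7 * m + k : ℤ) : ℝ) * √z.im)) *
      exp (-2 * π * I * ((7 * m + k : ℤ) : ℂ) ^ 2 * z)

/-- The non-holomorphic part of `N₇`, and its holomorphic derivatives. -/
def nonholo (k : ℤ) (p : ℕ) (z : ℂ) : ℂ := ∑' m, nonholoTerm k p m z

theorem hasFDerivAt_shadowTerm (k : ℤ) (p : ℕ) (m : ℤ) (z : ℂ) :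
    HasFDerivAt (shadowTerm k p m) ((-2 * π * I * shadowTerm k (p + 2) m z) • dConj) z := by
  unfold shadowTerm
  refine ((hasFDerivAt_exp_mul_conj _ z).const_mul _).congr_fderiv ?_
  rw [smul_smul]
  congr 1
  ring

/-- The Gaussian from the derivative of E changes z into its conjugate in the exponential, which
gives a shadow term. The exponent p is carried along so that the family is closed under
differentiation: p becomes p + 2 or, in the shadow, p + 1. -/
theorem hasFDerivAt_nonholoTerm (k : ℤ) (p : ℕ) (m : ℤ) {z : ℂ} (hz : 0 < z.im) :
    HasFDerivAt (nonholoTerm k p m) ((-2 * π * I * nonholoTerm k (p + 2) m z) • 1 +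
      (-2 * (((√z.im)⁻¹ : ℝ) : ℂ) * shadowTerm k (p + 1) m z) • dIm) z := by
  unfold nonholoTerm
  refine ((((hasFDerivAt_E_sqrt _ hz).const_sub _).const_mul _).mul
    (hasFDerivAt_exp_mul _ z)).congr_fderiv ?_
  have e : ((Real.exp (-(4 * π * ((7 * m + k : ℤ) : ℝ) ^ 2 * z.im)) : ℝ) : ℂ) *
      exp (-2 * π * I * ((7 * m + k : ℤ) : ℂ) ^ 2 * z) =
      exp (-2 * π * I * ((7 * m + k : ℤ) : ℂ) ^ 2 * conj z) := by
    rw [Complex.ofReal_exp, ← Complex.exp_add]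
    congr 1
    have h := Complex.sub_conj z
    push_cast at h ⊢
    linear_combination (-2 * π * I * (7 * m + k) ^ 2) * h +
      (-4 * π * (7 * m + k) ^ 2 * z.im) * Complex.I_sq
  have e2 : shadowTerm k (p + 1) m z = (-1) ^ m * ((7 * m + k : ℤ) : ℂ) ^ (p + 1) *
    (((Real.exp (-(4 * π * ((7 * m + k : ℤ) : ℝ) ^ 2 * z.im)) : ℝ) : ℂ) *
      exp (-2 * π * I * ((7 * m + k : ℤ) : ℂ) ^ 2 * z)) := by rw [e, shadowTerm]
  rw [e2]
  ext w
  simp [dIm_apply]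
  ring

theorem norm_shadowTerm (k : ℤ) (p : ℕ) (m : ℤ) (z : ℂ) : ‖shadowTerm k p m z‖ =
    |((7 * m + k : ℤ) : ℝ)| ^ p * Real.exp (-(2 * π * ((7 * m + k : ℤ) : ℝ) ^ 2 * z.im)) := by
  rw [shadowTerm, norm_mul, norm_mul, norm_zpow, norm_neg, norm_one, one_zpow, one_mul, norm_pow,
    Complex.norm_intCast, Complex.norm_exp]
  congr 2
  have : (-2 * π * I * ((7 * m + k : ℤ) : ℂ) ^ 2 * conj z) =
      ((-2 * π * ((7 * m + k : ℤ) : ℝ) ^ 2 : ℝ) : ℂ) * (conj z * I) := by push_cast; ring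
  rw [this, Complex.re_ofReal_mul, Complex.mul_I_re, Complex.conj_im]
  ring

theorem norm_nonholoTerm_le (k : ℤ) (p : ℕ) (m : ℤ) {z : ℂ} (hz : 0 < z.im) :
    ‖nonholoTerm k p m z‖ ≤ 2 * Real.exp (196 * π * ((k : ℝ) / 7 - 1 / 2) ^ 2 * z.im) *
      (|((7 * m + k : ℤ) : ℝ)| ^ p *
        Real.exp (-(2 * π * ((7 * m + k : ℤ) : ℝ) ^ 2 * z.im))) := by
  have h := abs_rCoeff_le m ((k : ℝ) / 7 - 1 / 2) (y := 98 * z.im) (by positivity)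
  have e1 : rCoeff m ((k : ℝ) / 7 - 1 / 2) (98 * z.im) =
      Real.sign ((m : ℝ) + 1 / 2) - E (2 * ((7 * m + k : ℤ) : ℝ) * √z.im) := by
    rw [rCoeff, show 2 * (98 * z.im) = 14 ^ 2 * z.im by ring, Real.sqrt_mul (by norm_num),
      Real.sqrt_sq (by norm_num)]
    congr 2
    push_cast
    ring
  have e2 : ‖exp (-2 * π * I * ((7 * m + k : ℤ) : ℂ) ^ 2 * z)‖ =
      Real.exp (2 * π * ((7 * m + k : ℤ) : ℝ) ^ 2 * z.im) := by
    rw [Complex.norm_exp]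
    congr 1
    have : (-2 * π * I * ((7 * m + k : ℤ) : ℂ) ^ 2 * z) =
        ((-2 * π * ((7 * m + k : ℤ) : ℝ) ^ 2 : ℝ) : ℂ) * (z * I) := by push_cast; ring
    rw [this, Complex.re_ofReal_mul, Complex.mul_I_re]
    ring
  rw [e1] at h
  rw [nonholoTerm, ← Complex.ofReal_sub, norm_mul, norm_mul, norm_mul, norm_zpow, norm_neg,
    norm_one, one_zpow, one_mul, norm_pow, Complex.norm_intCast, Complex.norm_real,
    Real.norm_eq_abs, e2]
  refine (mul_le_mul_of_nonneg_right (mul_le_mul_of_nonneg_left h (by positivity))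
    (Real.exp_pos _).le).trans (le_of_eq ?_)
  have e3 : Real.exp (-(2 * π * ((m : ℝ) + 1 / 2 + ((k : ℝ) / 7 - 1 / 2)) ^ 2 * (98 * z.im))) *
      Real.exp (2 * π * ((7 * m + k : ℤ) : ℝ) ^ 2 * z.im) =
      Real.exp (-(2 * π * ((7 * m + k : ℤ) : ℝ) ^ 2 * z.im)) := by
    rw [← Real.exp_add]
    congr 1
    push_cast
    ring
  rw [← e3, show 196 * π * ((k : ℝ) / 7 - 1 / 2) ^ 2 * z.im =
    2 * π * ((k : ℝ) / 7 - 1 / 2) ^ 2 * (98 * z.im) by ring]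
  ring

/-- A summable majorant for the series `shadow` and `nonholo`. -/
def stripBound (k : ℤ) (a : ℝ) (p : ℕ) (m : ℤ) : ℝ :=
  |((7 * m + k : ℤ) : ℝ)| ^ p * Real.exp (-(2 * π * ((7 * m + k : ℤ) : ℝ) ^ 2 * a))

theorem stripBound_nonneg (k : ℤ) (a : ℝ) (p : ℕ) (m : ℤ) : 0 ≤ stripBound k a p m := by
  unfold stripBound; positivity

theorem summable_stripBound (k : ℤ) {a : ℝ} (ha : 0 < a) (p : ℕ) :
    Summable (stripBound k a p) := by
  have h := (summable_pow_mul_thetaBound 0 (T := 2 * a) (by positivity) p).comp_injective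
    (i := fun m : ℤ => 7 * m + k) (fun m n h => by simpa using h)
  refine h.congr fun m => ?_
  simp only [Function.comp_apply, thetaBound, stripBound]
  congr 2
  ring

theorem norm_shadowTerm_le (k : ℤ) (p : ℕ) (m : ℤ) {a : ℝ} {z : ℂ} (hz : a < z.im) :
    ‖shadowTerm k p m z‖ ≤ stripBound k a p m := by
  rw [norm_shadowTerm, stripBound]
  have := Real.pi_pos
  gcongr

theorem norm_nonholoTerm_le_strip (k : ℤ) (p : ℕ) (m : ℤ) {a b : ℝ} (ha : 0 < a) {z : ℂ}
    (hz : a < z.im) (hz' : z.im < b) : ‖nonholoTerm k p m z‖ ≤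
      2 * Real.exp (196 * π * ((k : ℝ) / 7 - 1 / 2) ^ 2 * b) * stripBound k a p m := by
  refine (norm_nonholoTerm_le k p m (ha.trans hz)).trans ?_
  rw [stripBound]
  have := Real.pi_pos
  gcongr

theorem summable_shadowTerm (k : ℤ) (p : ℕ) {z : ℂ} (hz : 0 < z.im) :
    Summable fun m => shadowTerm k p m z :=
  Summable.of_norm_bounded (summable_stripBound k (half_pos hz) p)
    fun m => norm_shadowTerm_le k p m (by linarith)

theorem summable_nonholoTerm (k : ℤ) (p : ℕ) {z : ℂ} (hz : 0 < z.im) :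
    Summable fun m => nonholoTerm k p m z :=
  Summable.of_norm_bounded ((summable_stripBound k (half_pos hz) p).mul_left _)
    fun m => norm_nonholoTerm_le_strip k p m (half_pos hz) (half_lt_self hz)
      (lt_add_one z.im)

theorem norm_smul_le_of_norm_le_one (c : ℂ) {L : ℂ →L[ℝ] ℂ} (hL : ‖L‖ ≤ 1) :
    ‖c • L‖ ≤ ‖c‖ := by
  rw [norm_smul]; exact mul_le_of_le_one_right (norm_nonneg _) hL

theorem hasFDerivAt_shadow (k : ℤ) (p : ℕ) {z : ℂ} (hz : 0 < z.im) :
    HasFDerivAt (shadow k p) ((-2 * π * I * shadow k (p + 2) z) • dConj) z := by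
  have h := hasFDerivAt_tsum_of_strip (fun m w _ => hasFDerivAt_shadowTerm k p m w) ?_ hz
  · refine h.congr_fderiv ?_
    rw [((summable_shadowTerm k (p + 2) hz).mul_left _).tsum_smul_const, tsum_mul_left, shadow]
  · intro a b ha
    refine ⟨fun m => stripBound k a p m + 2 * π * stripBound k a (p + 2) m,
      (summable_stripBound k ha p).add ((summable_stripBound k ha _).mul_left _),
      fun m w hw _ => ⟨?_, ?_⟩⟩
    · have h1 := stripBound_nonneg k a (p + 2) m
      have h2 : 0 ≤ 2 * π * stripBound k a (p + 2) m := by positivity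
      exact (norm_shadowTerm_le k p m hw).trans (by linarith)
    · refine (norm_smul_le_of_norm_le_one _ norm_dConj_le).trans ?_
      have h1 := norm_shadowTerm_le k (p + 2) m hw
      have h2 := stripBound_nonneg k a p m
      have h3 := mul_le_mul_of_nonneg_left h1 (by positivity : 0 ≤ 2 * π)
      simp only [norm_mul, norm_neg, Complex.norm_ofNat, Complex.norm_I, Complex.norm_real,
        Real.norm_eq_abs, abs_of_pos Real.pi_pos, mul_one]
      linarith

theorem hasFDerivAt_nonholo (k : ℤ) (p : ℕ) {z : ℂ} (hz : 0 < z.im) :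
    HasFDerivAt (nonholo k p) ((-2 * π * I * nonholo k (p + 2) z) • 1 +
      (-2 * (((√z.im)⁻¹ : ℝ) : ℂ) * shadow k (p + 1) z) • dIm) z := by
  have h := hasFDerivAt_tsum_of_strip (fun m w hw => hasFDerivAt_nonholoTerm k p m hw) ?_ hz
  · refine h.congr_fderiv ?_
    have h1 := ((summable_nonholoTerm k (p + 2) hz).mul_left (-2 * π * I : ℂ))
    have h2 := ((summable_shadowTerm k (p + 1) hz).mul_left (-2 * (((√z.im)⁻¹ : ℝ) : ℂ)))
    rw [(h1.smul_const _).tsum_add (h2.smul_const _), h1.tsum_smul_const, h2.tsum_smul_const,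
      tsum_mul_left, tsum_mul_left, nonholo, shadow]
  · intro a b ha
    set C := 2 * Real.exp (196 * π * ((k : ℝ) / 7 - 1 / 2) ^ 2 * b) with hC
    have hC0 : 0 ≤ C := by positivity
    refine ⟨fun m => C * stripBound k a p m + (2 * π * (C * stripBound k a (p + 2) m) +
      2 * (√a)⁻¹ * stripBound k a (p + 1) m),
      ((summable_stripBound k ha p).mul_left _).add
        ((((summable_stripBound k ha _).mul_left _).mul_left _).add
          ((summable_stripBound k ha _).mul_left _)), fun m w hw hw' => ?_⟩
    have h0 := stripBound_nonneg k a p m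
    have h1 := stripBound_nonneg k a (p + 1) m
    have h2 := stripBound_nonneg k a (p + 2) m
    have h3 : 0 ≤ C * stripBound k a p m := by positivity
    have h4 : 0 ≤ 2 * π * (C * stripBound k a (p + 2) m) := by positivity
    have h5 : 0 ≤ 2 * (√a)⁻¹ * stripBound k a (p + 1) m := by positivity
    refine ⟨(norm_nonholoTerm_le_strip k p m ha hw hw').trans (by linarith), ?_⟩
    refine (norm_add_le _ _).trans ((add_le_add
      (norm_smul_le_of_norm_le_one _ ContinuousLinearMap.norm_id_le)
      (norm_smul_le_of_norm_le_one _ norm_dIm_le)).trans ?_)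
    have h6 := mul_le_mul_of_nonneg_left (norm_nonholoTerm_le_strip k (p + 2) m ha hw hw')
      (by positivity : 0 ≤ 2 * π)
    have h7 : 2 * (√w.im)⁻¹ * ‖shadowTerm k (p + 1) m w‖ ≤
        2 * (√a)⁻¹ * stripBound k a (p + 1) m := by
      have := norm_shadowTerm_le k (p + 1) m hw
      have := Real.sqrt_pos.2 ha
      gcongr
    simp only [norm_mul, norm_neg, Complex.norm_ofNat, Complex.norm_I, Complex.norm_real,
      Real.norm_eq_abs, abs_of_pos Real.pi_pos, mul_one, abs_inv, abs_of_nonneg (Real.sqrt_nonneg _)]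
    linarith

/-! ### Smoothness -/

theorem contDiffOn_succ_of_hasFDerivAt {f : ℂ → ℂ} {f' : ℂ → ℂ →L[ℝ] ℂ} {s : Set ℂ}
    (hs : IsOpen s) {n : ℕ} (h : ∀ z ∈ s, HasFDerivAt f (f' z) z) (h' : ContDiffOn ℝ n f' s) :
    ContDiffOn ℝ (n + 1 : ℕ) f s := by
  push_cast
  rw [contDiffOn_succ_iff_fderiv_of_isOpen hs]
  refine ⟨fun z hz => (h z hz).differentiableAt.differentiableWithinAt, by simp,
    h'.congr fun z hz => (h z hz).fderiv⟩

theorem contDiffOn_inv_sqrt_im (n : ℕ) :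
    ContDiffOn ℝ n (fun w : ℂ => (((√w.im)⁻¹ : ℝ) : ℂ)) {z : ℂ | 0 < z.im} := by
  intro z hz
  refine ContDiffAt.contDiffWithinAt ?_
  have h1 : ContDiffAt ℝ n (fun w : ℂ => w.im) z := Complex.imCLM.contDiff.contDiffAt
  have h2 : ContDiffAt ℝ n (fun w : ℂ => (√w.im)⁻¹) z :=
    (h1.sqrt (ne_of_gt hz)).inv (Real.sqrt_pos.2 hz).ne'
  exact Complex.ofRealCLM.contDiff.contDiffAt.comp z h2

theorem contDiffOn_shadow (k : ℤ) (n p : ℕ) : ContDiffOn ℝ n (shadow k p) {z : ℂ | 0 < z.im} := by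
  induction n generalizing p with
  | zero =>
    rw [Nat.cast_zero, contDiffOn_zero]
    exact fun z hz => (hasFDerivAt_shadow k p hz).continuousAt.continuousWithinAt
  | succ n ih =>
    exact contDiffOn_succ_of_hasFDerivAt isOpen_upperHalfPlane
      (fun z hz => hasFDerivAt_shadow k p hz)
      ((contDiffOn_const.mul (ih (p + 2))).smul contDiffOn_const)

/-- The derivative involves only the same two families and (Im z)^{-1/2}, so induction on n, for all
p at once, gives every order of smoothness. -/
theorem contDiffOn_nonholo (k : ℤ) (n p : ℕ) :
    ContDiffOn ℝ n (nonholo k p) {z : ℂ | 0 < z.im} := by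
  induction n generalizing p with
  | zero =>
    rw [Nat.cast_zero, contDiffOn_zero]
    exact fun z hz => (hasFDerivAt_nonholo k p hz).continuousAt.continuousWithinAt
  | succ n ih =>
    exact contDiffOn_succ_of_hasFDerivAt isOpen_upperHalfPlane
      (fun z hz => hasFDerivAt_nonholo k p hz)
      (((contDiffOn_const.mul (ih (p + 2))).smul contDiffOn_const).add
        (((contDiffOn_const.mul (contDiffOn_inv_sqrt_im n)).mul
          (contDiffOn_shadow k n (p + 1))).smul contDiffOn_const))

/-! ### The holomorphic part of `N₇` -/

/-- The holomorphic part of `N₇`. -/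
def holo (k : ℤ) (z : ℂ) : ℂ :=
  exp (2 * π * I * z * (-(k : ℂ) ^ 2 + 7 * k - 49 / 4)) * mu (14 * k * z) (49 * z) (98 * z)

theorem N7_eq_holo_add_nonholo (k : ℤ) (τ : ℍ) : N7 k τ = holo k τ + I / 2 * nonholo k 0 τ := by
  have h : exp (2 * π * I * τ * (-(k : ℂ) ^ 2 + 7 * k - 49 / 4)) *
      R (14 * k * τ - 49 * τ) (98 * τ) = nonholo k 0 τ := by
    rw [R_eq, nonholo, ← tsum_mul_left]
    refine tsum_congr fun m => ?_
    have h1 : ((14 * k * τ - 49 * τ : ℂ)).im / (98 * τ : ℂ).im = (k : ℝ) / 7 - 1 / 2 := by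
      have e1 : (14 * k * τ - 49 * τ : ℂ) = ((14 * k - 49 : ℝ) : ℂ) * τ := by push_cast; ring
      have e2 : (98 * τ : ℂ) = ((98 : ℝ) : ℂ) * τ := by push_cast; ring
      rw [e1, e2, Complex.im_ofReal_mul, Complex.im_ofReal_mul, mul_div_mul_right _ _
        (show (τ : ℂ).im ≠ 0 from τ.im_pos.ne')]
      ring
    have h2 : (98 * τ : ℂ).im = 98 * τ.im := by
      simp
    have h3 : rCoeff m ((k : ℝ) / 7 - 1 / 2) (98 * τ.im) =
        Real.sign ((m : ℝ) + 1 / 2) - E (2 * ((7 * m + k : ℤ) : ℝ) * √τ.im) := by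
      rw [rCoeff, show 2 * (98 * τ.im) = 14 ^ 2 * τ.im by ring, Real.sqrt_mul (by norm_num),
        Real.sqrt_sq (by norm_num)]
      congr 2
      push_cast
      ring
    have h4 : exp (2 * π * I * τ * (-(k : ℂ) ^ 2 + 7 * k - 49 / 4)) *
        rExp m (14 * k * τ - 49 * τ) (98 * τ) =
        (-1) ^ m * exp (-2 * π * I * ((7 * m + k : ℤ) : ℂ) ^ 2 * τ) := by
      rw [rExp, mul_left_comm, ← Complex.exp_add]
      congr 2
      push_cast
      ring
    rw [h1, h2, h3, nonholoTerm, mul_left_comm, h4, UpperHalfPlane.coe_im]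
    push_cast
    ring
  rw [N7, muTilde, ← h, holo]
  ring

theorem differentiableAt_theta_scaled {z : ℂ} (hz : 0 < z.im) :
    DifferentiableAt ℂ (fun w : ℂ => theta (49 * w) (98 * w)) z := by
  simp_rw [theta_eq_jacobiTheta₂]
  refine DifferentiableAt.mul (by fun_prop) ?_
  have h := (hasFDerivAt_jacobiTheta₂ (49 * z + 1 / 2 + 98 * z / 2) (τ := 98 * z)
    (by simpa using hz)).differentiableAt
  exact h.comp (f := fun w : ℂ => ((49 * w + 1 / 2 + 98 * w / 2, 98 * w) : ℂ × ℂ)) z (by fun_prop)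

/-- Relative to 98w the point 14kw has the constant coordinates (k/7, 0), which are not integral.
The denominators are thus bounded below uniformly on a strip, and the series converges uniformly
there. -/
theorem differentiableAt_numer_scaled {k : ℤ} (hk : ¬ (7 : ℤ) ∣ k) {z : ℂ} (hz : 0 < z.im) :
    DifferentiableAt ℂ (fun w : ℂ => numer (14 * k * w) (49 * w) (98 * w)) z := by
  simp_rw [numer_eq]
  refine DifferentiableAt.mul (by fun_prop) ?_
  have hpos : 0 < 98 * (z.im / 2) := by linarith
  obtain ⟨c, hc, hc'⟩ := exists_pos_le_norm_one_sub_exp (k / 7) 0 (fun m n h => hk ⟨m, by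
    have := h.1
    rw [div_eq_iff (by norm_num), mul_comm] at this
    exact_mod_cast this⟩) hpos
  have him : ∀ w : ℂ, (98 * w).im = 98 * w.im := fun w => by simp
  have him' : ∀ w : ℂ, (49 * w).im = 49 * w.im := fun w => by simp
  have hc2 : ∀ (n : ℤ) (w : ℂ), z.im / 2 < w.im →
      c ≤ ‖1 - exp (2 * π * I * n * (98 * w) + 2 * π * I * (14 * k * w))‖ := fun n w hw => by
    have := hc' n (98 * w) (by rw [him]; linarith)
    convert this using 5
    push_cast
    ring
  refine (Complex.differentiableOn_tsum_of_summable_norm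
    (F := fun (n : ℤ) (w : ℂ) => numerTerm (49 * w) (98 * w) n /
      (1 - exp (2 * π * I * n * (98 * w) + 2 * π * I * (14 * k * w))))
    ((summable_thetaBound (98 * (z.im + 1)) hpos).div_const c) (fun n w hw => ?_)
    (isOpen_strip (z.im / 2) (z.im + 1))
    fun n w hw => norm_numerTerm_div_le hpos hc ?_ ?_ n (hc2 n w hw.1)).differentiableAt
    ((isOpen_strip (z.im / 2) (z.im + 1)).mem_nhds ⟨by linarith, by linarith⟩)
  · have h0 : 1 - exp (2 * π * I * n * (98 * w) + 2 * π * I * (14 * k * w)) ≠ 0 :=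
      norm_pos_iff.1 (hc.trans_le (hc2 n w hw.1))
    unfold numerTerm
    refine DifferentiableAt.differentiableWithinAt ?_
    exact DifferentiableAt.div (by fun_prop) (by fun_prop) h0
  · have h1 : 0 < w.im := lt_trans (by linarith) hw.1
    have h2 := hw.2
    rw [him, him', abs_of_pos (by positivity)]
    linarith
  · rw [him]
    linarith [hw.1]

theorem theta_scaled_ne_zero {z : ℂ} (hz : 0 < z.im) : theta (49 * z) (98 * z) ≠ 0 := by
  have h := theta_ne_zero (offLattice_right (dilate ⟨z, hz⟩))
  rw [coe_dilate] at h
  convert h using 2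
  change 49 * z = 1 / 2 * (98 * z)
  ring

theorem differentiableOn_holo {k : ℤ} (hk : ¬ (7 : ℤ) ∣ k) :
    DifferentiableOn ℂ (holo k) {z : ℂ | 0 < z.im} := by
  intro z hz
  refine DifferentiableAt.differentiableWithinAt ?_
  unfold holo
  refine DifferentiableAt.mul (by fun_prop) ?_
  simp_rw [mu_eq]
  exact (differentiableAt_numer_scaled hk hz).div (differentiableAt_theta_scaled hz)
    (theta_scaled_ne_zero hz)

/-! ### Smoothness and harmonicity of `N₇` -/

theorem N7_ofComplex (k : ℤ) {z : ℂ} (hz : 0 < z.im) :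
    (N7 k ∘ UpperHalfPlane.ofComplex) z = holo k z + I / 2 * nonholo k 0 z := by
  rw [Function.comp_apply, UpperHalfPlane.ofComplex_apply_of_im_pos hz, N7_eq_holo_add_nonholo]

theorem contDiffOn_N7 {k : ℤ} (hk : ¬ (7 : ℤ) ∣ k) :
    ContDiffOn ℝ ((⊤ : ℕ∞) : WithTop ℕ∞) (N7 k ∘ UpperHalfPlane.ofComplex)
      {z : ℂ | 0 < z.im} := by
  rw [contDiffOn_infty]
  intro n
  refine ContDiffOn.congr ?_ fun z hz => N7_ofComplex k hz
  refine ContDiffOn.add ?_ (contDiffOn_const.mul (contDiffOn_nonholo k n 0))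
  exact ((differentiableOn_holo hk).contDiffOn isOpen_upperHalfPlane).restrict_scalars ℝ

theorem hasFDerivAt_of_differentiableOn {h : ℂ → ℂ} (hh : DifferentiableOn ℂ h {z : ℂ | 0 < z.im})
    {z : ℂ} (hz : 0 < z.im) : HasFDerivAt h (deriv h z • (1 : ℂ →L[ℝ] ℂ)) z := by
  have := ((hh z hz).differentiableAt (isOpen_upperHalfPlane.mem_nhds hz)).hasDerivAt
  refine (this.hasFDerivAt.restrictScalars ℝ).congr_fderiv ?_
  ext w
  simp [mul_comm]

theorem partialX_eq {f : ℂ → ℂ} {a b c z : ℂ} (h : HasFDerivAt f (a • 1 + b • dIm + c • dConj) z) :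
    partialX f z = a + c := by
  rw [partialX, h.fderiv]
  simp [dIm_apply, dConj_apply]

theorem partialY_eq {f : ℂ → ℂ} {a b c z : ℂ} (h : HasFDerivAt f (a • 1 + b • dIm + c • dConj) z) :
    partialY f z = I * (a - c) + b := by
  rw [partialY, h.fderiv]
  simp [dIm_apply, dConj_apply]
  ring

/-- Writing f_x = A and f_y = iA + B gives f_x + i f_y = iB = y^{-1/2} times an antiholomorphic
function. Hence y^{1/2} ∂f/∂τ̄ is antiholomorphic, which is harmonicity in weight 1/2: the
derivative of y^{-1/2} in the second-order part cancels the first-order part. -/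
theorem hypLaplacian_N7 {k : ℤ} (hk : ¬ (7 : ℤ) ∣ k) {z : ℂ} (hz : 0 < z.im) :
    hypLaplacian (1 / 2) (N7 k ∘ UpperHalfPlane.ofComplex) z = 0 := by
  have hh := differentiableOn_holo hk
  have hh' := hh.deriv isOpen_upperHalfPlane
  set A : ℂ → ℂ := fun w => deriv (holo k) w + π * nonholo k 2 w with hA
  set B : ℂ → ℂ := fun w => -I * (((√w.im)⁻¹ : ℝ) : ℂ) * shadow k 1 w with hB
  have hf : ∀ w : ℂ, 0 < w.im → HasFDerivAt (N7 k ∘ UpperHalfPlane.ofComplex)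
      (A w • 1 + B w • dIm + (0 : ℂ) • dConj) w := by
    intro w hw
    have h1 := (hasFDerivAt_of_differentiableOn hh hw).add
      ((hasFDerivAt_nonholo k 0 hw).const_mul (I / 2))
    refine (h1.congr_of_eventuallyEq ?_).congr_fderiv ?_
    · filter_upwards [isOpen_upperHalfPlane.mem_nhds hw] with v hv
      exact N7_ofComplex k hv
    · ext v
      simp [hA, hB, dIm_apply]
      linear_combination (-(π * nonholo k 2 w * v)) * Complex.I_sq
  have hA' : HasFDerivAt A (deriv (deriv (holo k)) z • 1 +
      (π : ℂ) • ((-2 * π * I * nonholo k 4 z) • 1 +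
        (-2 * (((√z.im)⁻¹ : ℝ) : ℂ) * shadow k 3 z) • dIm)) z := by
    exact (hasFDerivAt_of_differentiableOn hh' hz).add ((hasFDerivAt_nonholo k 2 hz).const_mul _)
  have hB' := ((hasFDerivAt_inv_sqrt_im hz).const_mul (-I)).mul (hasFDerivAt_shadow k 1 hz)
  have hfx : ∀ w : ℂ, 0 < w.im → partialX (N7 k ∘ UpperHalfPlane.ofComplex) w = A w :=
    fun w hw => by rw [partialX_eq (hf w hw), add_zero]
  have hfy : ∀ w : ℂ, 0 < w.im → partialY (N7 k ∘ UpperHalfPlane.ofComplex) w = I * A w + B w :=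
    fun w hw => by rw [partialY_eq (hf w hw), sub_zero]
  have hev : ∀ {g₁ g₂ : ℂ → ℂ}, (∀ w : ℂ, 0 < w.im → g₁ w = g₂ w) → fderiv ℝ g₁ z = fderiv ℝ g₂ z :=
    fun h => Filter.EventuallyEq.fderiv_eq
      (Filter.eventually_of_mem (isOpen_upperHalfPlane.mem_nhds hz) h)
  have hxx : partialX (partialX (N7 k ∘ UpperHalfPlane.ofComplex)) z =
      deriv (deriv (holo k)) z - 2 * π ^ 2 * I * nonholo k 4 z := by
    rw [partialX, hev hfx, hA'.fderiv]
    simp [dIm_apply]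
    ring
  have hyy : partialY (partialY (N7 k ∘ UpperHalfPlane.ofComplex)) z =
      -(deriv (deriv (holo k)) z - 2 * π ^ 2 * I * nonholo k 4 z) +
        I / 2 * ((((√z.im)⁻¹ : ℝ) : ℂ) ^ 3) * shadow k 1 z := by
    have hsum : HasFDerivAt (fun w => I * A w + B w) _ z := (hA'.const_mul I).add hB'
    rw [partialY, hev hfy, hsum.fderiv]
    simp [dIm_apply, dConj_apply]
    ring_nf
    simp only [Complex.I_sq, show I ^ 3 = -I by linear_combination I * Complex.I_sq]
    ring
  rw [hypLaplacian, hfx z hz, hfy z hz, hxx, hyy]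
  have hs : (((√z.im)⁻¹ : ℝ) : ℂ) ^ 2 * z.im = 1 := by
    rw [← Complex.ofReal_pow, inv_pow, Real.sq_sqrt hz.le, ← Complex.ofReal_mul,
      inv_mul_cancel₀ hz.ne', Complex.ofReal_one]
  simp only [hB]
  linear_combination (-(I / 2) * z.im * (((√z.im)⁻¹ : ℝ) : ℂ) * shadow k 1 z) * hs +
    (1 / 2 * I * z.im * A z - 1 / 2 * z.im * I * (((√z.im)⁻¹ : ℝ) : ℂ) * shadow k 1 z) * Complex.I_sq

/-! ### Growth -/

/-- Exponential growth in `Im τ`, uniformly in `Re τ`. -/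
def ExpGrowth (f : ℂ → ℂ) : Prop :=
  ∃ K C : ℝ, 0 ≤ K ∧ ∀ τ : ℂ, 1 ≤ τ.im → ‖f τ‖ ≤ K * Real.exp (C * τ.im)

theorem ExpGrowth.mul {f g : ℂ → ℂ} (hf : ExpGrowth f) (hg : ExpGrowth g) :
    ExpGrowth fun τ => f τ * g τ := by
  obtain ⟨K, C, hK, h⟩ := hf
  obtain ⟨K', C', hK', h'⟩ := hg
  refine ⟨K * K', C + C', mul_nonneg hK hK', fun τ hτ => ?_⟩
  rw [norm_mul, add_mul, Real.exp_add, mul_mul_mul_comm]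
  exact mul_le_mul (h τ hτ) (h' τ hτ) (norm_nonneg _) (by positivity)

theorem ExpGrowth.add {f g : ℂ → ℂ} (hf : ExpGrowth f) (hg : ExpGrowth g) :
    ExpGrowth fun τ => f τ + g τ := by
  obtain ⟨K, C, hK, h⟩ := hf
  obtain ⟨K', C', hK', h'⟩ := hg
  refine ⟨K + K', max C C', add_nonneg hK hK', fun τ hτ => ?_⟩
  have hy : 0 ≤ τ.im := zero_le_one.trans hτ
  rw [add_mul]
  refine (norm_add_le _ _).trans (add_le_add ((h τ hτ).trans ?_) ((h' τ hτ).trans ?_))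
  · gcongr; exact le_max_left _ _
  · gcongr; exact le_max_right _ _

theorem expGrowth_const (c : ℂ) : ExpGrowth fun _ => c :=
  ⟨‖c‖, 0, norm_nonneg c, fun τ _ => by simp⟩

theorem norm_exp_mul_add (x : ℝ) (b τ : ℂ) :
    ‖exp (π * I * x * τ + b)‖ = Real.exp b.re * Real.exp (-(π * x) * τ.im) := by
  rw [Complex.norm_exp, ← Real.exp_add]
  congr 1
  have : (π * I * x * τ : ℂ) = ((π * x : ℝ) : ℂ) * (τ * I) := by push_cast; ring
  rw [Complex.add_re, this, Complex.re_ofReal_mul, Complex.mul_I_re]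
  ring

theorem expGrowth_exp (x : ℝ) (b : ℂ) : ExpGrowth fun τ => exp (π * I * x * τ + b) :=
  ⟨Real.exp b.re, -(π * x), (Real.exp_pos _).le, fun τ _ => (norm_exp_mul_add x b τ).le⟩

/-- From (y-1)(|m|-S)² ≥ 0. It separates the growth in y from a summable series independent of y. -/
theorem thetaBound_mul_le (S : ℝ) {y : ℝ} (hy : 1 ≤ y) (m : ℤ) :
    thetaBound (S * y) y m ≤ Real.exp (π * S ^ 2 * y) * thetaBound S 1 m := by
  rw [thetaBound, thetaBound, ← Real.exp_add, Real.exp_le_exp]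
  have hm : (m : ℝ) ^ 2 = |(m : ℝ)| ^ 2 := (sq_abs _).symm
  have h1 : 0 ≤ π * ((y - 1) * (|(m : ℝ)| - S) ^ 2) :=
    mul_nonneg Real.pi_pos.le (mul_nonneg (by linarith) (sq_nonneg _))
  have h2 : 0 ≤ π * S ^ 2 := mul_nonneg Real.pi_pos.le (sq_nonneg _)
  rw [hm]
  nlinarith

theorem im_real_mul_add (r s : ℝ) (τ : ℂ) : (r * τ + s : ℂ).im = r * τ.im := by simp

theorem expGrowth_numer {r₁ r₂ : ℝ} (hr : ∀ m n : ℤ, ¬ (r₁ = m ∧ r₂ = n)) (s₁ s₂ : ℝ) :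
    ExpGrowth fun τ => numer (r₁ * τ + r₂) (s₁ * τ + s₂) τ := by
  obtain ⟨c, hc, hc'⟩ := exists_pos_le_norm_one_sub_exp r₁ r₂ hr one_pos
  have h1 : ExpGrowth fun τ => exp (π * I * (r₁ * τ + r₂)) := by
    convert expGrowth_exp r₁ (π * I * r₂) using 3
    ring
  refine h1.mul ⟨(∑' m, thetaBound |s₁ + 1 / 2| 1 m) / c, π * |s₁ + 1 / 2| ^ 2,
    div_nonneg (tsum_nonneg fun m => (thetaBound_pos _ _ _).le) hc.le, fun τ hτ => ?_⟩
  have hs : HasSum (fun m => thetaBound |s₁ + 1 / 2| 1 m / c *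
      Real.exp (π * |s₁ + 1 / 2| ^ 2 * τ.im)) _ :=
    (((summable_thetaBound |s₁ + 1 / 2| one_pos).hasSum).div_const c).mul_right _
  refine tsum_of_norm_bounded hs fun m => ?_
  have hy : 0 < τ.im := one_pos.trans_le hτ
  refine (norm_numerTerm_div_le (S := |s₁ + 1 / 2| * τ.im) hy hc (le_of_eq ?_) le_rfl m
    (hc' m τ hτ)).trans ?_
  · rw [im_real_mul_add, show s₁ * τ.im + τ.im / 2 = (s₁ + 1 / 2) * τ.im by ring, abs_mul,
      abs_of_pos hy]
  · rw [div_mul_eq_mul_div, mul_comm (thetaBound _ _ _)]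
    gcongr
    exact thetaBound_mul_le _ hτ m

theorem expGrowth_R (t₁ t₂ : ℝ) : ExpGrowth fun τ => R (t₁ * τ + t₂) τ := by
  refine ⟨2 * ∑' m, thetaBound |t₁ + 1 / 2| 1 m,
    -π * (t₁ + 1 / 4) + π * |t₁ + 1 / 2| ^ 2,
    mul_nonneg two_pos.le (tsum_nonneg fun m => (thetaBound_pos _ _ _).le), fun τ hτ => ?_⟩
  have hy : 0 < τ.im := one_pos.trans_le hτ
  have hs : HasSum (fun m => 2 * thetaBound |t₁ + 1 / 2| 1 m *
      Real.exp ((-π * (t₁ + 1 / 4) + π * |t₁ + 1 / 2| ^ 2) * τ.im)) _ :=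
    (((summable_thetaBound |t₁ + 1 / 2| one_pos).hasSum).mul_left 2).mul_right _
  simp only [R_eq]
  refine tsum_of_norm_bounded hs fun m => ?_
  refine (norm_rCoeff_mul_rExp_le m _ hy).trans ?_
  have h := thetaNorm_le (S := |t₁ + 1 / 2| * τ.im) (z := t₁ * τ + t₂) (τ := τ) (by
    rw [im_real_mul_add, show t₁ * τ.im + τ.im / 2 = (t₁ + 1 / 2) * τ.im by ring, abs_mul,
      abs_of_pos hy]) le_rfl m
  rw [im_real_mul_add] at h
  rw [mul_assoc]
  refine mul_le_mul_of_nonneg_left (h.trans ((mul_le_mul_of_nonneg_left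
    (thetaBound_mul_le _ hτ m) (Real.exp_pos _).le).trans (le_of_eq ?_))) two_pos.le
  rw [← mul_assoc, ← Real.exp_add, mul_comm]
  congr 2
  ring

theorem norm_sin_pi_mul (v : ℂ) : ‖Complex.sin (π * v)‖ =
    1 / 2 * Real.exp (π * v.im) * ‖1 - exp (2 * π * I * v)‖ := by
  have h : Complex.sin (π * v) = I / 2 * exp (-(π * I * v)) * (1 - exp (2 * π * I * v)) := by
    have e : exp (π * I * v) = exp (-(π * I * v)) * exp (2 * π * I * v) := by
      rw [← Complex.exp_add]; ring_nf
    rw [Complex.sin, show -(π * v) * I = -(π * I * v) by ring, show π * v * I = π * I * v by ring, e]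
    ring
  rw [h, norm_mul, norm_mul, norm_div, Complex.norm_I, Complex.norm_ofNat, Complex.norm_exp]
  congr 3
  have : -(π * I * v) = ((-π : ℝ) : ℂ) * (v * I) := by push_cast; ring
  rw [this, Complex.re_ofReal_mul, Complex.mul_I_re]
  ring

/-- Subtracting from s₁ its nearest integer puts the argument into the strip of `le_norm_theta` at
the cost of an exponential factor. There |sin πv| is bounded below by means of |1 - exp(2πiv)|. -/
theorem expGrowth_inv_theta {s₁ s₂ : ℝ} (hs : ∀ m n : ℤ, ¬ (s₁ = m ∧ s₂ = n)) :
    ExpGrowth fun τ => (theta (s₁ * τ + s₂) τ)⁻¹ := by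
  set n := round s₁ with hn
  set t := s₁ - n with ht
  have hts : ∀ m k : ℤ, ¬ (t = m ∧ s₂ = k) := fun m k h =>
    hs (m + n) k ⟨by push_cast; linarith [h.1], h.2⟩
  obtain ⟨c, hc, hc'⟩ := exists_pos_le_norm_one_sub_exp t s₂ hts one_pos
  have h1 : ExpGrowth fun τ => (theta (t * τ + s₂) τ)⁻¹ := by
    refine ⟨4 / c, π / 4 - π * t, by positivity, fun τ hτ => ?_⟩
    have hy : 0 < τ.im := one_pos.trans_le hτ
    have h2 := le_norm_theta (v := t * τ + s₂) (τ := τ) (by linarith) (by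
      rw [im_real_mul_add, abs_mul, abs_of_pos hy]
      have := abs_sub_round s₁
      rw [← hn, ← ht] at this
      nlinarith)
    have h3 := hc' 0 τ hτ
    rw [Int.cast_zero, mul_zero, zero_mul, zero_add] at h3
    rw [norm_sin_pi_mul, im_real_mul_add] at h2
    have h4 : c / 4 * Real.exp (-((π / 4 - π * t) * τ.im)) ≤ ‖theta (t * τ + s₂) τ‖ := by
      refine le_trans ?_ h2
      have e : Real.exp (-((π / 4 - π * t) * τ.im)) =
          Real.exp (-(π * τ.im / 4)) * Real.exp (π * (t * τ.im)) := by
        rw [← Real.exp_add]; ring_nf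
      rw [e]
      have h5 : 0 < Real.exp (-(π * τ.im / 4)) * Real.exp (π * (t * τ.im)) := by positivity
      nlinarith
    have h6 : 0 < c / 4 * Real.exp (-((π / 4 - π * t) * τ.im)) := by positivity
    rw [norm_inv]
    refine (inv_anti₀ h6 h4).trans (le_of_eq ?_)
    rw [mul_inv, inv_div, ← Real.exp_neg, neg_neg]
  have h2 : ∀ τ : ℂ, (theta (s₁ * τ + s₂) τ)⁻¹ = (-1) ^ n *
      exp (π * I * (n ^ 2 + 2 * n * t : ℝ) * τ + 2 * π * I * n * s₂) *
        (theta (t * τ + s₂) τ)⁻¹ := by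
    intro τ
    have h3 := theta_add_int_mul_tau (t * τ + s₂) τ n
    have h4 : (t : ℂ) * τ + s₂ + n * τ = s₁ * τ + s₂ := by rw [ht]; push_cast; ring
    rw [h4] at h3
    have h5 : ((-1 : ℂ) ^ n)⁻¹ = (-1) ^ n := by rw [← inv_zpow]; norm_num
    rw [h3, mul_inv, mul_inv, h5, ← Complex.exp_neg]
    congr 3
    push_cast
    ring
  simp_rw [h2]
  exact ((expGrowth_const _).mul (expGrowth_exp _ _)).mul h1

theorem expGrowth_muTilde {r₁ r₂ s₁ s₂ : ℝ} (hr : ∀ m n : ℤ, ¬ (r₁ = m ∧ r₂ = n))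
    (hs : ∀ m n : ℤ, ¬ (s₁ = m ∧ s₂ = n)) :
    ExpGrowth fun τ => muTilde (r₁ * τ + r₂) (s₁ * τ + s₂) τ := by
  have h : ∀ τ : ℂ, muTilde (r₁ * τ + r₂) (s₁ * τ + s₂) τ =
      numer (r₁ * τ + r₂) (s₁ * τ + s₂) τ * (theta (s₁ * τ + s₂) τ)⁻¹ +
        I / 2 * R ((r₁ - s₁ : ℝ) * τ + (r₂ - s₂ : ℝ)) τ := by
    intro τ
    rw [muTilde, mu_eq, div_eq_mul_inv]
    congr 3
    push_cast
    ring
  simp_rw [h]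
  exact ((expGrowth_numer hr _ _).mul (expGrowth_inv_theta hs)).add
    ((expGrowth_const _).mul (expGrowth_R _ _))

theorem offLattice_of_coords {r s : ℝ} (h : ∀ m n : ℤ, ¬ (r = m ∧ s = n)) (τ : ℍ) :
    OffLattice (r * τ + s) τ := by
  intro m n e
  have h1 := congrArg Complex.im e
  rw [im_real_mul_add] at h1
  have h2 : ((m : ℂ) + n * τ).im = n * (τ : ℂ).im := by simp
  rw [h2] at h1
  have h3 : r = n := mul_right_cancel₀ τ.im_pos.ne' h1
  refine h n m ⟨h3, ?_⟩
  rw [h3] at e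
  have : (s : ℂ) = m := by push_cast at e; linear_combination e
  exact_mod_cast this

/-! ### Behaviour at the cusps -/

/-- Factorization of `(98, 0; 0, 1) B` into a unimodular and an upper triangular matrix. -/
theorem exists_factorization (B : SL(2, ℤ)) : ∃ (B' : SL(2, ℤ)) (g b h : ℤ), 0 < g ∧ 0 < h ∧
    98 * B 0 0 = B' 0 0 * g ∧ 98 * B 0 1 = B' 0 0 * b + B' 0 1 * h ∧
    B 1 0 = B' 1 0 * g ∧ B 1 1 = B' 1 0 * b + B' 1 1 * h := by
  have hdet := det_eq B
  have hne : (98 * B 0 0).gcd (B 1 0) ≠ 0 := by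
    rw [Ne, Int.gcd_eq_zero_iff]
    rintro ⟨h1, h2⟩
    rw [h2] at hdet
    have : B 0 0 = 0 := by omega
    rw [this] at hdet
    simp at hdet
  have hg : 0 < (98 * B 0 0).gcd (B 1 0) := Nat.pos_of_ne_zero hne
  obtain ⟨p, q, hpq, hp, hq⟩ := Int.exists_gcd_one hg
  -- g is the content of the first column of diag(98,1)B. The primitive column (p, q) is completed
  -- to a unimodular matrix, and the determinant gives gh = 98, whence h > 0.
  set g : ℤ := ((98 * B 0 0).gcd (B 1 0) : ℤ) with hgdef
  have hg' : 0 < g := by rw [hgdef]; exact_mod_cast hg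
  obtain ⟨B', h0, h1⟩ := IsCoprime.exists_SL2_col (Int.isCoprime_iff_gcd_eq_one.2 hpq) 0
  have hdet' := det_eq B'
  rw [h0, h1] at hdet'
  refine ⟨B', g, B' 1 1 * (98 * B 0 1) - B' 0 1 * B 1 1, p * B 1 1 - q * (98 * B 0 1), hg', ?_,
    ?_, ?_, ?_, ?_⟩
  · have : g * (p * B 1 1 - q * (98 * B 0 1)) = 98 := by
      linear_combination (-B 1 1) * hp + 98 * B 0 1 * hq + 98 * hdet
    exact (mul_pos_iff_of_pos_left hg').1 (by rw [this]; norm_num)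
  · rw [h0, hp]
  · rw [h0]; linear_combination (-(98 * B 0 1)) * hdet'
  · rw [h1]; exact hq
  · rw [h1]; linear_combination (-B 1 1) * hdet'

/-- This expresses N₇ near a cusp through μ̃ at points whose real coordinates relative to σ do not
vary. The upper row of A is primitive, so its multiples by k/7 and by 1/2 are not integral and the
points stay off the lattice. -/
theorem N7_eq_of_dilate {k : ℤ} (hk : ¬ (7 : ℤ) ∣ k) {τ σ : ℍ} {A : SL(2, ℤ)}
    (h : dilate τ = A • σ) : N7 k τ = etaMultiplier A ^ (-3 : ℤ) *
      Complex.sqrt (autFactor A σ) *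
      (exp (π * I * (-((k / 7 - 1 / 2) ^ 2 * (A 0 0 : ℤ) ^ 2) : ℝ) * σ +
        -(π * I * (k / 7 - 1 / 2) ^ 2 * (A 0 0 : ℤ) * (A 0 1 : ℤ))) *
      muTilde ((k / 7 * (A 0 0 : ℤ) : ℝ) * σ + (k / 7 * (A 0 1 : ℤ) : ℝ))
        ((1 / 2 * (A 0 0 : ℤ) : ℝ) * σ + (1 / 2 * (A 0 1 : ℤ) : ℝ)) σ) ∧
      (∀ m n : ℤ, ¬ ((k / 7 * (A 0 0 : ℤ) : ℝ) = m ∧ (k / 7 * (A 0 1 : ℤ) : ℝ) = n)) ∧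
      (∀ m n : ℤ, ¬ ((1 / 2 * (A 0 0 : ℤ) : ℝ) = m ∧ (1 / 2 * (A 0 1 : ℤ) : ℝ) = n)) := by
  have hdet := det_eq A
  have h1 : ∀ m n : ℤ, ¬ ((k / 7 * (A 0 0 : ℤ) : ℝ) = m ∧ (k / 7 * (A 0 1 : ℤ) : ℝ) = n) := by
    rintro m n ⟨e1, e2⟩
    have e1' : k * A 0 0 = 7 * m := by
      have : (k * A 0 0 : ℝ) = 7 * m := by linarith
      exact_mod_cast this
    have e2' : k * A 0 1 = 7 * n := by
      have : (k * A 0 1 : ℝ) = 7 * n := by linarith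
      exact_mod_cast this
    exact hk ⟨m * A 1 1 - n * A 1 0,
      by linear_combination (-k) * hdet + A 1 1 * e1' - A 1 0 * e2'⟩
  have h2 : ∀ m n : ℤ, ¬ ((1 / 2 * (A 0 0 : ℤ) : ℝ) = m ∧ (1 / 2 * (A 0 1 : ℤ) : ℝ) = n) := by
    rintro m n ⟨e1, e2⟩
    have e1' : A 0 0 = 2 * m := by
      have : (A 0 0 : ℝ) = 2 * m := by linarith
      exact_mod_cast this
    have e2' : A 0 1 = 2 * n := by
      have : (A 0 1 : ℝ) = 2 * n := by linarith
      exact_mod_cast this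
    have : (1 : ℤ) = 2 * (m * A 1 1 - n * A 1 0) := by
      linear_combination (-1) * hdet + A 1 1 * e1' - A 1 0 * e2'
    omega
  refine ⟨?_, h1, h2⟩
  have hj := autFactor_ne_zero A σ
  have hσ := coe_smul_eq A σ
  set u : ℂ := (k / 7 * (A 0 0 : ℤ) : ℝ) * σ + (k / 7 * (A 0 1 : ℤ) : ℝ) with hu
  set v : ℂ := (1 / 2 * (A 0 0 : ℤ) : ℝ) * σ + (1 / 2 * (A 0 1 : ℤ) : ℝ) with hv
  have hu' : (k / 7 : ℂ) * (A • σ : ℍ) = u / autFactor A σ := by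
    rw [hσ, hu]; push_cast; ring
  have hv' : (1 / 2 : ℂ) * (A • σ : ℍ) = v / autFactor A σ := by
    rw [hσ, hv]; push_cast; ring
  have hexp : exp (-(π * I * (k / 7 - 1 / 2) ^ 2 * (A • σ : ℍ))) *
      exp (-(π * I * (A 1 0 : ℤ) * (u - v) ^ 2 / autFactor A σ)) =
      exp (π * I * (-((k / 7 - 1 / 2) ^ 2 * (A 0 0 : ℤ) ^ 2) : ℝ) * σ +
        -(π * I * (k / 7 - 1 / 2) ^ 2 * (A 0 0 : ℤ) * (A 0 1 : ℤ))) := by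
    rw [← Complex.exp_add, hσ, hu, hv]
    congr 1
    have hdet' := det_eq_complex A
    have hjA : ((A 1 0 : ℤ) : ℂ) * σ + (A 1 1 : ℤ) = autFactor A σ := rfl
    have e1 : (((A 0 0 : ℤ) : ℂ) * σ + (A 0 1 : ℤ)) / autFactor A σ +
        (A 1 0 : ℤ) * (((A 0 0 : ℤ) : ℂ) * σ + (A 0 1 : ℤ)) ^ 2 / autFactor A σ =
        (A 0 0 : ℤ) * (((A 0 0 : ℤ) : ℂ) * σ + (A 0 1 : ℤ)) := by
      rw [← add_div, div_eq_iff hj, ← hjA]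
      linear_combination (-(((A 0 0 : ℤ) : ℂ) * σ + (A 0 1 : ℤ))) * hdet'
    push_cast
    linear_combination (-(π * I * (k / 7 - 1 / 2) ^ 2) : ℂ) * e1
  rw [N7_eq, h, hu', hv', muTilde_smul (offLattice_of_coords h1 σ) (offLattice_of_coords h2 σ) A]
  linear_combination (etaMultiplier A ^ (-3 : ℤ) * Complex.sqrt (autFactor A σ) *
    muTilde u v σ) * hexp

theorem sqrt_eq_cpow (z : ℂ) : Complex.sqrt z = z ^ (1 / 2 : ℂ) := by
  simp [Complex.sqrt]

theorem growth_N7 {k : ℤ} (hk : ¬ (7 : ℤ) ∣ k) (B : SL(2, ℤ)) : ∃ C : ℝ,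
    (fun τ : ℍ => autFactor B τ ^ (-(1 / 2 : ℂ)) * N7 k (B • τ))
      =O[UpperHalfPlane.atImInfty] fun τ : ℍ => Real.exp (C * τ.im) := by
  obtain ⟨A, g, b, h, hg, hh, e00, e01, e10, e11⟩ := exists_factorization B
  have hg' : (0 : ℝ) < g := by exact_mod_cast hg
  have hh' : (0 : ℝ) < h := by exact_mod_cast hh
  have hhc : (h : ℂ) ≠ 0 := by exact_mod_cast hh.ne'
  let ρ : ℍ → ℍ := fun τ => ⟨((g : ℝ) * τ + (b : ℝ)) / (h : ℝ), by
    rw [Complex.div_ofReal_im, im_real_mul_add]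
    exact div_pos (mul_pos hg' τ.im_pos) hh'⟩
  have hρ : ∀ τ : ℍ, (ρ τ : ℂ) = (g * τ + b) / h := fun τ => by
    change (((g : ℝ) : ℂ) * τ + ((b : ℝ) : ℂ)) / ((h : ℝ) : ℂ) = _
    push_cast; rfl
  have hρim : ∀ τ : ℍ, (ρ τ : ℂ).im = g / h * τ.im := fun τ => by
    change ((((g : ℝ) : ℂ) * τ + ((b : ℝ) : ℂ)) / ((h : ℝ) : ℂ)).im = _
    rw [Complex.div_ofReal_im, im_real_mul_add]
    change (g : ℝ) * τ.im / h = _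
    ring
  have e00' : 98 * ((B 0 0 : ℤ) : ℂ) = (A 0 0 : ℤ) * g := by exact_mod_cast e00
  have e01' : 98 * ((B 0 1 : ℤ) : ℂ) = (A 0 0 : ℤ) * b + (A 0 1 : ℤ) * h := by exact_mod_cast e01
  have e10' : ((B 1 0 : ℤ) : ℂ) = (A 1 0 : ℤ) * g := by exact_mod_cast e10
  have e11' : ((B 1 1 : ℤ) : ℂ) = (A 1 0 : ℤ) * b + (A 1 1 : ℤ) * h := by exact_mod_cast e11
  have hj : ∀ τ : ℍ, autFactor B τ = h * autFactor A (ρ τ) := fun τ => by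
    rw [autFactor, autFactor, hρ, e10', e11']
    field_simp
    ring
  have hdil : ∀ τ : ℍ, dilate (B • τ) = A • ρ τ := fun τ => by
    apply UpperHalfPlane.ext
    have h1 := autFactor_ne_zero A (ρ τ)
    rw [coe_dilate, coe_smul_eq, coe_smul_eq, hj, hρ, ← mul_div_assoc, mul_add, ← mul_assoc, e00',
      e01']
    field_simp
    ring
  -- The non-integrality conditions involve only A and k, so they may be extracted at the arbitrary
  -- point i.
  obtain ⟨-, hr, hs⟩ := N7_eq_of_dilate hk (hdil UpperHalfPlane.I)
  obtain ⟨K, C, hK, hKC⟩ := (expGrowth_exp (-((k / 7 - 1 / 2) ^ 2 * (A 0 0 : ℤ) ^ 2) : ℝ)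
    (-(π * I * (k / 7 - 1 / 2) ^ 2 * (A 0 0 : ℤ) * (A 0 1 : ℤ)))).mul (expGrowth_muTilde hr hs)
  -- As j(B,τ) = h·j(A,ρτ), the product of the weight factors is h^{-1/2}, and h ≥ 1 is an integer.
  have hbound : ∀ τ : ℍ, ‖autFactor B τ ^ (-(1 / 2 : ℂ))‖ *
      ‖Complex.sqrt (autFactor A (ρ τ))‖ ≤ 1 := by
    intro τ
    have h0 := autFactor_ne_zero B τ
    have h1 : ‖Complex.sqrt (autFactor B τ)‖ ^ 2 = h * ‖autFactor A (ρ τ)‖ := by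
      rw [← norm_pow, sqrt_sq, hj, norm_mul, Complex.norm_intCast, abs_of_pos hh']
    have h2 : ‖Complex.sqrt (autFactor A (ρ τ))‖ ^ 2 = ‖autFactor A (ρ τ)‖ := by
      rw [← norm_pow, sqrt_sq]
    have h3 : (1 : ℝ) ≤ h := by exact_mod_cast (by omega : 1 ≤ h)
    have h4 : 0 < ‖Complex.sqrt (autFactor B τ)‖ := norm_pos_iff.2 (sqrt_ne_zero h0)
    rw [Complex.cpow_neg, ← sqrt_eq_cpow, norm_inv, inv_mul_le_iff₀ h4, mul_one]
    refine (sq_le_sq₀ (norm_nonneg _) h4.le).1 ?_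
    rw [h1, h2]
    exact le_mul_of_one_le_left (norm_nonneg _) h3
  refine ⟨C * (g / h), Asymptotics.IsBigO.of_bound (‖etaMultiplier A ^ (-3 : ℤ)‖ * K) ?_⟩
  -- This threshold makes Im ρτ = (g/h) Im τ at least 1, the range of `ExpGrowth`.
  have hev : ∀ᶠ τ : ℍ in UpperHalfPlane.atImInfty, (h / g : ℝ) ≤ τ.im :=
    (Filter.eventually_ge_atTop (h / g : ℝ)).comap UpperHalfPlane.im
  filter_upwards [hev] with τ hτ
  have h1 : 1 ≤ (ρ τ : ℂ).im := by
    rw [hρim]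
    rw [div_le_iff₀ hg'] at hτ
    rw [div_mul_eq_mul_div, le_div_iff₀ hh']
    linarith
  have h2 := hKC _ h1
  rw [hρim, ← mul_assoc] at h2
  have h3 := mul_le_mul (hbound τ) h2 (norm_nonneg _) zero_le_one
  rw [(N7_eq_of_dilate hk (hdil τ)).1, norm_mul, norm_mul, norm_mul, Real.norm_eq_abs,
    abs_of_pos (Real.exp_pos _)]
  have h4 := mul_le_mul_of_nonneg_left h3 (norm_nonneg (etaMultiplier A ^ (-3 : ℤ)))
  linarith

/-! ### N₇ as a harmonic weak Maass form. -/

theorem isHarmonicWeakMaassForm_N7 {k : ℤ} (hk : ¬ (7 : ℤ) ∣ k) :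
    IsHarmonicWeakMaassForm 1
      (CongruenceSubgroup.Gamma1 28 ⊓ CongruenceSubgroup.Gamma0 784) (N7 k) where
  odd := odd_one
  congruence := by
    refine ⟨784, by norm_num, fun A hA => ?_⟩
    have h := CongruenceSubgroup.Gamma_mem.1 hA
    have hdvd : ∀ n : ℤ, (n : ZMod 784) = 0 → (n : ZMod 28) = 0 := fun n hn => by
      rw [ZMod.intCast_zmod_eq_zero_iff_dvd] at hn ⊢
      exact dvd_trans (by norm_num) hn
    have hone : ∀ n : ℤ, (n : ZMod 784) = 1 → (n : ZMod 28) = 1 := fun n hn => by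
      have := hdvd (n - 1) (by push_cast; rw [hn, sub_self])
      push_cast at this
      exact sub_eq_zero.1 this
    exact ⟨(CongruenceSubgroup.Gamma1_mem _ _).2
      ⟨hone _ h.1, hone _ h.2.2.2, hdvd _ h.2.2.1⟩,
      CongruenceSubgroup.Gamma0_mem.2 h.2.2.1⟩
  le_Gamma0_four := by
    intro A hA
    have h : (784 : ℤ) ∣ A 1 0 := dvd_of_mem_Gamma0 hA.2
    rw [CongruenceSubgroup.Gamma0_mem, ZMod.intCast_zmod_eq_zero_iff_dvd]
    exact dvd_trans (by norm_num) h
  transform := by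
    intro A hA τ
    have hd : (28 : ℤ) ∣ A 1 1 - 1 := (dvd_of_mem_Gamma1 hA.1).2
    have hε : epsilonFactor (A 1 1) = 1 := if_pos (by omega)
    rw [N7_smul_of_mem_of_mem hk hA, hε, sqrt_eq_cpow]
    simp
  smooth := contDiffOn_N7 hk
  harmonic := fun τ => by
    have := hypLaplacian_N7 hk τ.im_pos
    simpa using this
  growth := fun B => by
    have := growth_N7 hk B
    simpa using this

end

end ZwegersForms

theorem corollary5p3 (k : ℤ) (hk : ¬ (7 : ℤ) ∣ k) :
    (∀ (A : SL(2, ℤ))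
        (hA : A ∈ CongruenceSubgroup.Gamma1 14 ⊓ CongruenceSubgroup.Gamma0 98)
        (τ : UpperHalfPlane),
      ZwegersForms.N7 k (A • τ) =
        ZwegersForms.etaMultiplier
            (ZwegersForms.twist 2 A (ZwegersForms.two_dvd_of_mem hA)) ^ (-3 : ℤ) *
          (-1 : ℂ) ^ (A 0 1 + (A 0 0 - 1) / 2) *
          Complex.I ^ (-(A 0 0 * A 0 1)) *
          Complex.sqrt (ZwegersForms.autFactor A τ) * ZwegersForms.N7 k τ) ∧
    (∀ A ∈ CongruenceSubgroup.Gamma1 28 ⊓ CongruenceSubgroup.Gamma0 784,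
      ∀ τ : UpperHalfPlane,
        ZwegersForms.N7 k (A • τ) =
          (ZwegersForms.jacobiExt (A 1 0) (A 1 1) : ℂ) *
            Complex.sqrt (ZwegersForms.autFactor A τ) * ZwegersForms.N7 k τ) ∧
    ZwegersForms.IsHarmonicWeakMaassForm 1
      (CongruenceSubgroup.Gamma1 28 ⊓ CongruenceSubgroup.Gamma0 784)
      (ZwegersForms.N7 k) := by
  exact ⟨fun _ hA τ => ZwegersForms.N7_smul_of_mem hk hA τ,
    fun _ hA τ => ZwegersForms.N7_smul_of_mem_of_mem hk hA τ,
    ZwegersForms.isHarmonicWeakMaassForm_N7 hk⟩
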